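/- A lattice is a full-rank discrete subgroup $L\subset\mathbb{R}^n$, and $\mathcal L_n^\circ$ denotes the set of lattices of covolume $1$, with the topology induced from the quotient topology on $GL_n(\mathbb{R})/GL_n(\mathbb{Z})$ via $P\mapsto P\mathbb{Z}^n$. For $L\in\mathcal L_n^\circ$ the Epstein zeta function is $\zeta(L,s)=\sum_{x\in L\setminus\{0\}}\|x\|^{-2s}$ for $\operatorname{Re}s>n/2$. The flat torus $\mathbb{R}^n/\Lambda$, $\Lambda\in\mathcal L_n^\circ$, has spectral zeta function $\zeta_{\mathbb{R}^n/\Lambda}(s)=\sum_{\lambda\neq0}m(\lambda)\lambda^{-s}$ for $\operatorname{Re}s>n/2$, where $m(\lambda)$ is the multiplicity of $\lambda$ as an eigenvalue of the Laplacian $-\Delta$ on smooth functions on $\mathbb{R}^n/\Lambda$. Both series converge for $\operatorname{Re}s>n/2$ and have meromorphic continuations to $\mathbb{C}$, holomorphic outside $s=n/2$, denoted by the same symbols; the height of the torus is $h(\mathbb{R}^n/\Lambda)=\zeta_{\mathbb{R}^n/\Lambda}'(0)$. An isometry-invariant real function $F$ on $\mathcal L_n^\circ$ has a strict local minimum at $L_0$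 if there is a neighbourhood $U$ of $L_0$ in $\mathcal L_n^\circ$ such that $F(L)>F(L_0)$ for every $L\in U$ that is not the image of $L_0$ under a linear isometry of $\mathbb{R}^n$; $L_0$ is $\zeta$-extreme at $s\in\mathbb{R}$ if $L\mapsto\zeta(L,s)$ has a strict local minimum at $L_0$. A finite nonempty set $X\subset\mathbb{S}^{n-1}$ is a spherical $t$-design if $\int_{\mathbb{S}^{n-1}}f\,dx=\frac1{|X|}\sum_{x\in X}f(x)$ for every homogeneous polynomial $f$ of degree $\le t$, where $dx$ is the surface measure normalized to total mass $1$. The layers of $L$ are the nonempty sets $\{x\in L: x\cdot x=m\}$, $m>0$; a layer holds a $t$-design if $m^{-1/2}$ times it is a spherical $t$-design. **Theorem.** Let $L\in\mathcal L_n^\circ$ be such that all its layers hold a $4$-design. Then: 1. $L$ is $\zeta$-extreme at $s$ for every real $s>n/2$. 2. The torus $\mathbb{R}^n/L^*$, where $L^*=\{y\in\mathbb{R}^n: y\cdot x\in\mathbb{Z}\text{ for all }x\in L\}$ is the dual lattice, achieves a strict local minimum of the height on the set of $n$-dimensional flat tori of covolume $1$; that is, $\Lambda\mapsto h(\mathbb{R}^n/\Lambda)$,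 $\Lambda\in\mathcal L_n^\circ$, has a strict local minimum at $L^*$. 3. If moreover $\zeta(L,s)<0$ for all $0<s<n/2$, then $L$ is $\zeta$-extreme at $s$ for every real $s>0$ with $s\neq n/2$. -/

import Mathlib

open Filter Topology MeasureTheory Module
open scoped RealInnerProductSpace ContDiff Laplacian

noncomputable section

/-! ### Lattices -/

/-- A (full rank) Euclidean lattice in `ℝⁿ`. -/
structure EuclideanLattice (n : ℕ) where
  toSubmodule : Submodule ℤ (EuclideanSpace ℝ (Fin n))
  discrete : DiscreteTopology toSubmodule
  isZLattice : IsZLattice ℝ toSubmodule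

attribute [instance] EuclideanLattice.discrete EuclideanLattice.isZLattice

instance EuclideanLattice.instMembership (n : ℕ) :
    Membership (EuclideanSpace ℝ (Fin n)) (EuclideanLattice n) :=
  ⟨fun L x => x ∈ L.toSubmodule⟩

/-- The lattice `ℤ b₁ ⊕ ⋯ ⊕ ℤ bₙ` with a given real basis. -/
def EuclideanLattice.ofBasis {n : ℕ} (b : Basis (Fin n) ℝ (EuclideanSpace ℝ (Fin n))) :
    EuclideanLattice n where
  toSubmodule := Submodule.span ℤ (Set.range b)
  discrete := inferInstance
  isZLattice := inferInstance

/-- The columns of an invertible matrix, as a basis of `ℝⁿ`. -/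
def columnBasis {n : ℕ} (P : GL (Fin n) ℝ) : Basis (Fin n) ℝ (EuclideanSpace ℝ (Fin n)) :=
  ((Pi.basisFun ℝ (Fin n)).map (Matrix.GeneralLinearGroup.toLin P).toLinearEquiv).map
    (WithLp.linearEquiv 2 ℝ (Fin n → ℝ)).symm

theorem columnBasis_apply {n : ℕ} (P : GL (Fin n) ℝ) (j : Fin n) :
    columnBasis P j = WithLp.toLp 2 (fun i => (P : Matrix (Fin n) (Fin n) ℝ) i j) := by
  ext i
  simp [columnBasis, Matrix.GeneralLinearGroup.toLin, Matrix.mulVec_single]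

/-- The lattice `P ℤⁿ`, for `P ∈ GLₙ(ℝ)`. -/
def EuclideanLattice.ofGL {n : ℕ} (P : GL (Fin n) ℝ) : EuclideanLattice n :=
  EuclideanLattice.ofBasis (columnBasis P)

/-- The quotient topology on the space `GLₙ(ℝ)/GLₙ(ℤ)` of lattices: a set of lattices is open
exactly when its preimage under `P ↦ P ℤⁿ` is open. -/
instance EuclideanLattice.instTopologicalSpace (n : ℕ) : TopologicalSpace (EuclideanLattice n) :=
  TopologicalSpace.coinduced EuclideanLattice.ofGL inferInstance

/-- The covolume of a lattice (for the Lebesgue measure). -/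
def EuclideanLattice.covol {n : ℕ} (L : EuclideanLattice n) : ℝ :=
  ZLattice.covolume L.toSubmodule

/-- The space of lattices of covolume `1`, with the subspace topology. -/
abbrev UnimodularLattice (n : ℕ) := {L : EuclideanLattice n // L.covol = 1}

/-- Two lattices are isometric if a linear isometry of `ℝⁿ` maps one onto the other. -/
def EuclideanLattice.Isometric {n : ℕ} (L M : EuclideanLattice n) : Prop :=
  ∃ u : EuclideanSpace ℝ (Fin n) ≃ₗᵢ[ℝ] EuclideanSpace ℝ (Fin n),
    u '' (L.toSubmodule : Set (EuclideanSpace ℝ (Fin n))) = M.toSubmodule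

/-! ### The dual lattice -/

/-- `{y | ⟪y, x⟫ ∈ ℤ for all x ∈ L}` -/
def dualSubmodule {n : ℕ} (L : Submodule ℤ (EuclideanSpace ℝ (Fin n))) :
    Submodule ℤ (EuclideanSpace ℝ (Fin n)) where
  carrier := {y | ∀ x ∈ L, ∃ k : ℤ, ⟪y, x⟫ = (k : ℝ)}
  zero_mem' := fun x _ => ⟨0, by simp⟩
  add_mem' := by
    intro y z hy hz x hx
    obtain ⟨k, hk⟩ := hy x hx
    obtain ⟨l, hl⟩ := hz x hx
    exact ⟨k + l, by rw [inner_add_left, hk, hl]; push_cast; ring⟩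
  smul_mem' := by
    intro c y hy x hx
    obtain ⟨k, hk⟩ := hy x hx
    refine ⟨c * k, ?_⟩
    rw [← Int.cast_smul_eq_zsmul ℝ, real_inner_smul_left, hk]
    push_cast
    ring

theorem dual_exists_basis {n : ℕ} (L : EuclideanLattice n) :
    ∃ b d : Basis (Fin n) ℝ (EuclideanSpace ℝ (Fin n)),
      (∀ i j, ⟪d i, b j⟫ = if i = j then 1 else 0) ∧
      L.toSubmodule = Submodule.span ℤ (Set.range b) ∧
      dualSubmodule L.toSubmodule = Submodule.span ℤ (Set.range d) := by
  classical
  have hr : finrank ℤ L.toSubmodule = n := by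
    rw [ZLattice.rank ℝ L.toSubmodule, finrank_euclideanSpace_fin]
  let b₀ : Basis (Fin n) ℤ L.toSubmodule := finBasisOfFinrankEq ℤ L.toSubmodule hr
  let b : Basis (Fin n) ℝ (EuclideanSpace ℝ (Fin n)) := b₀.ofZLatticeBasis ℝ L.toSubmodule
  have hb : L.toSubmodule = Submodule.span ℤ (Set.range b) :=
    (b₀.ofZLatticeBasis_span ℝ L.toSubmodule).symm
  let B : LinearMap.BilinForm ℝ (EuclideanSpace ℝ (Fin n)) := innerₗ _
  have hB : B.Nondegenerate := 
    ⟨fun x hx => inner_self_eq_zero.1 (hx x), fun x hx => inner_self_eq_zero.1 (hx x)⟩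
  refine ⟨b, B.dualBasis hB b, fun i j => ?_, hb, ?_⟩
  · have := B.apply_dualBasis_left hB b i j
    simp only [eq_comm (a := i)]
    exact this
  · rw [← B.dualSubmodule_span_of_basis hB b, ← hb]
    ext y
    rw [LinearMap.BilinForm.mem_dualSubmodule]
    refine forall₂_congr fun x _ => ?_
    rw [Submodule.mem_one]
    exact exists_congr fun k => eq_comm

/-- The dual lattice `L*`. -/
def EuclideanLattice.dual {n : ℕ} (L : EuclideanLattice n) : EuclideanLattice n where
  toSubmodule := dualSubmodule L.toSubmodule
  discrete := by
    obtain ⟨b, d, -, -, h⟩ := dual_exists_basis L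
    rw [h]
    infer_instance
  isZLattice := by
    obtain ⟨b, d, -, -, h⟩ := dual_exists_basis L
    exact @IsZLattice.mk ℝ _ _ _ _ _ (_) (by rw [h]; exact ZSpan.span_top d)

theorem covol_ofBasis {n : ℕ} (L : EuclideanLattice n)
    (b : Basis (Fin n) ℝ (EuclideanSpace ℝ (Fin n)))
    (h : L.toSubmodule = Submodule.span ℤ (Set.range b)) :
    L.covol = |(EuclideanSpace.basisFun (Fin n) ℝ).toBasis.det b| := by
  classical
  have hr : L = EuclideanLattice.ofBasis b := by
    cases L
    subst h
    rfl
  subst hr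
  let c : Basis (Fin n) ℤ (Submodule.span ℤ (Set.range b)) := b.restrictScalars ℤ
  have h1 := ZLattice.covolume_eq_det_mul_measureReal (Submodule.span ℤ (Set.range b))
    volume c (EuclideanSpace.basisFun (Fin n) ℝ).toBasis
  have h2 : (volume : Measure (EuclideanSpace ℝ (Fin n))).real
      (ZSpan.fundamentalDomain (EuclideanSpace.basisFun (Fin n) ℝ).toBasis) = 1 := by
    rw [measureReal_congr (ZSpan.fundamentalDomain_ae_parallelepiped _ volume)]
    simp [measureReal_def, OrthonormalBasis.volume_parallelepiped]
  rw [h2, mul_one] at h1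
  refine Eq.trans h1 ?_
  congr 2
  ext1 i
  simp [c]

theorem EuclideanLattice.covol_dual {n : ℕ} (L : EuclideanLattice n) (hL : L.covol = 1) :
    L.dual.covol = 1 := by
  classical
  obtain ⟨b, d, hbd, hb, hd⟩ := dual_exists_basis L
  have h1 := covol_ofBasis L b hb
  have h2 := covol_ofBasis L.dual d hd
  have h3 : (((EuclideanSpace.basisFun (Fin n) ℝ).toBasis.toMatrix d).transpose *
      (EuclideanSpace.basisFun (Fin n) ℝ).toBasis.toMatrix b) = 1 := by
    ext i j
    have := hbd i j
    rw [PiLp.inner_apply] at this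
    simp only [Matrix.mul_apply, Matrix.transpose_apply, Matrix.one_apply, ← this,
      Basis.toMatrix_apply]
    refine Finset.sum_congr rfl fun k _ => ?_
    simp [mul_comm]
  have h4 := congrArg Matrix.det h3
  rw [Matrix.det_mul, Matrix.det_transpose, Matrix.det_one, ← Basis.det_apply,
    ← Basis.det_apply] at h4
  have h5 : L.dual.covol * L.covol = 1 := by
    rw [h1, h2, ← abs_mul, h4, abs_one]
  rwa [hL, mul_one] at h5

/-- The dual of a lattice of covolume `1`, which again has covolume `1`. -/
def UnimodularLattice.dual {n : ℕ} (L : UnimodularLattice n) : UnimodularLattice n :=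
  ⟨L.1.dual, L.1.covol_dual L.2⟩

/-! ### Layers and spherical designs -/

/-- The set of lattice vectors `x` with `x ⬝ x = m`. -/
def EuclideanLattice.layer {n : ℕ} (L : EuclideanLattice n) (m : ℝ) :
    Set (EuclideanSpace ℝ (Fin n)) :=
  {x | x ∈ L ∧ ⟪x, x⟫ = m}

/-- `X` is a finite nonempty subset of the unit sphere such that every homogeneous polynomial of
degree at most `t` has the same average over `X` and over the sphere (for the surface measure,
normalized to have total mass one). -/
structure IsSphericalDesign {n : ℕ} (t : ℕ) (X : Set (EuclideanSpace ℝ (Fin n))) : Prop where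
  finite : X.Finite
  nonempty : X.Nonempty
  subset_sphere : X ⊆ Metric.sphere 0 1
  average_eq : ∀ d ≤ t, ∀ f : MvPolynomial (Fin n) ℝ, f.IsHomogeneous d →
    (⨍ x : Metric.sphere (0 : EuclideanSpace ℝ (Fin n)) 1,
        MvPolynomial.eval (fun i => x.1 i) f
          ∂((volume : Measure (EuclideanSpace ℝ (Fin n))).toSphere)) =
      (1 / (X.ncard : ℝ)) * ∑ x ∈ finite.toFinset, MvPolynomial.eval (fun i => x i) f

/-- Every layer of nonzero vectors, rescaled to the unit sphere, is a spherical `t`-design. -/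
def EuclideanLattice.LayersHoldDesign {n : ℕ} (t : ℕ) (L : EuclideanLattice n) : Prop :=
  ∀ m : ℝ, 0 < m → (L.layer m).Nonempty →
    IsSphericalDesign t ((fun x => (Real.sqrt m)⁻¹ • x) '' L.layer m)

/-! ### Meromorphic continuation of series -/

/-- `Z` is a meromorphic continuation to `ℂ` of the function `s ↦ ∑ᵢ f i s`, the series being
convergent on the half plane `Re s > σ`, and `Z` has no pole except possibly at `s = σ`.
These properties determine `Z` on `ℂ \ {σ}`. -/
structure IsMeromorphicContinuation {ι : Type} (σ : ℝ) (f : ι → ℂ → ℂ) (Z : ℂ → ℂ) : Prop where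
  hasSum : ∀ s : ℂ, σ < s.re → HasSum (fun i => f i s) (Z s)
  differentiableOn : DifferentiableOn ℂ Z {(σ : ℂ)}ᶜ
  meromorphic : Meromorphic Z

open Classical in
/-- The meromorphic continuation of `s ↦ ∑ᵢ f i s` (and `0` if there is none). -/
def continuedSum {ι : Type} (σ : ℝ) (f : ι → ℂ → ℂ) : ℂ → ℂ :=
  if h : ∃ Z, IsMeromorphicContinuation σ f Z then h.choose else 0

/-! ### The Epstein zeta function -/

/-- The term `‖x‖ ^ (-2 s)` of the Epstein zeta series, for `x ∈ L \ {0}`. -/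
def epsteinTerm {n : ℕ} (L : EuclideanLattice n)
    (x : {x : EuclideanSpace ℝ (Fin n) // x ∈ L ∧ x ≠ 0}) (s : ℂ) : ℂ :=
  ((‖x.1‖ : ℝ) : ℂ) ^ (-2 * s)

/-- The Epstein zeta function `ζ(L, ·)`, continued to the complex plane. -/
def epsteinZeta {n : ℕ} (L : EuclideanLattice n) : ℂ → ℂ :=
  continuedSum ((n : ℝ) / 2) (epsteinTerm L)

/-! ### Flat tori and their heights -/

/-- The eigenspace, for the eigenvalue `μ`, of the (positive) Laplacian `-Δ` acting on the smooth
complex functions on the flat torus `ℝⁿ/Λ`, that is, on the smooth `Λ`-periodic functions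
on `ℝⁿ`. -/
def torusEigenspace {n : ℕ} (Λ : EuclideanLattice n) (μ : ℝ) :
    Submodule ℂ (EuclideanSpace ℝ (Fin n) → ℂ) where
  carrier := {f | ContDiff ℝ ∞ f ∧ (∀ v ∈ Λ, ∀ x, f (x + v) = f x) ∧
    ∀ x, -(Δ f x) = (μ : ℂ) * f x}
  zero_mem' := by
    refine ⟨contDiff_const, fun v _ x => rfl, fun x => ?_⟩
    have h : (Δ (0 : EuclideanSpace ℝ (Fin n) → ℂ)) x = 0 := by
      have := InnerProductSpace.laplacian_smul (0 : ℝ)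
        (contDiff_const (c := (0 : ℂ)) : ContDiff ℝ 2
          (fun _ : EuclideanSpace ℝ (Fin n) => (0 : ℂ))).contDiffAt (x := x)
      simpa using this
    rw [h]
    simp
  add_mem' := by
    rintro f g ⟨hf, hf', hf''⟩ ⟨hg, hg', hg''⟩
    refine ⟨hf.add hg, fun v hv x => ?_, fun x => ?_⟩
    · simp only [Pi.add_apply, hf' v hv x, hg' v hv x]
    · have hf2 : ContDiff ℝ 2 f := mod_cast contDiff_infty.1 hf 2
      have hg2 : ContDiff ℝ 2 g := mod_cast contDiff_infty.1 hg 2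
      rw [hf2.contDiffAt.laplacian_add hg2.contDiffAt, neg_add, hf'' x, hg'' x, Pi.add_apply,
        mul_add]
  smul_mem' := by
    rintro c f ⟨hf, hf', hf''⟩
    refine ⟨hf.const_smul c, fun v hv x => ?_, fun x => ?_⟩
    · simp only [Pi.smul_apply, hf' v hv x]
    · have hf2 : ContDiff ℝ 2 f := mod_cast contDiff_infty.1 hf 2
      have h := hf2.contDiffAt (x := x) |>.laplacian_CLM_comp_left
        (l := (ContinuousLinearMap.mul ℝ ℂ) c)
      have h' : (Δ (c • f)) x = c * (Δ f) x := h
      rw [h', Pi.smul_apply, smul_eq_mul, mul_left_comm, ← hf'' x]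
      ring

/-- The term `m(μ) μ ^ (-s)` of the spectral zeta series of the torus `ℝⁿ/Λ`, where `m(μ)` is the
multiplicity of `μ ≠ 0` as an eigenvalue of the Laplacian (`0` if it is not an eigenvalue). -/
def torusZetaTerm {n : ℕ} (Λ : EuclideanLattice n) (μ : {μ : ℝ // μ ≠ 0}) (s : ℂ) : ℂ :=
  (finrank ℂ (torusEigenspace Λ μ.1) : ℂ) * ((μ.1 : ℝ) : ℂ) ^ (-s)

/-- The spectral zeta function of the flat torus `ℝⁿ/Λ`, continued to the complex plane. -/
def torusZeta {n : ℕ} (Λ : EuclideanLattice n) : ℂ → ℂ :=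
  continuedSum ((n : ℝ) / 2) (torusZetaTerm Λ)

/-- The height of the flat torus `ℝⁿ/Λ`: the derivative at `0` of its spectral zeta function
(which is real on the real axis). -/
def torusHeight {n : ℕ} (Λ : EuclideanLattice n) : ℝ :=
  (deriv (torusZeta Λ) 0).re

/-! ### Strict local minima -/

/-- `F`, a function invariant under isometries, has a strict local minimum at `L₀` among the
lattices of covolume `1`; as usual, lattices are considered up to isometry here: near `L₀`,
every lattice that is not isometric to `L₀` has a strictly larger value of `F`. -/
def IsStrictLocalMinLattice {n : ℕ} (F : EuclideanLattice n → ℝ) (L₀ : UnimodularLattice n) :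
    Prop :=
  ∀ᶠ L in 𝓝 L₀, EuclideanLattice.Isometric L₀.1 L.1 ∨ F L₀.1 < F L.1

/-- `L₀` is `ζ`-extreme at the real number `s` (where `ζ(L, s)` is real). -/
def IsZetaExtreme {n : ℕ} (L₀ : UnimodularLattice n) (s : ℝ) : Prop :=
  IsStrictLocalMinLattice (fun L => (epsteinZeta L (s : ℂ)).re) L₀

end

/-!
The idea is to test a lattice `L` of covolume `1` whose layers hold `4`-designs against its
deformations. By the polar decomposition, a unimodular lattice near `L` is, up to an isometry, the
image of `L` under a positive definite map of determinant `1` close to the identity, with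
orthonormal eigenvectors `vᵢ` and eigenvalues `exp (τ hᵢ / 2)`, where `∑ hᵢ = 0` and `∑ hᵢ² = 1`
(`EuclideanLattice.eventually_eq_map_spectralMap`); it is isometric to `L` if the deformation is
trivial.

Write `θ t = ∑ exp (-π t ‖x‖²)` for the theta series over the nonzero `x` in `L`. Along the
deformation its coefficients of `τ` and `τ²` are sums over the layers of `L` of the quadratic form
`∑ hᵢ ⟪vᵢ, x⟫²`, of its square, and of `∑ hᵢ² ⟪vᵢ, x⟫²`. The design property evaluates them: the
linear term vanishes because `∑ hᵢ = 0`, and the quadratic term is a function `D t` that depends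
neither on `vᵢ` nor on `hᵢ` (`EuclideanLattice.designKernel`). Hence the theta series of the
deformation is `θ t + τ² D t + O(τ³)`. The remainder is bounded by `τ³` times a function of `t` that
decays rapidly at `∞`, because the series does, and also at `0`, because of the functional equation
of the theta series; the uniqueness of Taylor coefficients shows that the expansions obtained on the
two sides of the functional equation are the same
(`EuclideanLattice.theta_map_spectralMap_expansion`).

The completed zeta function `Λ s = π⁻ˢ Γ(s) ζ(L, s)` equals `Λ₀ s - 1 / s - 1 / (n / 2 - s)` with
`Λ₀` entire, and the difference of the `Λ₀` of two lattices is the Mellin transform of the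
difference of their theta series, for every `s`. So the expansion can be integrated: `Λ₀ s` changes
by `τ² 𝒟 s + O(τ³)`, with `𝒟` the Mellin transform of `D`
(`EuclideanLattice.exists_norm_Λ₀_sub_le`). For large `Re s` the transform can be computed term by
term, and by analytic continuation
`2 n (n + 2) 𝒟 s = s (2 s - n) Λ₀ s + n` everywhere (`EuclideanLattice.mellin_designKernel_eq`).
For `s ≠ 0, n / 2` the right hand side is `s (2 s - n) Λ s`, which is positive for real `s > n / 2`,
and also for `0 < s < n / 2` if `ζ(L, s) < 0`; at `s = 0` it is `n > 0`. Wherever `𝒟 s > 0`, all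
small nontrivial deformations increase `Λ₀ s`, hence `ζ(L, s)`.

The height of a torus `ℝⁿ/Λ` is treated at `s = 0`. Its eigenfunctions are spanned by the characters
with frequencies in `Λ*`, so its spectral zeta function is `(4 π²)⁻ˢ ζ(Λ*, s)`, and its height is
the value at `0` of the `Λ₀` of `Λ*`, up to a constant which depends only on `n`
(`exists_torusHeight_eq`). The dual of a deformation of `L*` is the inverse deformation of `L`.
-/

/-! ### Gaussian sums over a lattice -/

/-- The nonzero vectors of a lattice. -/
abbrev EuclideanLattice.Nonzero {n : ℕ} (L : EuclideanLattice n) : Type :=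
  {x : EuclideanSpace ℝ (Fin n) // x ∈ L ∧ x ≠ 0}

namespace EuclideanLattice

variable {n : ℕ} (L : EuclideanLattice n)

theorem finrank_toSubmodule : finrank ℤ L.toSubmodule = n := by
  rw [ZLattice.rank ℝ L.toSubmodule, finrank_euclideanSpace_fin]

/-- Nonzero lattice vectors, as a subset of the lattice. -/
def Nonzero.toLattice (x : L.Nonzero) : L.toSubmodule := ⟨x.1, x.2.1⟩

theorem Nonzero.toLattice_injective : Function.Injective (Nonzero.toLattice L) := fun _ _ h =>
  Subtype.ext (congrArg (fun z : L.toSubmodule => z.1) h)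

instance : Countable L.Nonzero := (Nonzero.toLattice_injective L).countable

theorem exists_norm_lower_bound : ∃ r : ℝ, 0 < r ∧ ∀ x : L.Nonzero, r ≤ ‖x.1‖ := by
  let b : Basis (Fin n) ℤ L.toSubmodule := finBasisOfFinrankEq ℤ _ L.finrank_toSubmodule
  refine ⟨ZLattice.normBound b, ZLattice.normBound_pos b, fun x => ?_⟩
  have hx : Nonzero.toLattice L x ≠ 0 := fun h => x.2.2 (congrArg Subtype.val h)
  obtain ⟨i, hi⟩ : ∃ i, b.repr (Nonzero.toLattice L x) i ≠ 0 := by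
    by_contra! h
    exact hx (b.repr.map_eq_zero_iff.1 (Finsupp.ext h))
  have h1 : (1 : ℝ) ≤ |((b.repr (Nonzero.toLattice L x) i : ℤ) : ℝ)| := by
    exact_mod_cast Int.one_le_abs hi
  have h2 := ZLattice.normBound_spec b (Nonzero.toLattice L x) i
  have h3 := ZLattice.normBound_pos b
  calc ZLattice.normBound b = ZLattice.normBound b * 1 := (mul_one _).symm
    _ ≤ ZLattice.normBound b * |((b.repr (Nonzero.toLattice L x) i : ℤ) : ℝ)| := by gcongr
    _ ≤ ‖x.1‖ := by exact_mod_cast h2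

theorem Nonzero.norm_pos (x : L.Nonzero) : 0 < ‖x.1‖ := norm_pos_iff.2 x.2.2

theorem summable_norm_rpow {r : ℝ} (hr : r < -(n : ℝ)) :
    Summable fun x : L.Nonzero => ‖x.1‖ ^ r := by
  have h := ZLattice.summable_norm_rpow L.toSubmodule r (by rwa [L.finrank_toSubmodule])
  exact (h.comp_injective (Nonzero.toLattice_injective L)).congr fun _ => rfl

theorem summable_exp_neg_mul_sq {a : ℝ} (ha : 0 < a) :
    Summable fun x : L.Nonzero => Real.exp (-a * ‖x.1‖ ^ 2) := by
  have h := (L.summable_norm_rpow (r := -((2 * (n + 1) : ℕ) : ℝ)) (by push_cast; linarith)).mul_left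
    ((n + 1).factorial / a ^ (n + 1))
  refine Summable.of_nonneg_of_le (fun x => (Real.exp_pos _).le) (fun x => ?_) h
  have hx := Nonzero.norm_pos L x
  have h1 := Real.pow_div_factorial_le_exp (a * ‖x.1‖ ^ 2) (by positivity) (n + 1)
  rw [Real.rpow_neg hx.le, Real.rpow_natCast, neg_mul, Real.exp_neg, pow_mul]
  rw [← inv_div, ← mul_inv, inv_le_inv₀ (Real.exp_pos _) (by positivity)]
  refine le_trans (le_of_eq ?_) h1
  rw [mul_pow]
  field

theorem summable_pow_mul_exp_neg_mul_sq {a : ℝ} (ha : 0 < a) (j : ℕ) :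
    Summable fun x : L.Nonzero => (‖x.1‖ ^ 2) ^ j * Real.exp (-a * ‖x.1‖ ^ 2) := by
  have h := (L.summable_exp_neg_mul_sq (a := a / 2) (by positivity)).mul_left
    (j.factorial / (a / 2) ^ j)
  refine Summable.of_nonneg_of_le (fun x => by positivity) (fun x => ?_) h
  have h1 := Real.pow_div_factorial_le_exp (a / 2 * ‖x.1‖ ^ 2) (by positivity) j
  have h2 : (‖x.1‖ ^ 2) ^ j ≤ j.factorial / (a / 2) ^ j * Real.exp (a / 2 * ‖x.1‖ ^ 2) := by
    calc (‖x.1‖ ^ 2) ^ j = j.factorial / (a / 2) ^ j *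
        ((a / 2 * ‖x.1‖ ^ 2) ^ j / j.factorial) := by rw [mul_pow]; field
      _ ≤ _ := by gcongr
  calc (‖x.1‖ ^ 2) ^ j * Real.exp (-a * ‖x.1‖ ^ 2)
      ≤ j.factorial / (a / 2) ^ j * Real.exp (a / 2 * ‖x.1‖ ^ 2) * Real.exp (-a * ‖x.1‖ ^ 2) := by
        gcongr
    _ = _ := by
      rw [mul_assoc, ← Real.exp_add]
      ring_nf

theorem summable_exp_neg_mul_sq_toSubmodule {a : ℝ} (ha : 0 < a) :
    Summable fun x : L.toSubmodule => Real.exp (-a * ‖x.1‖ ^ 2) := by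
  have h : Summable ((fun x : L.toSubmodule => Real.exp (-a * ‖x.1‖ ^ 2)) ∘
      ((↑) : ({0}ᶜ : Set L.toSubmodule) → L.toSubmodule)) := by
    have h1 := L.summable_exp_neg_mul_sq ha
    exact h1.comp_injective (i := fun x : ({0}ᶜ : Set L.toSubmodule) =>
      (⟨x.1.1, x.1.2, fun h => x.2 (Subtype.ext h)⟩ : L.Nonzero))
      (fun x y hxy => Subtype.ext (Subtype.ext (congrArg (fun z : L.Nonzero => z.1) hxy)))
  exact ((Set.finite_singleton 0).summable_compl_iff).1 h

/-- The sum `∑ exp (-π t ‖x‖²)` over the nonzero vectors of the lattice, that is, its theta series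
without the constant term. -/
noncomputable def theta (t : ℝ) : ℝ := ∑' x : L.Nonzero, Real.exp (-(Real.pi * t) * ‖x.1‖ ^ 2)

theorem tsum_toSubmodule_eq_one_add_theta {t : ℝ} (ht : 0 < t) :
    ∑' x : L.toSubmodule, Real.exp (-(Real.pi * t) * ‖x.1‖ ^ 2) = 1 + L.theta t := by
  classical
  have h := L.summable_exp_neg_mul_sq_toSubmodule (a := Real.pi * t) (by positivity)
  rw [h.tsum_eq_add_tsum_ite 0]
  congr 1
  · simp
  · let g : L.Nonzero → L.toSubmodule := Nonzero.toLattice L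
    have hg : Function.Injective g := Nonzero.toLattice_injective L
    rw [theta, ← hg.tsum_eq (f := fun x : L.toSubmodule =>
      if x = 0 then 0 else Real.exp (-(Real.pi * t) * ‖x.1‖ ^ 2))]
    · refine tsum_congr fun x => ?_
      have : g x ≠ 0 := fun h => x.2.2 (congrArg Subtype.val h)
      simp only [this, if_false]
      rfl
    · intro x hx
      have hx0 : x ≠ 0 := by
        rintro rfl
        simp at hx
      exact ⟨⟨x.1, x.2, fun h => hx0 (Subtype.ext h)⟩, rfl⟩

theorem theta_nonneg (t : ℝ) : 0 ≤ L.theta t := tsum_nonneg fun _ => (Real.exp_pos _).le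

/-- Gaussian sums over the nonzero vectors decay faster than any power. -/
theorem exists_theta_mul_rpow_le {c : ℝ} (hc : 0 < c) (a : ℝ) :
    ∃ C : ℝ, 0 ≤ C ∧ ∀ t : ℝ, 1 ≤ t → L.theta (c * t) * t ^ a ≤ C := by
  obtain ⟨r, hr, hr'⟩ := L.exists_norm_lower_bound
  obtain ⟨N, hN⟩ := exists_nat_ge a
  have hπ := Real.pi_pos
  set k : ℝ := Real.pi * c * r ^ 2 with hk
  have hk0 : 0 < k := by positivity
  have hs := L.summable_exp_neg_mul_sq (a := Real.pi * c) (by positivity)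
  refine ⟨L.theta c * Real.exp k * (N.factorial / k ^ N), by
    have := L.theta_nonneg c; positivity, fun t ht => ?_⟩
  -- every `x` contributes to `θ (c t)` at most its contribution to `θ c` times `exp (-k (t - 1))`
  have h1 : L.theta (c * t) ≤ L.theta c * Real.exp (-(k * (t - 1))) := by
    rw [theta, theta, ← tsum_mul_right]
    refine Summable.tsum_le_tsum (fun x => ?_)
      (by simpa [mul_assoc] using
        L.summable_exp_neg_mul_sq (a := Real.pi * (c * t)) (by positivity))
      (hs.mul_right _)
    rw [← Real.exp_add, Real.exp_le_exp]
    have h2 : r ^ 2 ≤ ‖x.1‖ ^ 2 := by gcongr; exact hr' x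
    have h3 : k * (t - 1) ≤ Real.pi * c * ‖x.1‖ ^ 2 * (t - 1) := by
      have : 0 ≤ t - 1 := by linarith
      rw [hk]; gcongr
    linarith
  have h4 : t ^ a ≤ N.factorial / k ^ N * Real.exp (k * t) := by
    calc t ^ a ≤ t ^ (N : ℝ) := Real.rpow_le_rpow_of_exponent_le ht hN
      _ = N.factorial / k ^ N * ((k * t) ^ N / N.factorial) := by
        rw [Real.rpow_natCast, mul_pow]; field
      _ ≤ _ := by
        gcongr
        exact Real.pow_div_factorial_le_exp _ (by positivity) N
  have h5 := L.theta_nonneg c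
  calc L.theta (c * t) * t ^ a
      ≤ (L.theta c * Real.exp (-(k * (t - 1)))) * (N.factorial / k ^ N * Real.exp (k * t)) := by
        gcongr
    _ = L.theta c * (Real.exp (-(k * (t - 1))) * Real.exp (k * t)) * (N.factorial / k ^ N) := by
        ring
    _ = _ := by
        rw [← Real.exp_add]
        ring_nf

/-- The sum `∑ ‖x‖²ʲ exp (-π t ‖x‖²)` over the nonzero vectors of the lattice. -/
noncomputable def momentTheta (j : ℕ) (t : ℝ) : ℝ :=
  ∑' x : L.Nonzero, (‖x.1‖ ^ 2) ^ j * Real.exp (-(Real.pi * t) * ‖x.1‖ ^ 2)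

theorem momentTheta_zero (t : ℝ) : L.momentTheta 0 t = L.theta t := by
  simp [momentTheta, theta]

theorem continuousOn_momentTheta (j : ℕ) : ContinuousOn (L.momentTheta j) (Set.Ioi 0) := by
  intro t₀ ht₀
  have ht₀' : 0 < t₀ := ht₀
  have h : ContinuousOn (L.momentTheta j) (Set.Ioi (t₀ / 2)) := by
    refine continuousOn_tsum (fun x => by fun_prop)
      (L.summable_pow_mul_exp_neg_mul_sq (a := Real.pi * (t₀ / 2)) (by positivity) j)
      (fun x t ht => ?_)
    rw [Real.norm_of_nonneg (by positivity)]
    have : t₀ / 2 ≤ t := (Set.mem_Ioi.1 ht).le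
    have hπ := Real.pi_pos
    gcongr
  exact (h.continuousAt (Ioi_mem_nhds (by linarith))).continuousWithinAt

end EuclideanLattice

/-! ### Multiple Fourier series -/

/-- The half-open unit cube; the sides are written `(0, 0 + 1]` as a special case of the cubes with
sides `(aᵢ, aᵢ + 1]`, over which the Fourier coefficients of functions on the torus are computed. -/
def unitCube (n : ℕ) : Set (Fin n → ℝ) := {x | ∀ i, x i ∈ Set.Ioc (0 : ℝ) (0 + 1)}

/-- The character `x ↦ exp (2 π i m ⬝ x)` of `ℝⁿ`. -/
noncomputable def cubeChar {n : ℕ} (m : Fin n → ℤ) (x : Fin n → ℝ) : ℂ :=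
  Complex.exp (2 * Real.pi * Complex.I * ∑ i, (m i : ℂ) * (x i : ℂ))

theorem mFourier_coe {n : ℕ} (m : Fin n → ℤ) (x : Fin n → ℝ) :
    UnitAddTorus.mFourier m (fun i => (x i : UnitAddCircle)) = cubeChar m x := by
  simp only [UnitAddTorus.mFourier, ContinuousMap.coe_mk, cubeChar, Finset.mul_sum, Complex.exp_sum]
  refine Finset.prod_congr rfl fun i _ => ?_
  rw [fourier_coe_apply]
  congr 1
  push_cast
  ring

/-- A continuous `ℤⁿ`-periodic function descends to a continuous function on the torus. -/
theorem exists_continuousMap_torus {n : ℕ} {f : (Fin n → ℝ) → ℂ} (hf : Continuous f)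
    (hper : ∀ x, ∀ k : Fin n → ℤ, f (fun i => x i + k i) = f x) :
    ∃ F : C(UnitAddTorus (Fin n), ℂ), ∀ x, F (fun i => (x i : UnitAddCircle)) = f x := by
  let p : (Fin n → ℝ) → UnitAddTorus (Fin n) := fun x i => (x i : UnitAddCircle)
  have hp : IsOpenQuotientMap p :=
    IsOpenQuotientMap.piMap (fun _ => QuotientAddGroup.isOpenQuotientMap_mk)
  have hfac : ∀ x y, p x = p y → f x = f y := by
    intro x y hxy
    have : ∀ i, ∃ k : ℤ, x i = y i + k := by
      intro i
      have h := congrFun hxy i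
      obtain ⟨k, hk⟩ := AddSubgroup.mem_zmultiples_iff.1 ((QuotientAddGroup.eq).1 h.symm)
      refine ⟨k, ?_⟩
      have : (k : ℝ) = -y i + x i := by simpa using hk
      linarith
    choose k hk using this
    rw [← hper y k]
    exact congrArg f (funext hk)
  refine ⟨⟨fun z => f (Function.surjInv hp.surjective z), ?_⟩, fun x => ?_⟩
  · refine hp.isQuotientMap.continuous_iff.2 ?_
    refine hf.congr fun x => ?_
    exact hfac _ _ (Function.surjInv_eq hp.surjective (p x)).symm
  · exact hfac _ _ (Function.surjInv_eq hp.surjective (p x))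

/-- A continuous `ℤⁿ`-periodic function with summable Fourier coefficients is the sum of its Fourier
series. -/
theorem hasSum_cubeChar_of_summable {n : ℕ} {f : (Fin n → ℝ) → ℂ} (hf : Continuous f)
    (hper : ∀ x, ∀ k : Fin n → ℤ, f (fun i => x i + k i) = f x)
    (hsum : Summable fun m : Fin n → ℤ => ∫ y in unitCube n, cubeChar (-m) y * f y)
    (x : Fin n → ℝ) :
    HasSum (fun m : Fin n → ℤ => (∫ y in unitCube n, cubeChar (-m) y * f y) * cubeChar m x)
      (f x) := by
  obtain ⟨F, hF⟩ := exists_continuousMap_torus hf hper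
  have hc : ∀ m, UnitAddTorus.mFourierCoeff F m = ∫ y in unitCube n, cubeChar (-m) y * f y := by
    intro m
    rw [UnitAddTorus.mFourierCoeff_eq_integral F m 0]
    refine integral_congr_ae (Eventually.of_forall fun y => ?_)
    simp only [mFourier_coe, hF, smul_eq_mul]
  have h := UnitAddTorus.hasSum_mFourier_series_apply_of_summable (f := F)
    (by rwa [show UnitAddTorus.mFourierCoeff F = _ from funext hc])
    (fun i => (x i : UnitAddCircle))
  rw [hF] at h
  refine h.congr_fun fun m => ?_
  rw [hc, mFourier_coe, smul_eq_mul]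

theorem cubeChar_add_int {n : ℕ} (m : Fin n → ℤ) (x : Fin n → ℝ) (k : Fin n → ℤ) :
    cubeChar m (fun i => x i + k i) = cubeChar m x := by
  have : (∑ i, (m i : ℂ) * ((x i + k i : ℝ) : ℂ)) = ∑ i, (m i : ℂ) * (x i : ℂ) +
      ((∑ i, m i * k i : ℤ) : ℂ) := by
    push_cast
    rw [← Finset.sum_add_distrib]
    exact Finset.sum_congr rfl fun i _ => by ring
  rw [cubeChar, cubeChar, this, mul_add, Complex.exp_add,
    mul_comm (2 * Real.pi * Complex.I) (((∑ i, m i * k i : ℤ) : ℂ)),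
    Complex.exp_int_mul_two_pi_mul_I, mul_one]

/-- Unfolding: integrating the periodization of `G` over the unit cube gives the integral of `G`. -/
theorem setIntegral_unitCube_tsum {n : ℕ} {G : (Fin n → ℝ) → ℂ} (hG : Integrable G) :
    ∫ x in unitCube n, ∑' k : Fin n → ℤ, G (fun i => x i + k i) = ∫ x, G x := by
  let T : (Fin n → ℤ) → (Fin n → ℝ) := fun k i => (k i : ℝ)
  let Q : (Fin n → ℤ) → Set (Fin n → ℝ) := fun k => {x | ∀ i, x i ∈ Set.Ioc (k i : ℝ) (k i + 1)}
  have hQm : ∀ k, MeasurableSet (Q k) := fun k =>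
    MeasurableSet.univ_pi' fun i => measurableSet_Ioc
  have hQd : Pairwise (Function.onFun Disjoint Q) := by
    intro k l hkl
    rw [Function.onFun, Set.disjoint_left]
    intro x hx hy
    refine hkl (funext fun i => ?_)
    have h1 := hx i
    have h2 := hy i
    have h3 : (k i : ℝ) < l i + 1 := h1.1.trans_le h2.2
    have h4 : (l i : ℝ) < k i + 1 := h2.1.trans_le h1.2
    norm_cast at h3 h4
    omega
  have hQu : ⋃ k, Q k = Set.univ := by
    refine Set.eq_univ_of_forall fun x => Set.mem_iUnion.2 ⟨fun i => ⌈x i⌉ - 1, fun i => ?_⟩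
    have h1 := Int.ceil_lt_add_one (x i)
    have h2 := Int.le_ceil (x i)
    constructor <;> push_cast <;> linarith
  have hpre : ∀ k, (fun x => x + T k) ⁻¹' (Q k) = unitCube n := by
    intro k
    ext x
    refine forall_congr' fun i => ?_
    simp only [Set.mem_Ioc, Pi.add_apply, T]
    constructor <;> rintro ⟨h1, h2⟩ <;> constructor <;> linarith
  have hmp : ∀ k, MeasurePreserving (fun x : Fin n → ℝ => x + T k) (volume.restrict (unitCube n))
      (volume.restrict (Q k)) := by
    intro k
    rw [← hpre k]
    exact (measurePreserving_add_right volume (T k)).restrict_preimage (hQm k)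
  have hemb : ∀ k, MeasurableEmbedding (fun x : Fin n → ℝ => x + T k) := fun k =>
    measurableEmbedding_addRight (T k)
  have htr : ∀ k, ∫ x in Q k, G x = ∫ x in unitCube n, G (x + T k) := fun k =>
    ((hmp k).integral_comp (hemb k) G).symm
  have htrn : ∀ k, ∫ x in Q k, ‖G x‖ = ∫ x in unitCube n, ‖G (x + T k)‖ := fun k =>
    ((hmp k).integral_comp (hemb k) fun x => ‖G x‖).symm
  have h1 := hasSum_integral_iUnion hQm hQd (hG.integrableOn (s := ⋃ k, Q k))
  have h2 := (hasSum_integral_iUnion hQm hQd (hG.norm.integrableOn (s := ⋃ k, Q k))).summable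
  rw [hQu, setIntegral_univ] at h1
  simp only [htrn] at h2
  simp only [htr] at h1
  have h3 := hasSum_integral_of_summable_integral_norm (μ := volume.restrict (unitCube n))
    (F := fun (k : Fin n → ℤ) x => G (x + T k))
    (fun k => ((hmp k).integrable_comp_emb (hemb k)).2 hG.integrableOn) h2
  exact h3.unique h1

/-! ### Poisson summation and the functional equation of the theta series -/

section Poisson

variable {n : ℕ} (b : Basis (Fin n) ℝ (EuclideanSpace ℝ (Fin n)))

/-- The coordinate map of a unimodular basis preserves the volume. -/
theorem measurePreserving_equivFun_symm
    (hb : |(EuclideanSpace.basisFun (Fin n) ℝ).toBasis.det b| = 1) :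
    MeasurePreserving (fun x : Fin n → ℝ => b.equivFun.symm x) := by
  let M : (Fin n → ℝ) →ₗ[ℝ] (Fin n → ℝ) :=
    Matrix.toLin' ((EuclideanSpace.basisFun (Fin n) ℝ).toBasis.toMatrix b)
  have hdet : |LinearMap.det M| = 1 := by
    rw [LinearMap.det_toLin', ← Basis.det_apply, hb]
  have hM : ∀ x, b.equivFun.symm x = WithLp.toLp 2 (M x) := by
    intro x
    ext i
    simp [M, Basis.equivFun_symm_apply, Matrix.toLin'_apply, Matrix.mulVec, dotProduct,
      Basis.toMatrix_apply, mul_comm]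
  have h1 : MeasurePreserving M := by
    refine ⟨M.continuous_of_finiteDimensional.measurable, ?_⟩
    rw [Real.map_linearMap_volume_pi_eq_smul_volume_pi (by intro h; simp [h] at hdet), abs_inv,
      hdet]
    simp
  have h2 := (PiLp.volume_preserving_toLp (Fin n)).comp h1
  convert h2 using 1
  exact funext hM

theorem measurableEmbedding_equivFun_symm :
    MeasurableEmbedding (fun x : Fin n → ℝ => b.equivFun.symm x) :=
  (b.equivFun.symm.toContinuousLinearEquiv.toHomeomorph).measurableEmbedding

theorem continuous_equivFun_symm : Continuous (fun x : Fin n → ℝ => b.equivFun.symm x) :=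
  (b.equivFun.symm.toContinuousLinearEquiv.toHomeomorph).continuous

/-- Coordinates of lattice vectors. -/
noncomputable def intCoords : (Fin n → ℤ) ≃ (EuclideanLattice.ofBasis b).toSubmodule :=
  (b.restrictScalars ℤ).equivFun.symm.toEquiv

theorem intCoords_coe (k : Fin n → ℤ) :
    (intCoords b k : EuclideanSpace ℝ (Fin n)) = b.equivFun.symm (fun i => (k i : ℝ)) := by
  change (((b.restrictScalars ℤ).equivFun.symm k : Submodule.span ℤ (Set.range b)) :
    EuclideanSpace ℝ (Fin n)) = _
  rw [Basis.equivFun_symm_apply, Basis.equivFun_symm_apply]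
  simp [Basis.restrictScalars_apply, Int.cast_smul_eq_zsmul]

theorem inner_equivFun_symm {b d : Basis (Fin n) ℝ (EuclideanSpace ℝ (Fin n))}
    (hbd : ∀ i j, ⟪d i, b j⟫ = if i = j then 1 else 0) (y x : Fin n → ℝ) :
    ⟪d.equivFun.symm y, b.equivFun.symm x⟫ = ∑ i, y i * x i := by
  simp [Basis.equivFun_symm_apply, sum_inner, inner_sum, real_inner_smul_left,
    real_inner_smul_right, hbd, mul_comm]

/-- **Poisson summation** for Gaussians, for a pair of dual unimodular bases. -/
theorem tsum_exp_ofBasis {b d : Basis (Fin n) ℝ (EuclideanSpace ℝ (Fin n))}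
    (hbd : ∀ i j, ⟪d i, b j⟫ = if i = j then 1 else 0)
    (hb : |(EuclideanSpace.basisFun (Fin n) ℝ).toBasis.det b| = 1) {t : ℝ} (ht : 0 < t) :
    ∑' x : (EuclideanLattice.ofBasis b).toSubmodule, Real.exp (-(Real.pi * t) * ‖x.1‖ ^ 2) =
      t ^ (-((n : ℝ) / 2)) *
      ∑' y : (EuclideanLattice.ofBasis d).toSubmodule, Real.exp (-(Real.pi * t⁻¹) * ‖y.1‖ ^ 2) := by
  have hπ := Real.pi_pos
  have ha : 0 < Real.pi * t := by positivity
  let φ : (Fin n → ℝ) → EuclideanSpace ℝ (Fin n) := fun x => b.equivFun.symm x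
  let g : EuclideanSpace ℝ (Fin n) → ℂ := fun v => Complex.exp (-(Real.pi * t : ℝ) * ‖v‖ ^ 2)
  have hgr : ∀ v, g v = ((Real.exp (-(Real.pi * t) * ‖v‖ ^ 2) : ℝ) : ℂ) := fun v => by
    simp only [g]; push_cast; rfl
  have hgn : ∀ v, ‖g v‖ = Real.exp (-(Real.pi * t) * ‖v‖ ^ 2) := fun v => by
    rw [hgr, Complex.norm_real, Real.norm_of_nonneg (Real.exp_pos _).le]
  have hgc : Continuous g := by fun_prop
  have hφc : Continuous φ := continuous_equivFun_symm b
  have hφa : ∀ x y : Fin n → ℝ, φ (fun i => x i + y i) = φ x + φ y := fun x y =>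
    map_add b.equivFun.symm x y
  -- the periodization of the Gaussian, in the coordinates of `b`
  let f : (Fin n → ℝ) → ℂ := fun x => ∑' k : Fin n → ℤ, g (φ (fun i => x i + k i))
  have hsumb : ∀ {a : ℝ}, 0 < a → Summable fun k : Fin n → ℤ =>
      Real.exp (-a * ‖φ (fun i => (k i : ℝ))‖ ^ 2) := by
    intro a ha
    have := (intCoords b).summable_iff.2
      ((EuclideanLattice.ofBasis b).summable_exp_neg_mul_sq_toSubmodule ha)
    simpa only [Function.comp_def, intCoords_coe] using this
  have hfc : Continuous f := by
    rw [continuous_iff_continuousAt]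
    intro x₀
    have hU : IsOpen {x | ‖φ x‖ < ‖φ x₀‖ + 1} := isOpen_lt hφc.norm continuous_const
    refine ContinuousOn.continuousAt (s := {x | ‖φ x‖ < ‖φ x₀‖ + 1}) ?_
      (hU.mem_nhds (by simp))
    refine continuousOn_tsum (u := fun k => Real.exp (Real.pi * t * (‖φ x₀‖ + 1) ^ 2) *
      Real.exp (-(Real.pi * t / 2) * ‖φ (fun i => ((k : Fin n → ℤ) i : ℝ))‖ ^ 2)) (fun k => ?_)
      ((hsumb (by positivity)).mul_left _) (fun k x hx => ?_)
    · exact (hgc.comp (hφc.comp (by fun_prop))).continuousOn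
    · rw [hgn, hφa, ← Real.exp_add, Real.exp_le_exp]
      set v := φ (fun i => (k i : ℝ))
      have h1 : ‖v‖ ≤ ‖φ x + v‖ + ‖φ x‖ := by
        simpa using norm_sub_le (φ x + v) (φ x)
      have h2 : ‖φ x‖ ≤ ‖φ x₀‖ + 1 := le_of_lt hx
      have h3 : ‖v‖ ^ 2 ≤ 2 * ‖φ x + v‖ ^ 2 + 2 * (‖φ x₀‖ + 1) ^ 2 := by
        have h4 : ‖φ x‖ ^ 2 ≤ (‖φ x₀‖ + 1) ^ 2 := by gcongr
        have h5 : ‖v‖ ^ 2 ≤ (‖φ x + v‖ + ‖φ x‖) ^ 2 := by gcongr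
        nlinarith [sq_nonneg (‖φ x + v‖ - ‖φ x‖)]
      nlinarith
  have hper : ∀ x, ∀ k : Fin n → ℤ, f (fun i => x i + k i) = f x := by
    intro x k
    change ∑' l : Fin n → ℤ, g (φ (fun i => x i + k i + l i)) =
      ∑' l : Fin n → ℤ, g (φ (fun i => x i + l i))
    rw [← (Equiv.addLeft k).tsum_eq (fun l : Fin n → ℤ => g (φ (fun i => x i + l i)))]
    refine tsum_congr fun l => ?_
    simp [add_assoc]
  let G : (Fin n → ℤ) → (Fin n → ℝ) → ℂ := fun m x => cubeChar (-m) x * g (φ x)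
  let H : (Fin n → ℤ) → EuclideanSpace ℝ (Fin n) → ℂ := fun m v =>
    Complex.exp (-((Real.pi * t : ℝ) : ℂ) * ‖v‖ ^ 2 +
      (-(2 * Real.pi * Complex.I)) * ⟪d.equivFun.symm (fun i => (m i : ℝ)), v⟫)
  have hGH : ∀ m x, G m x = H m (φ x) := by
    intro m x
    simp only [G, H, g, φ, cubeChar, inner_equivFun_symm hbd]
    rw [← Complex.exp_add]
    congr 1
    push_cast
    simp only [Pi.neg_apply, Int.cast_neg, neg_mul, Finset.sum_neg_distrib]
    ring
  have hmp := measurePreserving_equivFun_symm b hb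
  have hre : 0 < ((Real.pi * t : ℝ) : ℂ).re := by simpa using ha
  have hGi : ∀ m, Integrable (G m) := by
    intro m
    have h1 : Integrable (H m) :=
      GaussianFourier.integrable_cexp_neg_mul_sq_norm_add hre _ _
    have h2 := (hmp.integrable_comp_emb (measurableEmbedding_equivFun_symm b)).2 h1
    exact h2.congr (Eventually.of_forall fun x => (hGH m x).symm)
  -- the Fourier transform of the Gaussian at the dual lattice vector with coordinates `m`
  have hGint : ∀ m, ∫ x, G m x = ((t ^ (-((n : ℝ) / 2)) *
      Real.exp (-(Real.pi * t⁻¹) * ‖d.equivFun.symm (fun i => (m i : ℝ))‖ ^ 2) : ℝ) : ℂ) := by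
    intro m
    simp only [hGH]
    rw [hmp.integral_comp (measurableEmbedding_equivFun_symm b) (H m)]
    rw [GaussianFourier.integral_cexp_neg_mul_sq_norm_add hre, finrank_euclideanSpace_fin]
    push_cast
    congr 1
    · rw [div_mul_eq_div_div, div_self (by exact_mod_cast hπ.ne'), one_div, Complex.inv_cpow,
        ← Complex.cpow_neg, Complex.ofReal_cpow ht.le]
      · push_cast; rfl
      · rw [Complex.arg_ofReal_of_nonneg ht.le]; exact hπ.ne
    · congr 1
      have : (Real.pi : ℂ) ≠ 0 := by exact_mod_cast hπ.ne'
      have : (t : ℂ) ≠ 0 := by exact_mod_cast ht.ne'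
      field_simp
      rw [Complex.I_sq]
      ring
  -- the Fourier coefficients of the periodization, by unfolding
  have hcoef : ∀ m : Fin n → ℤ, ∫ y in unitCube n, cubeChar (-m) y * f y = ∫ x, G m x := by
    intro m
    rw [← setIntegral_unitCube_tsum (hGi m)]
    refine integral_congr_ae (Eventually.of_forall fun y => ?_)
    simp only [f, G, cubeChar_add_int, tsum_mul_left]
  have hsumd : Summable fun m : Fin n → ℤ => t ^ (-((n : ℝ) / 2)) *
      Real.exp (-(Real.pi * t⁻¹) * ‖d.equivFun.symm (fun i => (m i : ℝ))‖ ^ 2) := by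
    have := (intCoords d).summable_iff.2
      ((EuclideanLattice.ofBasis d).summable_exp_neg_mul_sq_toSubmodule
        (a := Real.pi * t⁻¹) (by positivity))
    simpa only [Function.comp_def, intCoords_coe] using this.mul_left (t ^ (-((n : ℝ) / 2)))
  have hfin := hasSum_cubeChar_of_summable hfc hper
    (by simp only [hcoef, hGint]; exact_mod_cast hsumd) 0
  simp only [hcoef, hGint] at hfin
  have h0 : ∀ m : Fin n → ℤ, cubeChar m 0 = 1 := fun m => by simp [cubeChar]
  simp only [h0, mul_one] at hfin
  have hf0 : f 0 = ((∑' k : Fin n → ℤ,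
      Real.exp (-(Real.pi * t) * ‖φ (fun i => (k i : ℝ))‖ ^ 2) : ℝ) : ℂ) := by
    simp only [f, hgr, Complex.ofReal_tsum, Pi.zero_apply, zero_add]
  rw [hf0] at hfin
  have hfin' := (Complex.hasSum_ofReal.1 hfin).tsum_eq
  rw [tsum_mul_left] at hfin'
  rw [← (intCoords b).tsum_eq, ← (intCoords d).tsum_eq]
  simp only [intCoords_coe]
  exact hfin'.symm

end Poisson

namespace EuclideanLattice

variable {n : ℕ}

theorem eq_ofBasis {L : EuclideanLattice n} {b : Basis (Fin n) ℝ (EuclideanSpace ℝ (Fin n))}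
    (h : L.toSubmodule = Submodule.span ℤ (Set.range b)) : L = ofBasis b := by
  cases L
  subst h
  rfl

/-- The functional equation of the theta series of a lattice of covolume `1`. -/
theorem one_add_theta (L : EuclideanLattice n) (hL : L.covol = 1) {t : ℝ} (ht : 0 < t) :
    1 + L.theta t = t ^ (-((n : ℝ) / 2)) * (1 + L.dual.theta t⁻¹) := by
  obtain ⟨b, d, hbd, hb, hd⟩ := dual_exists_basis L
  rw [← tsum_toSubmodule_eq_one_add_theta _ ht,
    ← tsum_toSubmodule_eq_one_add_theta _ (inv_pos.2 ht)]
  have h1 := covol_ofBasis L b hb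
  rw [hL] at h1
  have hd' : L.dual = ofBasis d := eq_ofBasis hd
  rw [hd', eq_ofBasis hb]
  exact tsum_exp_ofBasis hbd h1.symm ht

end EuclideanLattice

/-! ### Uniqueness of meromorphic continuations -/

namespace IsMeromorphicContinuation

variable {ι : Type} {σ : ℝ} {f : ι → ℂ → ℂ} {Z Z' : ℂ → ℂ}

theorem continuedSum_of (h : IsMeromorphicContinuation σ f Z) :
    IsMeromorphicContinuation σ f (continuedSum σ f) := by
  have h' : ∃ Z, IsMeromorphicContinuation σ f Z := ⟨Z, h⟩
  rw [continuedSum, dif_pos h']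
  exact h'.choose_spec

theorem eqOn (h : IsMeromorphicContinuation σ f Z) (h' : IsMeromorphicContinuation σ f Z') :
    Set.EqOn Z Z' {(σ : ℂ)}ᶜ := by
  have ho : IsOpen ({(σ : ℂ)}ᶜ : Set ℂ) := isOpen_compl_singleton
  have hc : IsPreconnected ({(σ : ℂ)}ᶜ : Set ℂ) :=
    (isConnected_compl_singleton_of_one_lt_rank
      (by simp [Complex.rank_real_complex]) _).isPreconnected
  refine (h.differentiableOn.analyticOnNhd ho).eqOn_of_preconnected_of_eventuallyEq
    (h'.differentiableOn.analyticOnNhd ho) hc (z₀ := (σ : ℂ) + 1) (by simp) ?_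
  have hU : IsOpen {s : ℂ | σ < s.re} := isOpen_lt continuous_const Complex.continuous_re
  filter_upwards [hU.mem_nhds (show σ < ((σ : ℂ) + 1).re by simp)] with s hs
  exact (h.hasSum s hs).unique (h'.hasSum s hs)

theorem continuedSum_eq (h : IsMeromorphicContinuation σ f Z) {s : ℂ} (hs : s ≠ σ) :
    continuedSum σ f s = Z s :=
  h.continuedSum_of.eqOn h hs

theorem deriv_continuedSum_eq (h : IsMeromorphicContinuation σ f Z) {s : ℂ} (hs : s ≠ σ) :
    deriv (continuedSum σ f) s = deriv Z s :=
  (Filter.eventuallyEq_of_mem (isOpen_compl_singleton.mem_nhds hs)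
    (h.continuedSum_of.eqOn h)).deriv_eq

end IsMeromorphicContinuation

/-! ### The continuation of the Epstein zeta function -/

namespace EuclideanLattice

variable {n : ℕ}

theorem continuousOn_theta (L : EuclideanLattice n) : ContinuousOn L.theta (Set.Ioi 0) :=
  (L.continuousOn_momentTheta 0).congr fun t _ => (L.momentTheta_zero t).symm

theorem theta_isBigO_rpow (L : EuclideanLattice n) (r : ℝ) :
    (fun t => ((1 + L.theta t : ℝ) : ℂ) - 1) =O[atTop] (fun t : ℝ => t ^ r) := by
  obtain ⟨C, -, hC⟩ := L.exists_theta_mul_rpow_le one_pos (-r)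
  refine Asymptotics.IsBigO.of_bound C ?_
  filter_upwards [eventually_ge_atTop 1] with t ht
  have h := hC t ht
  have ht0 : 0 < t := by linarith
  have h1 : ((1 + L.theta t : ℝ) : ℂ) - 1 = ((L.theta t : ℝ) : ℂ) := by push_cast; ring
  rw [h1, Complex.norm_real, Real.norm_of_nonneg (L.theta_nonneg t),
    Real.norm_of_nonneg (by positivity)]
  rw [one_mul, Real.rpow_neg ht0.le, ← div_eq_mul_inv, div_le_iff₀ (by positivity)] at h
  exact h

/-- The theta series of a lattice of covolume `1` and of its dual, as a pair of functions related
by a functional equation of weight `n / 2`. -/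
noncomputable def thetaPair (L : EuclideanLattice n) (hn : 0 < n) (hL : L.covol = 1) :
    WeakFEPair ℂ where
  f t := ((1 + L.theta t : ℝ) : ℂ)
  g t := ((1 + L.dual.theta t : ℝ) : ℂ)
  k := (n : ℝ) / 2
  ε := 1
  f₀ := 1
  g₀ := 1
  hf_int := ContinuousOn.locallyIntegrableOn
    (Complex.continuous_ofReal.comp_continuousOn (continuousOn_const.add L.continuousOn_theta))
    measurableSet_Ioi
  hg_int := ContinuousOn.locallyIntegrableOn
    (Complex.continuous_ofReal.comp_continuousOn (continuousOn_const.add L.dual.continuousOn_theta))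
    measurableSet_Ioi
  hk := by positivity
  hε := one_ne_zero
  h_feq := fun x hx => by
    have hx' : 0 < x := hx
    rw [one_div, L.one_add_theta hL (inv_pos.2 hx'), inv_inv, Real.inv_rpow hx'.le,
      Real.rpow_neg hx'.le, inv_inv]
    push_cast
    rw [one_mul, smul_eq_mul]
  hf_top := L.theta_isBigO_rpow
  hg_top := L.dual.theta_isBigO_rpow

/-- The explicit continuation of the Epstein zeta function through the theta series. The factor
`1 / Γ(s)` is written as `s / Γ(s + 1)`, which removes the singularity at `s = 0`. -/
noncomputable def epsteinContinuation (L : EuclideanLattice n) (hn : 0 < n) (hL : L.covol = 1)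
    (s : ℂ) : ℂ :=
  (Real.pi : ℂ) ^ s * (Complex.Gamma (s + 1))⁻¹ *
    (s * (L.thetaPair hn hL).Λ₀ s - 1 - s / ((n / 2 : ℝ) - s))

variable (L : EuclideanLattice n) (hn : 0 < n) (hL : L.covol = 1)

theorem epsteinContinuation_eq {s : ℂ} (hs : s ≠ 0) :
    L.epsteinContinuation hn hL s =
      (Real.pi : ℂ) ^ s * (Complex.Gamma s)⁻¹ * (L.thetaPair hn hL).Λ s := by
  rw [epsteinContinuation, Complex.Gamma_add_one s hs, WeakFEPair.Λ]
  simp only [thetaPair, smul_eq_mul, mul_one]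
  rw [mul_inv]
  field_simp

theorem ofReal_sq_cpow {x : ℝ} (hx : 0 < x) (s : ℂ) :
    ((x ^ 2 : ℝ) : ℂ) ^ s = (x : ℂ) ^ (2 * s) := by
  rw [Complex.cpow_def_of_ne_zero (by exact_mod_cast (pow_pos hx 2).ne'),
    Complex.cpow_def_of_ne_zero (by exact_mod_cast hx.ne'), ← Complex.ofReal_log (by positivity),
    ← Complex.ofReal_log hx.le, Real.log_pow]
  push_cast
  ring_nf

theorem sq_rpow {x : ℝ} (hx : 0 ≤ x) (s : ℝ) : (x ^ 2) ^ s = x ^ (2 * s) := by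
  rw [← Real.rpow_natCast, ← Real.rpow_mul hx]
  norm_num

/-- The Mellin transform of `∑ ‖x‖²ʲ exp (-π t ‖x‖²)` is an Epstein zeta value. -/
theorem hasSum_mellin_momentTheta (j : ℕ) {s : ℂ} (hs0 : 0 < s.re) (hs : (n : ℝ) / 2 + j < s.re) :
    HasSum (fun x : L.Nonzero => (Real.pi : ℂ) ^ (-s) * Complex.Gamma s * epsteinTerm L x (s - j))
      (mellin (fun t => (L.momentTheta j t : ℂ)) s) := by
  have h := hasSum_mellin_pi_mul (ι := L.Nonzero) (a := fun x => (((‖x.1‖ ^ 2) ^ j : ℝ) : ℂ))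
    (q := fun x => ‖x.1‖ ^ 2) (F := fun t => (L.momentTheta j t : ℂ)) (s := s)
    (fun x => Or.inr (by have := Nonzero.norm_pos L x; positivity)) hs0
    (fun t ht => by
      have h1 := (L.summable_pow_mul_exp_neg_mul_sq (a := Real.pi * t)
        (mul_pos Real.pi_pos ht) j).hasSum
      have h2 : HasSum _ (L.momentTheta j t : ℂ) := Complex.hasSum_ofReal.2 h1
      refine h2.congr_fun fun x => ?_
      push_cast
      ring_nf)
    (by
      refine (L.summable_norm_rpow (r := -2 * (s.re - j)) (by linarith)).congr fun x => ?_
      have hx := Nonzero.norm_pos L x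
      rw [Complex.norm_real, Real.norm_of_nonneg (by positivity), sq_rpow hx.le, ← pow_mul,
        ← Real.rpow_natCast, ← Real.rpow_sub hx]
      push_cast
      ring_nf)
  convert h using 2 with x
  have hx := Nonzero.norm_pos L x
  have hxc : (‖x.1‖ : ℂ) ≠ 0 := by exact_mod_cast hx.ne'
  rw [mul_div_assoc, ofReal_sq_cpow hx, epsteinTerm]
  congr 1
  push_cast
  rw [← pow_mul, ← Complex.cpow_natCast, ← Complex.cpow_sub _ _ hxc]
  push_cast
  ring_nf

theorem mellin_theta {s : ℂ} (hs : (n : ℝ) / 2 < s.re) :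
    mellin (fun t => (L.theta t : ℂ)) s = (L.thetaPair hn hL).Λ s := by
  rw [← ((L.thetaPair hn hL).hasMellin hs).2]
  refine congrArg (mellin · s) (funext fun t => ?_)
  simp [thetaPair]

theorem isMeromorphicContinuation_epsteinContinuation :
    IsMeromorphicContinuation ((n : ℝ) / 2) (epsteinTerm L) (L.epsteinContinuation hn hL) where
  hasSum s hs := by
    have hs0 : 0 < s.re := lt_of_le_of_lt (by positivity) hs
    have hs1 : s ≠ 0 := by rintro rfl; simp at hs0
    have h := L.hasSum_mellin_momentTheta 0 hs0 (by simpa using hs)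
    simp only [momentTheta_zero, L.mellin_theta hn hL hs, CharP.cast_eq_zero, sub_zero] at h
    rw [L.epsteinContinuation_eq hn hL hs1]
    have hG : Complex.Gamma s ≠ 0 := Complex.Gamma_ne_zero_of_re_pos hs0
    have hπ : (Real.pi : ℂ) ≠ 0 := by exact_mod_cast Real.pi_ne_zero
    have hπs : (Real.pi : ℂ) ^ s ≠ 0 := by simp [Complex.cpow_eq_zero_iff, hπ]
    refine (h.mul_left ((Real.pi : ℂ) ^ s * (Complex.Gamma s)⁻¹)).congr_fun fun x => ?_
    rw [Complex.cpow_neg]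
    field_simp
  differentiableOn := by
    intro s hs
    have hs' : ((n / 2 : ℝ) : ℂ) - s ≠ 0 := sub_ne_zero.2 (fun h => hs h.symm)
    have hπ : (Real.pi : ℂ) ≠ 0 := by exact_mod_cast Real.pi_ne_zero
    have h1 : DifferentiableAt ℂ (fun s : ℂ => (Complex.Gamma (s + 1))⁻¹) s :=
      Complex.differentiable_one_div_Gamma.differentiableAt.comp s (by fun_prop)
    have h2 := (L.thetaPair hn hL).differentiable_Λ₀ s
    have h3 : DifferentiableAt ℂ (fun s : ℂ => (Real.pi : ℂ) ^ s) s :=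
      differentiableAt_id.const_cpow (Or.inl hπ)
    refine DifferentiableAt.differentiableWithinAt ?_
    unfold epsteinContinuation
    fun_prop (disch := assumption)
  meromorphic := by
    have hπ : (Real.pi : ℂ) ≠ 0 := by exact_mod_cast Real.pi_ne_zero
    have h1 : Differentiable ℂ (fun s : ℂ => (Complex.Gamma (s + 1))⁻¹) :=
      Complex.differentiable_one_div_Gamma.comp (by fun_prop)
    have h2 := (L.thetaPair hn hL).differentiable_Λ₀
    have h3 : Differentiable ℂ (fun s : ℂ => (Real.pi : ℂ) ^ s) :=
      differentiable_id.const_cpow (Or.inl hπ)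
    intro s
    unfold epsteinContinuation
    have m1 := (h1.analyticAt s).meromorphicAt
    have m2 := (h2.analyticAt s).meromorphicAt
    have m3 := (h3.analyticAt s).meromorphicAt
    have m4 : MeromorphicAt (fun s : ℂ => s) s := analyticAt_id.meromorphicAt
    exact (m3.mul m1).mul (((m4.mul m2).sub (MeromorphicAt.const 1 s)).sub
      (m4.div ((MeromorphicAt.const _ s).sub m4)))

theorem epsteinZeta_eq {s : ℂ} (hs : s ≠ (n / 2 : ℝ)) :
    epsteinZeta L s = L.epsteinContinuation hn hL s :=
  (L.isMeromorphicContinuation_epsteinContinuation hn hL).continuedSum_eq hs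

theorem isMeromorphicContinuation_epsteinZeta (L : EuclideanLattice n) (hL : L.covol = 1) :
    IsMeromorphicContinuation ((n : ℝ) / 2) (epsteinTerm L) (epsteinZeta L) := by
  rcases Nat.eq_zero_or_pos n with rfl | hn
  · have : IsEmpty L.Nonzero := ⟨fun x => x.2.2 (Subsingleton.elim _ _)⟩
    have h : IsMeromorphicContinuation (((0 : ℕ) : ℝ) / 2) (epsteinTerm L) 0 :=
      ⟨fun s _ => hasSum_empty, differentiableOn_const 0, fun s => MeromorphicAt.const 0 s⟩
    exact h.continuedSum_of
  · exact (L.isMeromorphicContinuation_epsteinContinuation hn hL).continuedSum_of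

end EuclideanLattice

/-! ### The spectrum of a flat torus -/

section Torus

variable {n : ℕ}

/-- The character `v ↦ exp (2 π i ⟪y, v⟫)` of `ℝⁿ`. -/
noncomputable def expChar (y v : EuclideanSpace ℝ (Fin n)) : ℂ :=
  Complex.exp (2 * Real.pi * Complex.I * (⟪y, v⟫ : ℝ))

theorem contDiff_expChar (y : EuclideanSpace ℝ (Fin n)) : ContDiff ℝ ∞ (expChar y) := by
  have h1 : ContDiff ℝ ∞ fun v : EuclideanSpace ℝ (Fin n) => ((⟪y, v⟫ : ℝ) : ℂ) :=
    Complex.ofRealCLM.contDiff.comp (innerSL ℝ y).contDiff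
  exact (contDiff_const.mul h1).cexp

theorem fderiv_expChar (y x v : EuclideanSpace ℝ (Fin n)) :
    fderiv ℝ (expChar y) x v = 2 * Real.pi * Complex.I * (⟪y, v⟫ : ℝ) * expChar y x := by
  have h1 : HasFDerivAt (fun x : EuclideanSpace ℝ (Fin n) => ⟪y, x⟫) (innerSL ℝ y) x :=
    (innerSL ℝ y).hasFDerivAt
  have h2 : HasFDerivAt (fun x : EuclideanSpace ℝ (Fin n) => ((⟪y, x⟫ : ℝ) : ℂ))
      (Complex.ofRealCLM.comp (innerSL ℝ y)) x :=
    Complex.ofRealCLM.hasFDerivAt.comp x h1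
  have h3 := ((h2.const_mul (2 * Real.pi * Complex.I)).cexp).fderiv
  have h4 : (fun x : EuclideanSpace ℝ (Fin n) =>
    Complex.exp (2 * Real.pi * Complex.I * (⟪y, x⟫ : ℝ))) = expChar y := rfl
  rw [h4] at h3
  rw [h3]
  simp [expChar]
  ring

theorem expChar_add (y x v : EuclideanSpace ℝ (Fin n)) :
    expChar y (x + v) = expChar y x * expChar y v := by
  simp only [expChar, inner_add_right, ← Complex.exp_add]
  push_cast
  ring_nf

theorem expChar_eq_one {Λ : EuclideanLattice n} {y v : EuclideanSpace ℝ (Fin n)}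
    (hy : y ∈ Λ.dual) (hv : v ∈ Λ) : expChar y v = 1 := by
  obtain ⟨k, hk⟩ : ∃ k : ℤ, ⟪y, v⟫ = (k : ℝ) := hy v hv
  rw [expChar, hk]
  push_cast
  rw [mul_comm, Complex.exp_int_mul_two_pi_mul_I]

/-- The Laplacian in terms of iterated directional derivatives. -/
theorem laplacian_eq_sum_fderiv {f : EuclideanSpace ℝ (Fin n) → ℂ} (hf : ContDiff ℝ ∞ f)
    (x : EuclideanSpace ℝ (Fin n)) :
    (Δ f) x = ∑ i, fderiv ℝ (fun z => fderiv ℝ f z (EuclideanSpace.basisFun (Fin n) ℝ i)) x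
      (EuclideanSpace.basisFun (Fin n) ℝ i) := by
  rw [InnerProductSpace.laplacian_eq_iteratedFDeriv_orthonormalBasis f
    (EuclideanSpace.basisFun (Fin n) ℝ)]
  refine Finset.sum_congr rfl fun i _ => ?_
  rw [iteratedFDeriv_two_apply]
  have hd : DifferentiableAt ℝ (fderiv ℝ f) x :=
    ((hf.fderiv_right (m := 1) (by norm_cast)).differentiable one_ne_zero) x
  rw [fderiv_clm_apply hd (differentiableAt_const _)]
  simp

theorem laplacian_expChar (y x : EuclideanSpace ℝ (Fin n)) :
    -(Δ (expChar y)) x = ((4 * Real.pi ^ 2 * ‖y‖ ^ 2 : ℝ) : ℂ) * expChar y x := by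
  have hd : Differentiable ℝ (expChar y) := (contDiff_expChar y).differentiable (by simp)
  rw [laplacian_eq_sum_fderiv (contDiff_expChar y)]
  have h : ∀ i : Fin n, fderiv ℝ (fun z => fderiv ℝ (expChar y) z
      (EuclideanSpace.basisFun (Fin n) ℝ i)) x (EuclideanSpace.basisFun (Fin n) ℝ i) =
      -((4 * Real.pi ^ 2 * y i ^ 2 : ℝ) : ℂ) * expChar y x := by
    intro i
    simp only [fderiv_expChar]
    rw [fderiv_const_mul (hd x)]
    simp only [smul_apply, fderiv_expChar, smul_eq_mul]
    have h1 : ⟪y, EuclideanSpace.basisFun (Fin n) ℝ i⟫ = y i := by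
      simp [EuclideanSpace.inner_single_right]
    rw [h1]
    push_cast
    linear_combination (4 * (Real.pi : ℂ) ^ 2 * (y i : ℂ) ^ 2 * expChar y x) * Complex.I_sq
  simp only [h]
  rw [EuclideanSpace.real_norm_sq_eq, Finset.mul_sum, ← Finset.sum_mul]
  push_cast
  rw [Finset.sum_neg_distrib]
  ring

theorem linearIndependent_expChar :
    LinearIndependent ℂ (fun y : EuclideanSpace ℝ (Fin n) => expChar y) := by
  -- distinct monoid homomorphisms to a field are linearly independent
  let e : EuclideanSpace ℝ (Fin n) → (Multiplicative (EuclideanSpace ℝ (Fin n)) →* ℂ) := fun y =>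
    { toFun := fun v => expChar y v.toAdd
      map_one' := by simp [expChar]
      map_mul' := fun u v => expChar_add y _ _ }
  have he : Function.Injective e := by
    intro y z hyz
    have h1 : expChar y = expChar z :=
      funext fun v => DFunLike.congr_fun hyz (Multiplicative.ofAdd v)
    refine ext_inner_right ℝ fun v => ?_
    have h2 := fderiv_expChar y 0 v
    rw [h1, fderiv_expChar] at h2
    have h3 : expChar z 0 = 1 := by simp [expChar]
    rw [h3, mul_one, mul_one] at h2
    have h5 := mul_left_cancel₀ Complex.two_pi_I_ne_zero h2
    exact_mod_cast h5.symm
  exact (linearIndependent_monoidHom (Multiplicative (EuclideanSpace ℝ (Fin n))) ℂ).comp e he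

theorem measurableSet_unitCube : MeasurableSet (unitCube n) :=
  MeasurableSet.univ_pi' fun _ => measurableSet_Ioc

theorem unitCube_subset : unitCube n ⊆ Set.Icc 0 1 := fun x hx =>
  ⟨fun i => (hx i).1.le, fun i => by simpa using (hx i).2⟩

theorem _root_.Continuous.integrableOn_unitCube {F : Type*} [NormedAddCommGroup F]
    {g : (Fin n → ℝ) → F} (hg : Continuous g) : IntegrableOn g (unitCube n) :=
  (hg.continuousOn.integrableOn_compact isCompact_Icc).mono_set unitCube_subset

/-- The integral of a periodic function over the unit cube is invariant under translations. -/
theorem setIntegral_unitCube_add {f : (Fin n → ℝ) → ℂ} (hf : Continuous f)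
    (hper : ∀ x, ∀ k : Fin n → ℤ, f (fun i => x i + k i) = f x) (a : Fin n → ℝ) :
    ∫ x in unitCube n, f (x + a) = ∫ x in unitCube n, f x := by
  obtain ⟨F, hF⟩ := exists_continuousMap_torus hf hper
  have h1 := UnitAddTorus.integral_preimage F a
  have h0 := UnitAddTorus.integral_preimage F 0
  simp only [hF] at h1 h0
  have hQ : MeasurableSet {x : Fin n → ℝ | ∀ i, x i ∈ Set.Ioc (a i) (a i + 1)} :=
    MeasurableSet.univ_pi' fun i => measurableSet_Ioc
  have hpre : (fun x => x + a) ⁻¹' {x : Fin n → ℝ | ∀ i, x i ∈ Set.Ioc (a i) (a i + 1)} =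
      unitCube n := by
    ext x
    refine forall_congr' fun i => ?_
    simp only [Set.mem_Ioc, Pi.add_apply]
    constructor <;> rintro ⟨h1, h2⟩ <;> constructor <;> linarith
  have hmp := (measurePreserving_add_right volume a).restrict_preimage hQ
  rw [hpre] at hmp
  rw [hmp.integral_comp (measurableEmbedding_addRight a) f, ← h1, h0]
  rfl

/-- The integral of a directional derivative of a periodic function over a period vanishes. -/
theorem setIntegral_unitCube_fderiv_eq_zero (b : Basis (Fin n) ℝ (EuclideanSpace ℝ (Fin n)))
    {f : EuclideanSpace ℝ (Fin n) → ℂ} (hf : ContDiff ℝ 1 f)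
    (hper : ∀ v ∈ EuclideanLattice.ofBasis b, ∀ x, f (x + v) = f x)
    (v : EuclideanSpace ℝ (Fin n)) :
    ∫ x in unitCube n, fderiv ℝ f (b.equivFun.symm x) v = 0 := by
  set a : Fin n → ℝ := b.equivFun v with ha
  have hBc := continuous_equivFun_symm b
  have hfd : Continuous (fderiv ℝ f) := hf.continuous_fderiv one_ne_zero
  have hper' : ∀ x, ∀ k : Fin n → ℤ, f (b.equivFun.symm (fun i => x i + k i)) =
      f (b.equivFun.symm x) := by
    intro x k
    have h1 : b.equivFun.symm (fun i => x i + k i) =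
        b.equivFun.symm x + b.equivFun.symm (fun i => (k i : ℝ)) :=
      map_add b.equivFun.symm x (fun i => (k i : ℝ))
    rw [h1, ← intCoords_coe]
    exact hper _ (intCoords b k).2 _
  -- the integral of `f (x + s v)` does not depend on `s`; its derivative at `s = 0` is the claim
  have hconst : ∀ s : ℝ, ∫ x in unitCube n, f (b.equivFun.symm x + s • v) =
      ∫ x in unitCube n, f (b.equivFun.symm x) := by
    intro s
    refine Eq.trans ?_ (setIntegral_unitCube_add (hf.continuous.comp hBc) hper' (s • a))
    refine integral_congr_ae (Eventually.of_forall fun x => ?_)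
    change f (b.equivFun.symm x + s • v) = f (b.equivFun.symm (x + s • a))
    rw [map_add, map_smul, ha, LinearEquiv.symm_apply_apply]
  have hcont : Continuous fun p : (Fin n → ℝ) × ℝ =>
      fderiv ℝ f (b.equivFun.symm p.1 + p.2 • v) v :=
    (hfd.comp ((hBc.comp continuous_fst).add (by fun_prop))).clm_apply continuous_const
  obtain ⟨C, hC⟩ := (isCompact_Icc.prod isCompact_Icc : IsCompact
    (Set.Icc (0 : Fin n → ℝ) 1 ×ˢ Set.Icc (-1 : ℝ) 1)).exists_bound_of_continuousOn
      hcont.continuousOn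
  have hder := (hasDerivAt_integral_of_dominated_loc_of_deriv_le (𝕜 := ℝ) (s := Set.Icc (-1 : ℝ) 1)
    (μ := volume.restrict (unitCube n)) (x₀ := 0) (bound := fun _ => C)
    (F := fun s x => f (b.equivFun.symm x + s • v))
    (F' := fun s x => fderiv ℝ f (b.equivFun.symm x + s • v) v)
    (Icc_mem_nhds (by norm_num) (by norm_num))
    (Eventually.of_forall fun s =>
      (hf.continuous.comp (hBc.add continuous_const)).aestronglyMeasurable)
    ((hf.continuous.comp (hBc.add continuous_const)).integrableOn_unitCube)
    ((hcont.comp (Continuous.prodMk_left 0)).aestronglyMeasurable)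
    (by
      filter_upwards [ae_restrict_mem measurableSet_unitCube] with x hx s hs
      exact hC (x, s) ⟨unitCube_subset hx, hs⟩)
    (continuous_const.integrableOn_unitCube)
    (Eventually.of_forall fun x s _ => by
      have h1 : HasFDerivAt f (fderiv ℝ f (b.equivFun.symm x + s • v))
          (b.equivFun.symm x + s • v) :=
        ((hf.differentiable one_ne_zero) _).hasFDerivAt
      have h2 : HasDerivAt (fun s : ℝ => b.equivFun.symm x + s • v) v s := by
        simpa using ((hasDerivAt_id s).smul_const v).const_add (b.equivFun.symm x)
      exact h1.comp_hasDerivAt s h2)).2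
  simp only [hconst, zero_smul, add_zero] at hder
  exact hder.unique (hasDerivAt_const _ _)

theorem cubeChar_eq_expChar {b d : Basis (Fin n) ℝ (EuclideanSpace ℝ (Fin n))}
    (hbd : ∀ i j, ⟪d i, b j⟫ = if i = j then 1 else 0) (m : Fin n → ℤ) (x : Fin n → ℝ) :
    cubeChar m x = expChar (d.equivFun.symm (fun i => (m i : ℝ))) (b.equivFun.symm x) := by
  rw [cubeChar, expChar, inner_equivFun_symm hbd]
  push_cast
  rfl

/-- Integration by parts on a flat torus, against a character. -/
theorem setIntegral_expChar_mul_fderiv (b : Basis (Fin n) ℝ (EuclideanSpace ℝ (Fin n)))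
    {y : EuclideanSpace ℝ (Fin n)} (hy : y ∈ (EuclideanLattice.ofBasis b).dual)
    {g : EuclideanSpace ℝ (Fin n) → ℂ} (hg : ContDiff ℝ ∞ g)
    (hper : ∀ v ∈ EuclideanLattice.ofBasis b, ∀ x, g (x + v) = g x)
    (v : EuclideanSpace ℝ (Fin n)) :
    ∫ x in unitCube n, expChar (-y) (b.equivFun.symm x) * fderiv ℝ g (b.equivFun.symm x) v =
      2 * Real.pi * Complex.I * (⟪y, v⟫ : ℝ) *
        ∫ x in unitCube n, expChar (-y) (b.equivFun.symm x) * g (b.equivFun.symm x) := by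
  have hBc := continuous_equivFun_symm b
  have hy' : -y ∈ (EuclideanLattice.ofBasis b).dual :=
    neg_mem (S := Submodule ℤ (EuclideanSpace ℝ (Fin n))) hy
  have hec := contDiff_expChar (-y)
  have h0 := setIntegral_unitCube_fderiv_eq_zero b (f := fun x => expChar (-y) x * g x)
    (by exact_mod_cast (contDiff_infty.1 (hec.mul hg) 1))
    (fun w hw x => by rw [expChar_add, expChar_eq_one hy' hw, mul_one, hper w hw]) v
  have h1 : ∀ x, fderiv ℝ (fun x => expChar (-y) x * g x) x v =
      expChar (-y) x * fderiv ℝ g x v -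
        2 * Real.pi * Complex.I * (⟪y, v⟫ : ℝ) * (expChar (-y) x * g x) := by
    intro x
    rw [fderiv_fun_mul (hec.differentiable (by simp) x) (hg.differentiable (by simp) x)]
    simp only [add_apply, smul_apply, fderiv_expChar, smul_eq_mul,
      inner_neg_left]
    push_cast
    ring
  have hgc : Continuous fun x => fderiv ℝ g x v :=
    (hg.continuous_fderiv (by simp)).clm_apply continuous_const
  simp only [h1] at h0
  rw [integral_sub, integral_const_mul] at h0
  · exact sub_eq_zero.1 h0
  · exact ((hec.continuous.mul hgc).comp hBc).integrableOn_unitCube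
  · exact ((continuous_const.mul (hec.continuous.mul hg.continuous)).comp hBc).integrableOn_unitCube

/-- The Fourier coefficient at `y` of an eigenfunction vanishes unless the eigenvalue is
`4 π² ‖y‖²`. -/
theorem setIntegral_expChar_mul_eigenfunction
    (b : Basis (Fin n) ℝ (EuclideanSpace ℝ (Fin n))) {y : EuclideanSpace ℝ (Fin n)}
    (hy : y ∈ (EuclideanLattice.ofBasis b).dual) {μ : ℝ} {f : EuclideanSpace ℝ (Fin n) → ℂ}
    (hf : f ∈ torusEigenspace (EuclideanLattice.ofBasis b) μ)
    (hyμ : 4 * Real.pi ^ 2 * ‖y‖ ^ 2 ≠ μ) :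
    ∫ x in unitCube n, expChar (-y) (b.equivFun.symm x) * f (b.equivFun.symm x) = 0 := by
  obtain ⟨hf, hper, hev⟩ := hf
  have hBc := continuous_equivFun_symm b
  have hfd : ∀ v, ContDiff ℝ ∞ fun z => fderiv ℝ f z v := fun v =>
    (hf.fderiv_right (m := ∞) (by simp)).clm_apply contDiff_const
  have hfdper : ∀ v, ∀ w ∈ EuclideanLattice.ofBasis b, ∀ x,
      fderiv ℝ f (x + w) v = fderiv ℝ f x v := by
    intro v w hw x
    rw [← fderiv_comp_add_right w]
    congr 2
    exact funext fun z => hper w hw z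
  set I := ∫ x in unitCube n, expChar (-y) (b.equivFun.symm x) * f (b.equivFun.symm x) with hI
  have hterm : ∀ i : Fin n, ∫ x in unitCube n, expChar (-y) (b.equivFun.symm x) *
      fderiv ℝ (fun z => fderiv ℝ f z (EuclideanSpace.basisFun (Fin n) ℝ i)) (b.equivFun.symm x)
      (EuclideanSpace.basisFun (Fin n) ℝ i) = -((4 * Real.pi ^ 2 * y i ^ 2 : ℝ) : ℂ) * I := by
    intro i
    rw [setIntegral_expChar_mul_fderiv b hy (hfd _) (hfdper _),
      setIntegral_expChar_mul_fderiv b hy hf hper, ← hI]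
    have h1 : ⟪y, EuclideanSpace.basisFun (Fin n) ℝ i⟫ = y i := by
      simp [EuclideanSpace.inner_single_right]
    rw [h1]
    push_cast
    linear_combination (4 * (Real.pi : ℂ) ^ 2 * (y i : ℂ) ^ 2 * I) * Complex.I_sq
  have hec := (contDiff_expChar (-y)).continuous
  have hsum : ∫ x in unitCube n, expChar (-y) (b.equivFun.symm x) * (Δ f) (b.equivFun.symm x) =
      -((4 * Real.pi ^ 2 * ‖y‖ ^ 2 : ℝ) : ℂ) * I := by
    simp only [laplacian_eq_sum_fderiv hf, Finset.mul_sum]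
    rw [integral_finsetSum]
    · simp only [hterm]
      rw [EuclideanSpace.real_norm_sq_eq, Finset.mul_sum, ← Finset.sum_mul]
      push_cast
      rw [Finset.sum_neg_distrib]
    · intro i _
      exact ((hec.mul (((hfd _).continuous_fderiv (by simp)).clm_apply
        continuous_const)).comp hBc).integrableOn_unitCube
  have hev' : ∀ x, (Δ f) x = -((μ : ℂ) * f x) := fun x => by rw [← hev x, neg_neg]
  have hsum' : ∫ x in unitCube n, expChar (-y) (b.equivFun.symm x) * (Δ f) (b.equivFun.symm x) =
      -(μ : ℂ) * I := by
    simp only [hev']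
    rw [hI, ← integral_const_mul]
    refine integral_congr_ae (Eventually.of_forall fun x => ?_)
    simp only
    ring
  have h := hsum.symm.trans hsum'
  have h2 : (((4 * Real.pi ^ 2 * ‖y‖ ^ 2 : ℝ) : ℂ) - (μ : ℂ)) * I = 0 := by
    linear_combination -h
  refine (mul_eq_zero.1 h2).resolve_left (sub_ne_zero.2 ?_)
  exact_mod_cast hyμ

/-- The frequencies `y` in the dual lattice whose characters have Laplace eigenvalue `μ`. -/
abbrev TorusFrequency (Λ : EuclideanLattice n) (μ : ℝ) : Type :=
  {y : Λ.dual.Nonzero // 4 * Real.pi ^ 2 * ‖y.1‖ ^ 2 = μ}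

instance finite_torusFrequency (Λ : EuclideanLattice n) (μ : ℝ) : Finite (TorusFrequency Λ μ) := by
  have h := (Λ.dual.summable_exp_neg_mul_sq (a := 4 * Real.pi ^ 2) (by positivity))
  have h1 := h.tendsto_cofinite_zero
  have h2 := h1.eventually_lt_const (Real.exp_pos (-μ))
  -- the terms of a convergent Gaussian series are at least `exp (-μ)` only finitely often
  rw [Filter.eventually_cofinite] at h2
  refine (h2.subset ?_ : {y : Λ.dual.Nonzero | 4 * Real.pi ^ 2 * ‖y.1‖ ^ 2 = μ}.Finite)
  intro y hy
  have hy' : 4 * Real.pi ^ 2 * ‖y.1‖ ^ 2 = μ := hy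
  simp [← hy']

/-- The eigenspaces of the Laplacian on a flat torus are spanned by characters. -/
theorem torusEigenspace_eq_span (Λ : EuclideanLattice n) {μ : ℝ} (hμ : μ ≠ 0) :
    torusEigenspace Λ μ =
      Submodule.span ℂ (Set.range fun y : TorusFrequency Λ μ => expChar y.1.1) := by
  obtain ⟨b, d, hbd, hb, hd⟩ := dual_exists_basis Λ
  obtain rfl : Λ = EuclideanLattice.ofBasis b := EuclideanLattice.eq_ofBasis hb
  refine le_antisymm (fun f hf => ?_) (Submodule.span_le.2 ?_)
  · have hBc := continuous_equivFun_symm b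
    let y : (Fin n → ℤ) → EuclideanSpace ℝ (Fin n) := fun m => d.equivFun.symm (fun i => (m i : ℝ))
    have hdual : ∀ m, y m ∈ (EuclideanLattice.ofBasis b).dual := by
      intro m
      change y m ∈ dualSubmodule (EuclideanLattice.ofBasis b).toSubmodule
      rw [hd, show y m = _ from (intCoords_coe d m).symm]
      exact (intCoords d m).2
    have hyinj : Function.Injective y := fun m m' h => by
      have := d.equivFun.symm.injective h
      exact funext fun i => by exact_mod_cast congrFun this i
    have hmy : ∀ m, y (-m) = - y m := fun m => by
      rw [← map_neg d.equivFun.symm]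
      exact congrArg d.equivFun.symm (funext fun i => by simp)
    have hper : ∀ x, ∀ k : Fin n → ℤ, f (b.equivFun.symm (fun i => x i + k i)) =
        f (b.equivFun.symm x) := by
      intro x k
      have h1 : b.equivFun.symm (fun i => x i + k i) =
          b.equivFun.symm x + b.equivFun.symm (fun i => (k i : ℝ)) :=
        map_add b.equivFun.symm x (fun i => (k i : ℝ))
      rw [h1, ← intCoords_coe]
      exact hf.2.1 _ (intCoords b k).2 _
    let c : (Fin n → ℤ) → ℂ := fun m =>
      ∫ x in unitCube n, cubeChar (-m) x * f (b.equivFun.symm x)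
    have hc : ∀ m, 4 * Real.pi ^ 2 * ‖y m‖ ^ 2 ≠ μ → c m = 0 := by
      intro m hm
      have := setIntegral_expChar_mul_eigenfunction b (hdual m) hf hm
      rw [← this]
      refine integral_congr_ae (Eventually.of_forall fun x => ?_)
      simp only
      rw [cubeChar_eq_expChar hbd]
      congr 2
      exact hmy m
    -- only finitely many Fourier coefficients survive, so `f` is a finite sum of characters
    have hS : {m : Fin n → ℤ | 4 * Real.pi ^ 2 * ‖y m‖ ^ 2 = μ}.Finite := by
      have hne : ∀ m : {m : Fin n → ℤ | 4 * Real.pi ^ 2 * ‖y m‖ ^ 2 = μ}, y m.1 ≠ 0 := by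
        intro m h0
        have := m.2
        rw [Set.mem_ofPred_eq, h0] at this
        simp [hμ.symm] at this
      exact Finite.of_injective (β := TorusFrequency (EuclideanLattice.ofBasis b) μ)
        (fun m => ⟨⟨y m.1, hdual m.1, hne m⟩, m.2⟩) (fun m m' h => by
          have : y m.1 = y m'.1 := congrArg (fun z => z.1.1) h
          exact Subtype.ext (hyinj this))
    have hcS : ∀ m ∉ hS.toFinset, c m = 0 := fun m hm => hc m (by simpa using hm)
    have hf' : f = ∑ m ∈ hS.toFinset, c m • expChar (y m) := by
      funext v
      have h := hasSum_cubeChar_of_summable (hf.1.continuous.comp hBc) hper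
        (hasSum_sum_of_ne_finset_zero (L := .unconditional _) hcS).summable (b.equivFun v)
      have h' := hasSum_sum_of_ne_finset_zero (L := .unconditional _)
        (f := fun m => c m * cubeChar m (b.equivFun v))
        (s := hS.toFinset) (fun m hm => by rw [hcS m hm, zero_mul])
      have h'' := h.unique h'
      simp only [Function.comp_apply, LinearEquiv.symm_apply_apply] at h''
      rw [h'', Finset.sum_apply]
      refine Finset.sum_congr rfl fun m _ => ?_
      rw [cubeChar_eq_expChar hbd, LinearEquiv.symm_apply_apply]
      rfl
    rw [hf']
    refine Submodule.sum_mem _ fun m hm => Submodule.smul_mem _ _ (Submodule.subset_span ?_)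
    have hm' : 4 * Real.pi ^ 2 * ‖y m‖ ^ 2 = μ := by simpa using hm
    refine ⟨⟨⟨y m, hdual m, fun h0 => hμ ?_⟩, hm'⟩, rfl⟩
    rw [← hm', h0]
    simp
  · rintro _ ⟨y, rfl⟩
    refine ⟨contDiff_expChar _, fun v hv x => ?_, fun x => ?_⟩
    · change expChar y.1.1 (x + v) = _
      rw [expChar_add, expChar_eq_one y.1.2.1 hv, mul_one]
    · change -(Δ (expChar y.1.1)) x = _
      rw [laplacian_expChar, y.2]

theorem finrank_torusEigenspace (Λ : EuclideanLattice n) {μ : ℝ} (hμ : μ ≠ 0) :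
    finrank ℂ (torusEigenspace Λ μ) = Nat.card (TorusFrequency Λ μ) := by
  have := Fintype.ofFinite (TorusFrequency Λ μ)
  rw [torusEigenspace_eq_span Λ hμ, Nat.card_eq_fintype_card]
  refine finrank_span_eq_card (linearIndependent_expChar.comp
    (fun y : TorusFrequency Λ μ => y.1.1) fun y z h => ?_)
  exact Subtype.ext (Subtype.ext h)

/-- The spectral zeta series of a torus is an Epstein zeta series of the dual lattice. -/
theorem hasSum_torusZetaTerm (Λ : EuclideanLattice n) {s Z : ℂ}
    (h : HasSum (fun y => epsteinTerm Λ.dual y s) Z) :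
    HasSum (fun μ => torusZetaTerm Λ μ s) (((4 * Real.pi ^ 2 : ℝ) : ℂ) ^ (-s) * Z) := by
  let g : Λ.dual.Nonzero → {μ : ℝ // μ ≠ 0} := fun y => ⟨4 * Real.pi ^ 2 * ‖y.1‖ ^ 2, by
    have := EuclideanLattice.Nonzero.norm_pos _ y
    positivity⟩
  have h1 : HasSum (fun y : Λ.dual.Nonzero => (((g y).1 : ℝ) : ℂ) ^ (-s))
      (((4 * Real.pi ^ 2 : ℝ) : ℂ) ^ (-s) * Z) := by
    refine (h.mul_left _).congr_fun fun y => ?_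
    have hy := EuclideanLattice.Nonzero.norm_pos _ y
    simp only [g, epsteinTerm]
    rw [Complex.ofReal_mul, Complex.mul_cpow_ofReal_nonneg (by positivity) (by positivity),
      EuclideanLattice.ofReal_sq_cpow hy]
    ring_nf
  have h2 := ((Equiv.sigmaFiberEquiv g).hasSum_iff.2 h1).sigma (g := fun μ => torusZetaTerm Λ μ s)
  refine h2 fun μ => ?_
  have e : {y // g y = μ} ≃ TorusFrequency Λ μ.1 :=
    Equiv.subtypeEquivRight fun y => Subtype.ext_iff
  have : Finite {y // g y = μ} := Finite.of_equiv _ e.symm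
  have := Fintype.ofFinite {y // g y = μ}
  have h3 := hasSum_fintype fun y : {y // g y = μ} =>
    ((fun y : Λ.dual.Nonzero => (((g y).1 : ℝ) : ℂ) ^ (-s)) ∘ (Equiv.sigmaFiberEquiv g)) ⟨μ, y⟩
  convert h3 using 1
  have h4 : ∀ y : {y // g y = μ}, ((fun y : Λ.dual.Nonzero => (((g y).1 : ℝ) : ℂ) ^ (-s)) ∘
      (Equiv.sigmaFiberEquiv g)) ⟨μ, y⟩ = ((μ.1 : ℝ) : ℂ) ^ (-s) := by
    intro y
    simp [Equiv.sigmaFiberEquiv, y.2]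
  rw [Finset.sum_congr rfl fun y _ => h4 y, Finset.sum_const, torusZetaTerm,
    finrank_torusEigenspace Λ μ.2, ← Nat.card_congr e, Nat.card_eq_fintype_card,
    Finset.card_univ, nsmul_eq_mul]

theorem isMeromorphicContinuation_torusZeta_of (Λ : EuclideanLattice n) {Z : ℂ → ℂ}
    (h : IsMeromorphicContinuation ((n : ℝ) / 2) (epsteinTerm Λ.dual) Z) :
    IsMeromorphicContinuation ((n : ℝ) / 2) (torusZetaTerm Λ)
      (fun s => ((4 * Real.pi ^ 2 : ℝ) : ℂ) ^ (-s) * Z s) := by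
  have hπ : ((4 * Real.pi ^ 2 : ℝ) : ℂ) ≠ 0 := by
    exact_mod_cast (show (0 : ℝ) < 4 * Real.pi ^ 2 by positivity).ne'
  have hd : Differentiable ℂ fun s : ℂ => ((4 * Real.pi ^ 2 : ℝ) : ℂ) ^ (-s) :=
    (differentiable_id.neg).const_cpow (Or.inl hπ)
  exact ⟨fun s hs => hasSum_torusZetaTerm Λ (h.hasSum s hs),
    hd.differentiableOn.mul h.differentiableOn,
    fun s => (hd.analyticAt s).meromorphicAt.mul (h.meromorphic s)⟩

/-- Up to a constant that depends only on the dimension, the height of the torus `ℝⁿ/Λ` is the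
value at `0` of the entire part of the completed Epstein zeta function of `Λ*`. -/
theorem exists_torusHeight_eq (hn : 0 < n) : ∃ K : ℝ, ∀ (Λ : EuclideanLattice n)
    (hΛ : Λ.dual.covol = 1), torusHeight Λ = ((Λ.dual.thetaPair hn hΛ).Λ₀ 0).re + K := by
  let A : ℂ → ℂ := fun s =>
    ((4 * Real.pi ^ 2 : ℝ) : ℂ) ^ (-s) * ((Real.pi : ℂ) ^ s * (Complex.Gamma (s + 1))⁻¹)
  have hn0 : ((n / 2 : ℝ) : ℂ) ≠ 0 := by
    exact_mod_cast (show (0 : ℝ) < n / 2 by positivity).ne'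
  have hA : DifferentiableAt ℂ A 0 := by
    have hπ : ((4 * Real.pi ^ 2 : ℝ) : ℂ) ≠ 0 := by
      exact_mod_cast (show (0 : ℝ) < 4 * Real.pi ^ 2 by positivity).ne'
    have hπ' : (Real.pi : ℂ) ≠ 0 := by exact_mod_cast Real.pi_ne_zero
    have hd : Differentiable ℂ fun s : ℂ => ((4 * Real.pi ^ 2 : ℝ) : ℂ) ^ (-s) :=
      (differentiable_id.neg).const_cpow (Or.inl hπ)
    have h1 : Differentiable ℂ (fun s : ℂ => (Complex.Gamma (s + 1))⁻¹) :=
      Complex.differentiable_one_div_Gamma.comp (by fun_prop)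
    have h3 : Differentiable ℂ (fun s : ℂ => (Real.pi : ℂ) ^ s) :=
      differentiable_id.const_cpow (Or.inl hπ')
    exact (hd.mul (h3.mul h1)) 0
  have hA0 : A 0 = 1 := by simp [A]
  refine ⟨(-(deriv A 0) - ((n / 2 : ℝ) : ℂ)⁻¹).re, fun Λ hΛ => ?_⟩
  set P := Λ.dual.thetaPair hn hΛ with hP
  have h := isMeromorphicContinuation_torusZeta_of Λ
    (Λ.dual.isMeromorphicContinuation_epsteinContinuation hn hΛ)
  have hB : HasDerivAt (fun s : ℂ => s * P.Λ₀ s - 1 - s / ((n / 2 : ℝ) - s))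
      (P.Λ₀ 0 - ((n / 2 : ℝ) : ℂ)⁻¹) 0 := by
    have h1 := ((hasDerivAt_id (0 : ℂ)).mul (P.differentiable_Λ₀ 0).hasDerivAt).sub_const 1
    have h2 := (hasDerivAt_id (0 : ℂ)).div ((hasDerivAt_id (0 : ℂ)).const_sub ((n / 2 : ℝ) : ℂ))
      (by simpa using hn0)
    refine (h1.sub h2).congr_deriv ?_
    simp only [id_eq, sub_zero, zero_mul, add_zero, one_mul]
    field_simp
  have hC := (hA.hasDerivAt.mul hB).deriv
  rw [hA0] at hC
  rw [torusHeight, torusZeta, h.deriv_continuedSum_eq (fun h0 => hn0 (by rw [← h0]))]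
  have hfun : (fun s => ((4 * Real.pi ^ 2 : ℝ) : ℂ) ^ (-s) *
      Λ.dual.epsteinContinuation hn hΛ s) =
      A * fun s : ℂ => s * P.Λ₀ s - 1 - s / ((n / 2 : ℝ) - s) := by
    funext s
    simp only [A, Pi.mul_apply, EuclideanLattice.epsteinContinuation, ← hP]
    ring
  rw [hfun, hC, ← Complex.add_re]
  congr 1
  simp
  ring

end Torus

/-! ### Spherical designs and sums over layers -/

section Sphere

variable {n : ℕ}

open scoped Pointwise in
/-- Linear isometries preserve the surface measure of the sphere. -/
theorem average_sphere_comp (u : EuclideanSpace ℝ (Fin n) ≃ₗᵢ[ℝ] EuclideanSpace ℝ (Fin n))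
    (g : EuclideanSpace ℝ (Fin n) → ℝ) :
    (⨍ x : Metric.sphere (0 : EuclideanSpace ℝ (Fin n)) 1, g (u x.1)
      ∂((volume : Measure (EuclideanSpace ℝ (Fin n))).toSphere)) =
    ⨍ x : Metric.sphere (0 : EuclideanSpace ℝ (Fin n)) 1, g x.1
      ∂((volume : Measure (EuclideanSpace ℝ (Fin n))).toSphere) := by
  let e : Metric.sphere (0 : EuclideanSpace ℝ (Fin n)) 1 ≃ₜ
      Metric.sphere (0 : EuclideanSpace ℝ (Fin n)) 1 :=
    u.toHomeomorph.subtype fun x => by simp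
  have he : MeasurePreserving e (volume : Measure (EuclideanSpace ℝ (Fin n))).toSphere
      (volume : Measure (EuclideanSpace ℝ (Fin n))).toSphere := by
    refine ⟨e.measurable, Measure.ext fun s hs => ?_⟩
    rw [Measure.map_apply e.measurable hs, Measure.toSphere_apply' _ hs,
      Measure.toSphere_apply' _ (e.measurable hs)]
    congr 1
    have hset : Set.Ioo (0 : ℝ) 1 • (Subtype.val '' (e ⁻¹' s)) =
        u ⁻¹' (Set.Ioo (0 : ℝ) 1 • (Subtype.val '' s)) := by
      ext x
      simp only [Set.mem_smul, Set.mem_preimage, Set.mem_image]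
      constructor
      · rintro ⟨r, hr, _, ⟨y, hy, rfl⟩, rfl⟩
        exact ⟨r, hr, _, ⟨e y, hy, rfl⟩, (map_smul u r y.1).symm⟩
      · rintro ⟨r, hr, _, ⟨y, hy, rfl⟩, hx⟩
        refine ⟨r, hr, _, ⟨e.symm y, by simpa using hy, rfl⟩, ?_⟩
        apply u.injective
        rw [map_smul, ← hx]
        congr 1
        exact congrArg Subtype.val (e.apply_symm_apply y)
    rw [hset]
    exact u.measurePreserving.measure_preimage_emb u.toHomeomorph.measurableEmbedding _
  rw [average_eq, average_eq]
  congr 1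
  exact he.integral_comp e.measurableEmbedding fun x => g x.1

/-- By rotation invariance, the moments of the linear forms on the sphere depend only on the norm of
the form. -/
theorem exists_average_inner_pow (hn : 0 < n) (d : ℕ) : ∃ a : ℝ, ∀ p : EuclideanSpace ℝ (Fin n),
    (⨍ x : Metric.sphere (0 : EuclideanSpace ℝ (Fin n)) 1, ⟪p, x.1⟫ ^ d
      ∂((volume : Measure (EuclideanSpace ℝ (Fin n))).toSphere)) = a * ‖p‖ ^ d := by
  let e : EuclideanSpace ℝ (Fin n) := EuclideanSpace.single ⟨0, hn⟩ 1
  have he : ‖e‖ = 1 := by simp [e]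
  refine ⟨⨍ x : Metric.sphere (0 : EuclideanSpace ℝ (Fin n)) 1, ⟪e, x.1⟫ ^ d
      ∂((volume : Measure (EuclideanSpace ℝ (Fin n))).toSphere), fun p => ?_⟩
  have hq : ‖p‖ = ‖‖p‖ • e‖ := by rw [norm_smul, he, norm_norm, mul_one]
  -- the reflection that carries `p` to a multiple of the fixed unit vector `e`
  let u := (ℝ ∙ (p - ‖p‖ • e))ᗮ.reflection
  have hu : u p = ‖p‖ • e := Submodule.reflection_sub hq
  rw [← average_sphere_comp u.symm fun x => ⟪p, x⟫ ^ d]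
  have h1 : ∀ x : EuclideanSpace ℝ (Fin n), ⟪p, u.symm x⟫ ^ d = ‖p‖ ^ d * ⟪e, x⟫ ^ d := by
    intro x
    rw [← u.inner_map_map, u.apply_symm_apply, hu, real_inner_smul_left, mul_pow]
  simp only [h1]
  rw [average_eq, average_eq, integral_const_mul]
  simp only [smul_eq_mul]
  ring

end Sphere

namespace EuclideanLattice

variable {n : ℕ} (L : EuclideanLattice n)

/-- The nonzero lattice vectors of squared norm `m`, as a type. -/
abbrev Layer (m : ℝ) : Type := {x : L.Nonzero // ‖x.1‖ ^ 2 = m}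

instance finite_layer (m : ℝ) : Finite (L.Layer m) := by
  have h1 := (L.summable_exp_neg_mul_sq one_pos).tendsto_cofinite_zero
  have h2 := h1.eventually_lt_const (Real.exp_pos (-m))
  rw [Filter.eventually_cofinite] at h2
  refine (h2.subset ?_ : {y : L.Nonzero | ‖y.1‖ ^ 2 = m}.Finite)
  intro y hy
  have hy' : ‖y.1‖ ^ 2 = m := hy
  simp [← hy']

variable {L}

theorem layer_nonempty_of {m : ℝ} (x : L.Layer m) : (L.layer m).Nonempty :=
  ⟨x.1.1, x.1.2.1, by rw [real_inner_self_eq_norm_sq, x.2]⟩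

theorem sum_rescaled_layer {m : ℝ} (hm : 0 < m) [Fintype (L.Layer m)]
    (hfin : ((fun x => (Real.sqrt m)⁻¹ • x) '' L.layer m).Finite)
    (g : EuclideanSpace ℝ (Fin n) → ℝ) :
    ∑ x ∈ hfin.toFinset, g x = ∑ x : L.Layer m, g ((Real.sqrt m)⁻¹ • x.1.1) := by
  have hs : (Real.sqrt m)⁻¹ ≠ 0 := inv_ne_zero (Real.sqrt_pos.2 hm).ne'
  symm
  refine Finset.sum_bij (fun x _ => (Real.sqrt m)⁻¹ • x.1.1) (fun x _ => ?_) (fun x _ y _ h => ?_)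
    (fun z hz => ?_) (fun x _ => rfl)
  · rw [Set.Finite.mem_toFinset]
    exact ⟨x.1.1, ⟨x.1.2.1, by rw [real_inner_self_eq_norm_sq, x.2]⟩, rfl⟩
  · exact Subtype.ext (Subtype.ext (smul_right_injective _ hs h))
  · rw [Set.Finite.mem_toFinset] at hz
    obtain ⟨x, ⟨hx, hxm⟩, rfl⟩ := hz
    have hx0 : x ≠ 0 := by
      rintro rfl
      simp at hxm
      exact hm.ne hxm
    exact ⟨⟨⟨x, hx, hx0⟩, by rw [← hxm, real_inner_self_eq_norm_sq]⟩, Finset.mem_univ _, rfl⟩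

/-- The design property of a layer, for powers of linear forms. Only these polynomials are needed:
powers of linear forms determine all the moments that enter the second variation. -/
theorem sum_layer_inner_pow {t d : ℕ} (hL : L.LayersHoldDesign t) (hd : d ≤ t) {a : ℝ}
    (ha : ∀ p : EuclideanSpace ℝ (Fin n),
      (⨍ x : Metric.sphere (0 : EuclideanSpace ℝ (Fin n)) 1, ⟪p, x.1⟫ ^ d
        ∂((volume : Measure (EuclideanSpace ℝ (Fin n))).toSphere)) = a * ‖p‖ ^ d)
    {m : ℝ} (hm : 0 < m) [Fintype (L.Layer m)] (p : EuclideanSpace ℝ (Fin n)) :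
    ∑ x : L.Layer m, ⟪p, x.1.1⟫ ^ d =
      Fintype.card (L.Layer m) * (Real.sqrt m ^ d * (a * ‖p‖ ^ d)) := by
  rcases isEmpty_or_nonempty (L.Layer m) with he | ⟨⟨x₀⟩⟩
  · simp
  have hD := hL m hm (layer_nonempty_of x₀)
  have hs : 0 < Real.sqrt m := Real.sqrt_pos.2 hm
  let f : MvPolynomial (Fin n) ℝ := (∑ i, MvPolynomial.C (p i) * MvPolynomial.X i) ^ d
  have hf : f.IsHomogeneous d := by
    have h1 : (∑ i, MvPolynomial.C (p i) * MvPolynomial.X i :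
        MvPolynomial (Fin n) ℝ).IsHomogeneous 1 :=
      MvPolynomial.IsHomogeneous.sum _ _ _ fun i _ => MvPolynomial.isHomogeneous_C_mul_X _ _
    simpa using h1.pow d
  have hev : ∀ x : EuclideanSpace ℝ (Fin n), MvPolynomial.eval (fun i => x i) f = ⟪p, x⟫ ^ d := by
    intro x
    simp [f, PiLp.inner_apply, mul_comm]
  have h2 := hD.average_eq d hd f hf
  simp only [hev] at h2
  have hcard : (((fun x => (Real.sqrt m)⁻¹ • x) '' L.layer m).ncard : ℝ) =
      Fintype.card (L.Layer m) := by
    rw [Set.ncard_eq_toFinset_card _ hD.finite]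
    have := sum_rescaled_layer hm hD.finite fun _ => 1
    simpa using this
  have hc0 : (Fintype.card (L.Layer m) : ℝ) ≠ 0 := by
    have : Nonempty (L.Layer m) := ⟨x₀⟩
    exact_mod_cast Fintype.card_ne_zero
  rw [ha, hcard, sum_rescaled_layer hm hD.finite fun x => ⟪p, x⟫ ^ d] at h2
  simp only [real_inner_smul_right, mul_pow, ← Finset.mul_sum, inv_pow] at h2
  have hsd : Real.sqrt m ^ d ≠ 0 := (pow_pos hs d).ne'
  rw [h2]
  field_simp

theorem sum_layer_norm_pow {m : ℝ} [Fintype (L.Layer m)] (j : ℕ) :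
    ∑ x : L.Layer m, (‖x.1.1‖ ^ 2) ^ j = Fintype.card (L.Layer m) * m ^ j := by
  simp only [fun x : L.Layer m => x.2, Finset.sum_const, Finset.card_univ, nsmul_eq_mul]

section Moments

variable (hL : L.LayersHoldDesign 4) (hn : 0 < n) {m : ℝ} (hm : 0 < m) [Fintype (L.Layer m)]
  (v : OrthonormalBasis (Fin n) ℝ (EuclideanSpace ℝ (Fin n)))

include hL hn hm

/-- The second moments of a layer. The constant is found by summing over `i`. -/
theorem sum_layer_inner_sq (i : Fin n) :
    ∑ x : L.Layer m, ⟪v i, x.1.1⟫ ^ 2 = Fintype.card (L.Layer m) * m / n := by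
  obtain ⟨a, ha⟩ := exists_average_inner_pow hn 2
  have h1 : ∀ i, ∑ x : L.Layer m, ⟪v i, x.1.1⟫ ^ 2 = Fintype.card (L.Layer m) * (m * a) := by
    intro i
    rw [sum_layer_inner_pow hL (by norm_num) ha hm, v.norm_eq_one, Real.sq_sqrt hm.le]
    ring
  have h2 : ∑ i, ∑ x : L.Layer m, ⟪v i, x.1.1⟫ ^ 2 = Fintype.card (L.Layer m) * m := by
    rw [Finset.sum_comm]
    simp only [v.sum_sq_inner_right]
    simpa using sum_layer_norm_pow (L := L) (m := m) 1
  simp only [h1, Finset.sum_const, Finset.card_univ, Fintype.card_fin, nsmul_eq_mul] at h2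
  rw [h1, ← h2]
  have : (n : ℝ) ≠ 0 := by positivity
  field_simp

/-- The fourth moments of a layer. They agree with those of the sphere up to a constant, which is
found by summing over `i` and `j`. -/
theorem sum_layer_inner_sq_mul_inner_sq (i j : Fin n) :
    ∑ x : L.Layer m, ⟪v i, x.1.1⟫ ^ 2 * ⟪v j, x.1.1⟫ ^ 2 =
      Fintype.card (L.Layer m) * m ^ 2 / (n * (n + 2)) * (1 + if i = j then 2 else 0) := by
  classical
  obtain ⟨a, ha⟩ := exists_average_inner_pow hn 4
  have hs4 : Real.sqrt m ^ 4 = m ^ 2 := by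
    rw [show Real.sqrt m ^ 4 = (Real.sqrt m ^ 2) ^ 2 by ring, Real.sq_sqrt hm.le]
  set N : ℝ := (Fintype.card (L.Layer m) : ℝ)
  have h4 : ∀ p : EuclideanSpace ℝ (Fin n), ∑ x : L.Layer m, ⟪p, x.1.1⟫ ^ 4 =
      N * (m ^ 2 * (a * ‖p‖ ^ 4)) := fun p => by
    rw [sum_layer_inner_pow hL le_rfl ha hm, hs4]
  -- polarization of the fourth moments: `(u + w)⁴ + (u - w)⁴ = 2 u⁴ + 12 u² w² + 2 w⁴`
  have hij : ∀ i j, ∑ x : L.Layer m, ⟪v i, x.1.1⟫ ^ 2 * ⟪v j, x.1.1⟫ ^ 2 =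
      N * m ^ 2 * (a / 3) * (1 + if i = j then 2 else 0) := by
    intro i j
    split_ifs with h
    · subst h
      have := h4 (v i)
      rw [v.norm_eq_one] at this
      simp only [← pow_add]
      rw [this]
      ring
    · have h0 : ⟪v i, v j⟫ = 0 := v.orthonormal.2 h
      have hp : ‖v i + v j‖ ^ 2 = 2 := by
        rw [norm_add_sq_real, h0, v.norm_eq_one, v.norm_eq_one]; norm_num
      have hq : ‖v i - v j‖ ^ 2 = 2 := by
        rw [norm_sub_sq_real, h0, v.norm_eq_one, v.norm_eq_one]; norm_num
      have e1 := h4 (v i)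
      have e2 := h4 (v j)
      have e3 := h4 (v i + v j)
      have e4 := h4 (v i - v j)
      rw [v.norm_eq_one] at e1 e2
      rw [show ‖v i + v j‖ ^ 4 = (‖v i + v j‖ ^ 2) ^ 2 by ring, hp] at e3
      rw [show ‖v i - v j‖ ^ 4 = (‖v i - v j‖ ^ 2) ^ 2 by ring, hq] at e4
      have e5 : ∑ x : L.Layer m, ⟪v i + v j, x.1.1⟫ ^ 4 + ∑ x : L.Layer m, ⟪v i - v j, x.1.1⟫ ^ 4 =
          2 * ∑ x : L.Layer m, ⟪v i, x.1.1⟫ ^ 4 + 2 * ∑ x : L.Layer m, ⟪v j, x.1.1⟫ ^ 4 +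
          12 * ∑ x : L.Layer m, ⟪v i, x.1.1⟫ ^ 2 * ⟪v j, x.1.1⟫ ^ 2 := by
        simp only [Finset.mul_sum, ← Finset.sum_add_distrib]
        refine Finset.sum_congr rfl fun x _ => ?_
        rw [inner_add_left, inner_sub_left]
        ring
      linarith
  have hsum : ∑ i, ∑ j, ∑ x : L.Layer m, ⟪v i, x.1.1⟫ ^ 2 * ⟪v j, x.1.1⟫ ^ 2 = N * m ^ 2 := by
    have h1 : ∀ i, ∑ j, ∑ x : L.Layer m, ⟪v i, x.1.1⟫ ^ 2 * ⟪v j, x.1.1⟫ ^ 2 =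
        ∑ x : L.Layer m, ⟪v i, x.1.1⟫ ^ 2 * ‖x.1.1‖ ^ 2 := by
      intro i
      rw [Finset.sum_comm]
      simp only [← Finset.mul_sum, v.sum_sq_inner_right]
    simp only [h1]
    rw [Finset.sum_comm]
    simp only [← Finset.sum_mul, v.sum_sq_inner_right, ← pow_two]
    exact sum_layer_norm_pow 2
  simp only [hij, ← Finset.mul_sum, Finset.sum_add_distrib, Finset.sum_ite_eq, Finset.mem_univ,
    if_true, Finset.sum_const, Finset.card_univ, Fintype.card_fin, nsmul_eq_mul, mul_one] at hsum
  have hne : (n : ℝ) * (n + 2) ≠ 0 := by positivity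
  have hc : N * m ^ 2 * (a / 3) = N * m ^ 2 / (n * (n + 2)) := by
    rw [eq_div_iff hne]
    linear_combination hsum
  rw [hij, hc]

variable {h : Fin n → ℝ}

/-- A layer is balanced for quadratic forms of trace zero: the first variation vanishes. -/
theorem sum_layer_quadratic (h0 : ∑ i, h i = 0) :
    ∑ x : L.Layer m, ∑ i, h i * ⟪v i, x.1.1⟫ ^ 2 = 0 := by
  rw [Finset.sum_comm]
  simp only [← Finset.mul_sum, sum_layer_inner_sq hL hn hm v, ← Finset.sum_mul, h0, zero_mul]

theorem sum_layer_quadratic_sq_coeff :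
    ∑ x : L.Layer m, ∑ i, h i ^ 2 * ⟪v i, x.1.1⟫ ^ 2 =
      ∑ x : L.Layer m, (∑ i, h i ^ 2) / n * ‖x.1.1‖ ^ 2 := by
  rw [Finset.sum_comm]
  have := sum_layer_norm_pow (L := L) (m := m) 1
  simp only [pow_one] at this
  simp only [← Finset.mul_sum, sum_layer_inner_sq hL hn hm v, ← Finset.sum_mul, this]
  ring

/-- On a layer, the square of a quadratic form of trace zero has a sum which depends only on
`∑ hᵢ²`. -/
theorem sum_layer_quadratic_sq (h0 : ∑ i, h i = 0) :
    ∑ x : L.Layer m, (∑ i, h i * ⟪v i, x.1.1⟫ ^ 2) ^ 2 =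
      ∑ x : L.Layer m, 2 * (∑ i, h i ^ 2) / (n * (n + 2)) * (‖x.1.1‖ ^ 2) ^ 2 := by
  have e1 : ∀ x : L.Layer m, (∑ i, h i * ⟪v i, x.1.1⟫ ^ 2) ^ 2 =
      ∑ i, ∑ j, h i * h j * (⟪v i, x.1.1⟫ ^ 2 * ⟪v j, x.1.1⟫ ^ 2) := by
    intro x
    rw [pow_two, Finset.sum_mul_sum]
    exact Finset.sum_congr rfl fun i _ => Finset.sum_congr rfl fun j _ => by ring
  simp only [e1]
  rw [Finset.sum_comm]
  have e2 : ∀ i, ∑ x : L.Layer m, ∑ j, h i * h j * (⟪v i, x.1.1⟫ ^ 2 * ⟪v j, x.1.1⟫ ^ 2) =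
      ∑ j, h i * h j * (Fintype.card (L.Layer m) * m ^ 2 / (n * (n + 2)) *
        (1 + if i = j then 2 else 0)) := by
    intro i
    rw [Finset.sum_comm]
    simp only [← Finset.mul_sum, sum_layer_inner_sq_mul_inner_sq hL hn hm v]
  have e3 : ∀ i, ∑ j, h i * h j * (Fintype.card (L.Layer m) * m ^ 2 / (n * (n + 2)) *
        (1 + if i = j then 2 else 0)) =
      Fintype.card (L.Layer m) * m ^ 2 / (n * (n + 2)) * (h i * ∑ j, h j + 2 * h i ^ 2) := by
    intro i
    have : ∑ j, h i * h j * (if i = j then (2 : ℝ) else 0) = 2 * h i ^ 2 := by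
      simp; ring
    rw [← this, Finset.mul_sum, ← Finset.sum_add_distrib, Finset.mul_sum]
    exact Finset.sum_congr rfl fun j _ => by ring
  simp only [e2, e3, h0, mul_zero, zero_add, ← Finset.mul_sum, sum_layer_norm_pow]
  ring

end Moments

/-- A sum over the nonzero lattice vectors vanishes if it vanishes on each layer. -/
theorem tsum_eq_zero_of_layers {F : L.Nonzero → ℝ} (hF : Summable F)
    (h0 : ∀ m : ℝ, 0 < m → ∀ [Fintype (L.Layer m)], ∑ x : L.Layer m, F x.1 = 0) :
    ∑' x, F x = 0 := by
  let g : L.Nonzero → ℝ := fun x => ‖x.1‖ ^ 2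
  rw [← (Equiv.sigmaFiberEquiv g).tsum_eq]
  change ∑' c, (F ∘ Equiv.sigmaFiberEquiv g) c = 0
  rw [Summable.tsum_sigma' (fun m => ?_) ((Equiv.sigmaFiberEquiv g).summable_iff.2 hF)]
  · rw [← tsum_zero (α := ℝ) (β := ℝ)]
    refine tsum_congr fun m => ?_
    have := Fintype.ofFinite (L.Layer m)
    change ∑' x : L.Layer m, F x.1 = 0
    rcases isEmpty_or_nonempty (L.Layer m) with he | ⟨⟨x₀⟩⟩
    · simp
    rw [tsum_fintype]
    refine h0 m ?_
    rw [← x₀.2]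
    have := Nonzero.norm_pos L x₀.1
    positivity
  · have : Finite { a // g a = m } := finite_layer L m
    exact .of_finite

end EuclideanLattice

/-! ### Second order expansion of deformed Gaussians -/

section Expansion

variable {ι : Type*} [Fintype ι] {h q : ι → ℝ}

theorem pow_le_factorial_mul_exp {Q : ℝ} (hQ : 0 ≤ Q) (k : ℕ) :
    Q ^ k ≤ 4 ^ k * k.factorial * Real.exp (Q / 4) := by
  have h1 := Real.pow_div_factorial_le_exp (Q / 4) (by positivity) k
  rw [div_le_iff₀ (by positivity), div_pow, div_le_iff₀ (by positivity)] at h1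
  linarith

theorem abs_sum_mul_le (hh : ∀ i, |h i| ≤ 1) (hq : ∀ i, 0 ≤ q i) :
    |∑ i, h i * q i| ≤ ∑ i, q i := by
  refine (Finset.abs_sum_le_sum_abs _ _).trans (Finset.sum_le_sum fun i _ => ?_)
  rw [abs_mul, abs_of_nonneg (hq i)]
  exact mul_le_of_le_one_left (hq i) (hh i)

theorem sum_sq_mul_nonneg (hq : ∀ i, 0 ≤ q i) : 0 ≤ ∑ i, h i ^ 2 * q i :=
  Finset.sum_nonneg fun i _ => mul_nonneg (sq_nonneg _) (hq i)

theorem sum_sq_mul_le (hh : ∀ i, |h i| ≤ 1) (hq : ∀ i, 0 ≤ q i) :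
    ∑ i, h i ^ 2 * q i ≤ ∑ i, q i := by
  refine Finset.sum_le_sum fun i _ => mul_le_of_le_one_left (hq i) ?_
  rw [← sq_abs]
  exact pow_le_one₀ (abs_nonneg _) (hh i)

/-- Expansion to second order in `τ` of `exp (-∑ e^{τ hᵢ} qᵢ)`, with a remainder that is uniform in
`h` and `q`. The loss from `exp (-Q)` to `exp (-Q / 2)`, with `Q = ∑ qᵢ`, absorbs the powers of `Q`
in the remainder. -/
theorem abs_exp_deformed_sub_le (hh : ∀ i, |h i| ≤ 1) (hq : ∀ i, 0 ≤ q i) {τ : ℝ} (h0 : 0 ≤ τ)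
    (h1 : τ ≤ 1 / 8) :
    |Real.exp (-∑ i, Real.exp (τ * h i) * q i) - Real.exp (-∑ i, q i) *
        (1 - τ * ∑ i, h i * q i + τ ^ 2 * (((∑ i, h i * q i) ^ 2 - ∑ i, h i ^ 2 * q i) / 2))| ≤
      3124 * τ ^ 3 * Real.exp (-(∑ i, q i) / 2) := by
  set Q := ∑ i, q i with hQdef
  set A := ∑ i, h i * q i with hA
  set B := ∑ i, h i ^ 2 * q i with hB
  have hQ : 0 ≤ Q := Finset.sum_nonneg fun i _ => hq i
  have hAQ : |A| ≤ Q := abs_sum_mul_le hh hq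
  have hB0 : 0 ≤ B := sum_sq_mul_nonneg hq
  have hBQ : B ≤ Q := sum_sq_mul_le hh hq
  -- the exponent is `-Q - u` with `u = τ A + τ² B / 2 + ρ`
  set u := ∑ i, (Real.exp (τ * h i) - 1) * q i with hu
  set ρ := u - (τ * A + τ ^ 2 * B / 2) with hρ
  have hρQ : |ρ| ≤ τ ^ 3 * Q := by
    have : ρ = ∑ i, (Real.exp (τ * h i) - 1 - τ * h i - (τ * h i) ^ 2 / 2) * q i := by
      rw [hρ, hu, hA, hB, Finset.mul_sum, Finset.mul_sum, Finset.sum_div, ← Finset.sum_add_distrib,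
        ← Finset.sum_sub_distrib]
      exact Finset.sum_congr rfl fun i _ => by ring
    rw [this, hQdef, Finset.mul_sum]
    refine (Finset.abs_sum_le_sum_abs _ _).trans (Finset.sum_le_sum fun i _ => ?_)
    rw [abs_mul, abs_of_nonneg (hq i)]
    refine mul_le_mul_of_nonneg_right ?_ (hq i)
    have hy : |τ * h i| ≤ τ := by
      rw [abs_mul, abs_of_nonneg h0]
      exact mul_le_of_le_one_right h0 (hh i)
    have h2 := Real.exp_bound (x := τ * h i) (by linarith) (n := 3) (by norm_num)
    have h3 : |τ * h i| ^ 3 ≤ τ ^ 3 := by gcongr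
    have h4 : Real.exp (τ * h i) - ∑ m ∈ Finset.range 3, (τ * h i) ^ m / (m.factorial : ℝ) =
        Real.exp (τ * h i) - 1 - τ * h i - (τ * h i) ^ 2 / 2 := by
      simp [Finset.sum_range_succ, Nat.factorial]
      ring
    rw [h4] at h2
    refine h2.trans (le_trans ?_ h3)
    refine mul_le_of_le_one_right (by positivity) ?_
    norm_num [Nat.factorial]
  have huQ : |u| ≤ 2 * τ * Q := by
    have h2 : u = τ * A + τ ^ 2 * B / 2 + ρ := by rw [hρ]; ring
    rw [abs_le] at hAQ hρQ ⊢
    have e1 : τ ^ 2 ≤ τ / 8 := by nlinarith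
    have e2 : τ ^ 3 ≤ τ / 64 := by nlinarith
    have e3 : τ ^ 2 * B ≤ τ / 8 * Q := by gcongr
    have e4 : τ ^ 3 * Q ≤ τ / 64 * Q := by gcongr
    have e5 : τ * A ≤ τ * Q := by gcongr; exact hAQ.2
    have e6 : τ * -Q ≤ τ * A := by gcongr; exact hAQ.1
    have e7 : 0 ≤ τ * Q := by positivity
    have e8 : 0 ≤ τ ^ 2 * B := by positivity
    constructor <;> linarith [hρQ.1, hρQ.2]
  -- the remainder of the exponential series in `u`
  set ρ₂ := Real.exp (-u) - (1 - u + u ^ 2 / 2) with hρ₂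
  have hρ₂Q : |ρ₂| ≤ 8 * τ ^ 3 * (Q ^ 3 * Real.exp (Q / 4)) := by
    have h2 := Complex.norm_exp_sub_sum_le_norm_mul_exp ((-u : ℝ) : ℂ) 3
    have h3 : Complex.exp ((-u : ℝ) : ℂ) -
        ∑ m ∈ Finset.range 3, ((-u : ℝ) : ℂ) ^ m / (m.factorial : ℂ) = (ρ₂ : ℂ) := by
      rw [hρ₂]
      push_cast
      simp [Finset.sum_range_succ, Nat.factorial]
      ring
    rw [h3, Complex.norm_real, Complex.norm_real, Real.norm_eq_abs, Real.norm_eq_abs, abs_neg] at h2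
    refine h2.trans ?_
    have e1 : |u| ^ 3 ≤ (2 * τ * Q) ^ 3 := by gcongr
    have e2 : |u| ≤ Q / 4 := huQ.trans (by nlinarith)
    calc |u| ^ 3 * Real.exp |u| ≤ (2 * τ * Q) ^ 3 * Real.exp (Q / 4) := by gcongr
      _ = _ := by ring
  have hdiff : |u ^ 2 - (τ * A) ^ 2| ≤ 3 * τ ^ 3 * Q ^ 2 := by
    have e1 : u ^ 2 - (τ * A) ^ 2 = (u - τ * A) * (u + τ * A) := by ring
    have e2 : |u - τ * A| ≤ τ ^ 2 * Q := by
      have : u - τ * A = τ ^ 2 * B / 2 + ρ := by rw [hρ]; ring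
      rw [this]
      refine (abs_add_le _ _).trans ?_
      rw [abs_of_nonneg (by positivity)]
      have e3 : τ ^ 2 * B ≤ τ ^ 2 * Q := by gcongr
      have e4 : τ ^ 3 * Q ≤ τ ^ 2 * Q / 8 := by
        have : 0 ≤ τ ^ 2 * Q := by positivity
        nlinarith
      have e5 : 0 ≤ τ ^ 2 * Q := by positivity
      linarith
    have e3 : |u + τ * A| ≤ 3 * τ * Q := by
      refine (abs_add_le _ _).trans ?_
      rw [abs_mul, abs_of_nonneg h0]
      have : τ * |A| ≤ τ * Q := by gcongr
      linarith
    rw [e1, abs_mul]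
    calc |u - τ * A| * |u + τ * A| ≤ (τ ^ 2 * Q) * (3 * τ * Q) := by gcongr
      _ = _ := by ring
  have hexp : Real.exp (-∑ i, Real.exp (τ * h i) * q i) = Real.exp (-Q) * Real.exp (-u) := by
    rw [← Real.exp_add]
    congr 1
    rw [hQdef, hu, ← neg_add, ← Finset.sum_add_distrib]
    congr 1
    exact Finset.sum_congr rfl fun i _ => by ring
  -- each of the two factors `exp (Q / 4)` absorbs one contribution to the remainder
  set E := Real.exp (Q / 4) with hE
  have hE1 : 1 ≤ E := Real.one_le_exp (by positivity)
  have hE2 : Real.exp (-Q) * E ^ 2 = Real.exp (-Q / 2) := by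
    rw [hE, ← Real.exp_nat_mul, ← Real.exp_add]
    congr 1
    push_cast
    ring
  have q1 : Q ≤ 4 * E := by simpa using pow_le_factorial_mul_exp hQ 1
  have q2 : Q ^ 2 ≤ 32 * E := by
    have := pow_le_factorial_mul_exp hQ 2
    norm_num [Nat.factorial] at this
    linarith
  have q3 : Q ^ 3 ≤ 384 * E := by
    have := pow_le_factorial_mul_exp hQ 3
    norm_num [Nat.factorial] at this
    linarith
  have hEE : E ≤ E ^ 2 := by nlinarith
  have hτ3 : 0 ≤ τ ^ 3 := by positivity
  rw [hexp, ← mul_sub, abs_mul, abs_of_pos (Real.exp_pos _), ← hE2]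
  have hfin : Real.exp (-u) - (1 - τ * A + τ ^ 2 * ((A ^ 2 - B) / 2)) =
      ρ₂ - ρ + (u ^ 2 - (τ * A) ^ 2) / 2 := by
    rw [hρ₂, hρ]; ring
  have hb : |Real.exp (-u) - (1 - τ * A + τ ^ 2 * ((A ^ 2 - B) / 2))| ≤ 3124 * τ ^ 3 * E ^ 2 := by
    rw [hfin]
    refine (abs_add_le _ _).trans ?_
    have e1 := abs_sub ρ₂ ρ
    have e2 : |(u ^ 2 - (τ * A) ^ 2) / 2| ≤ 3 * τ ^ 3 * Q ^ 2 / 2 := by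
      rw [abs_div, abs_two]; gcongr
    have e3 : 8 * τ ^ 3 * (Q ^ 3 * E) ≤ 8 * τ ^ 3 * (384 * E * E) := by gcongr
    have e4 : τ ^ 3 * Q ≤ τ ^ 3 * (4 * E ^ 2) := by gcongr; linarith
    have e5 : 3 * τ ^ 3 * Q ^ 2 / 2 ≤ 3 * τ ^ 3 * (32 * E ^ 2) / 2 := by gcongr; linarith
    calc |ρ₂ - ρ| + |(u ^ 2 - (τ * A) ^ 2) / 2|
        ≤ 8 * τ ^ 3 * (384 * E * E) + τ ^ 3 * (4 * E ^ 2) + 3 * τ ^ 3 * (32 * E ^ 2) / 2 := by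
          linarith
      _ = _ := by ring
  calc Real.exp (-Q) * |Real.exp (-u) - (1 - τ * A + τ ^ 2 * ((A ^ 2 - B) / 2))|
      ≤ Real.exp (-Q) * (3124 * τ ^ 3 * E ^ 2) := by gcongr
    _ = _ := by ring

/-- Bounds for the coefficients of the expansion. -/
theorem abs_coeff_le (hh : ∀ i, |h i| ≤ 1) (hq : ∀ i, 0 ≤ q i) :
    |Real.exp (-∑ i, q i) * ∑ i, h i * q i| ≤ 4 * Real.exp (-(∑ i, q i) / 2) ∧
    |Real.exp (-∑ i, q i) * (((∑ i, h i * q i) ^ 2 - ∑ i, h i ^ 2 * q i) / 2)| ≤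
      18 * Real.exp (-(∑ i, q i) / 2) := by
  set Q := ∑ i, q i with hQdef
  set A := ∑ i, h i * q i with hA
  set B := ∑ i, h i ^ 2 * q i with hB
  have hQ : 0 ≤ Q := Finset.sum_nonneg fun i _ => hq i
  have hAQ : |A| ≤ Q := abs_sum_mul_le hh hq
  have hB0 : 0 ≤ B := sum_sq_mul_nonneg hq
  have hBQ : B ≤ Q := sum_sq_mul_le hh hq
  set E := Real.exp (Q / 4) with hE
  have hE1 : 1 ≤ E := Real.one_le_exp (by positivity)
  have hEE : E ≤ E ^ 2 := by nlinarith
  have hE2 : Real.exp (-Q) * E ^ 2 = Real.exp (-Q / 2) := by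
    rw [hE, ← Real.exp_nat_mul, ← Real.exp_add]
    congr 1
    push_cast
    ring
  have q1 : Q ≤ 4 * E := by simpa using pow_le_factorial_mul_exp hQ 1
  have q2 : Q ^ 2 ≤ 32 * E := by
    have := pow_le_factorial_mul_exp hQ 2
    norm_num [Nat.factorial] at this
    linarith
  have hA2 : A ^ 2 ≤ Q ^ 2 := by rw [← sq_abs A]; gcongr
  rw [abs_mul, abs_of_pos (Real.exp_pos _), abs_mul, abs_of_pos (Real.exp_pos _), ← hE2]
  constructor
  · calc Real.exp (-Q) * |A| ≤ Real.exp (-Q) * (4 * E ^ 2) := by gcongr; linarith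
      _ = _ := by ring
  · calc Real.exp (-Q) * |(A ^ 2 - B) / 2| ≤ Real.exp (-Q) * (18 * E ^ 2) := by
          gcongr
          rw [abs_le]
          constructor <;> nlinarith [sq_nonneg A]
      _ = _ := by ring

/-- A real number bounded by arbitrarily small multiples vanishes. -/
theorem eq_zero_of_abs_le_mul {a C δ : ℝ} (hδ : 0 < δ) (h : ∀ τ, 0 < τ → τ ≤ δ → |a| ≤ C * τ) :
    a = 0 := by
  have h1 : Tendsto (fun τ : ℝ => C * τ) (𝓝[>] 0) (𝓝 0) := by
    have : Tendsto (fun τ : ℝ => C * τ) (𝓝 0) (𝓝 (C * 0)) :=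
      (continuous_const.mul continuous_id).tendsto 0
    rw [mul_zero] at this
    exact this.mono_left nhdsWithin_le_nhds
  refine abs_nonpos_iff.1 (ge_of_tendsto h1 ?_)
  filter_upwards [Ioc_mem_nhdsGT hδ] with τ hτ using h τ hτ.1 hτ.2

/-- Uniqueness of second order Taylor polynomials. -/
theorem taylor_coeff_eq_zero {a b C δ : ℝ} (hδ : 0 < δ)
    (h : ∀ τ, 0 < τ → τ ≤ δ → |a * τ + b * τ ^ 2| ≤ C * τ ^ 3) : a = 0 ∧ b = 0 := by
  have ha : a = 0 := by
    refine eq_zero_of_abs_le_mul (C := |C| * δ + |b|) hδ fun τ h0 h1 => ?_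
    have h2 := h τ h0 h1
    have h3 : |a * τ| ≤ |a * τ + b * τ ^ 2| + |b * τ ^ 2| := by
      have := abs_sub (a * τ + b * τ ^ 2) (b * τ ^ 2)
      rwa [add_sub_cancel_right] at this
    have h4 : C * τ ^ 3 ≤ |C| * δ * τ * τ := by
      calc C * τ ^ 3 ≤ |C| * τ ^ 3 := by gcongr; exact le_abs_self C
        _ = |C| * τ * τ * τ := by ring
        _ ≤ |C| * δ * τ * τ := by gcongr
    rw [abs_mul, abs_of_pos h0] at h3
    rw [abs_mul b, abs_of_pos (by positivity : 0 < τ ^ 2)] at h3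
    refine le_of_mul_le_mul_right ?_ h0
    nlinarith
  refine ⟨ha, eq_zero_of_abs_le_mul (C := C) hδ fun τ h0 h1 => ?_⟩
  have h2 := h τ h0 h1
  rw [ha, zero_mul, zero_add, abs_mul, abs_of_pos (by positivity : 0 < τ ^ 2)] at h2
  refine le_of_mul_le_mul_right ?_ (by positivity : 0 < τ ^ 2)
  linarith

end Expansion

/-! ### Linear images of lattices -/

namespace EuclideanLattice

variable {n : ℕ}

theorem ext_toSubmodule {L M : EuclideanLattice n} (h : L.toSubmodule = M.toSubmodule) : L = M := by
  cases L
  cases M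
  subst h
  rfl

theorem exists_eq_ofBasis (L : EuclideanLattice n) :
    ∃ b : Basis (Fin n) ℝ (EuclideanSpace ℝ (Fin n)), L = ofBasis b := by
  obtain ⟨b, -, -, hb, -⟩ := dual_exists_basis L
  exact ⟨b, eq_ofBasis hb⟩

theorem map_span_eq (b : Basis (Fin n) ℝ (EuclideanSpace ℝ (Fin n)))
    (g : EuclideanSpace ℝ (Fin n) ≃ₗ[ℝ] EuclideanSpace ℝ (Fin n)) :
    (Submodule.span ℤ (Set.range b)).map (g.toLinearMap.restrictScalars ℤ) =
      Submodule.span ℤ (Set.range (b.map g)) := by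
  rw [Submodule.map_span, ← Set.range_comp]
  rfl

/-- The image `g L` of a lattice under a linear automorphism of `ℝⁿ`. -/
def map (g : EuclideanSpace ℝ (Fin n) ≃ₗ[ℝ] EuclideanSpace ℝ (Fin n)) (L : EuclideanLattice n) :
    EuclideanLattice n where
  toSubmodule := L.toSubmodule.map (g.toLinearMap.restrictScalars ℤ)
  discrete := by
    obtain ⟨b, rfl⟩ := L.exists_eq_ofBasis
    change DiscreteTopology ((Submodule.span ℤ (Set.range b)).map (g.toLinearMap.restrictScalars ℤ))
    rw [map_span_eq]
    infer_instance
  isZLattice := by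
    obtain ⟨b, rfl⟩ := L.exists_eq_ofBasis
    refine @IsZLattice.mk ℝ _ _ _ _ _ (_) ?_
    change Submodule.span ℝ (((Submodule.span ℤ (Set.range b)).map
      (g.toLinearMap.restrictScalars ℤ) : Submodule ℤ _) : Set (EuclideanSpace ℝ (Fin n))) = ⊤
    rw [map_span_eq]
    exact ZSpan.span_top (b.map g)

variable (g g' : EuclideanSpace ℝ (Fin n) ≃ₗ[ℝ] EuclideanSpace ℝ (Fin n)) (L : EuclideanLattice n)

theorem map_ofBasis (b : Basis (Fin n) ℝ (EuclideanSpace ℝ (Fin n))) :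
    (ofBasis b).map g = ofBasis (b.map g) :=
  ext_toSubmodule (map_span_eq b g)

theorem covol_map : (L.map g).covol = |LinearMap.det g.toLinearMap| * L.covol := by
  obtain ⟨b, rfl⟩ := L.exists_eq_ofBasis
  rw [map_ofBasis, covol_ofBasis _ (b.map g) rfl, covol_ofBasis _ b rfl, ← abs_mul,
    ← Basis.det_comp]
  rfl

/-- The bijection `x ↦ g x` between the nonzero vectors of `L` and of `g L`. -/
noncomputable def mapNonzero : L.Nonzero ≃ (L.map g).Nonzero :=
  Equiv.ofBijective (fun x => ⟨g x.1, ⟨x.1, x.2.1, rfl⟩, by simpa using x.2.2⟩) <| by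
    constructor
    · intro x y h
      exact Subtype.ext (g.injective (congrArg (fun z : (L.map g).Nonzero => z.1) h))
    · rintro ⟨_, ⟨x, hx, rfl⟩, h0⟩
      exact ⟨⟨x, hx, fun h => h0 (by simp [h])⟩, rfl⟩

theorem theta_map (t : ℝ) :
    (L.map g).theta t = ∑' x : L.Nonzero, Real.exp (-(Real.pi * t) * ‖g x.1‖ ^ 2) := by
  rw [theta, ← (mapNonzero g L).tsum_eq]
  rfl

theorem dual_map (h : ∀ x y, ⟪g' y, g x⟫ = ⟪y, x⟫) : (L.map g).dual = L.dual.map g' := by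
  refine ext_toSubmodule (SetLike.ext fun y => ?_)
  change (∀ x ∈ L.map g, ∃ k : ℤ, ⟪y, x⟫ = (k : ℝ)) ↔
    ∃ z, (∀ x ∈ L, ∃ k : ℤ, ⟪z, x⟫ = (k : ℝ)) ∧ g' z = y
  constructor
  · intro hy
    refine ⟨g'.symm y, fun x hx => ?_, g'.apply_symm_apply y⟩
    rw [← h, g'.apply_symm_apply]
    exact hy _ ⟨x, hx, rfl⟩
  · rintro ⟨z, hz, rfl⟩ _ ⟨x, hx, rfl⟩
    have := hz x hx
    rw [← h] at this
    exact this

theorem dual_dual : L.dual.dual = L := by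
  obtain ⟨b, d, hbd, hb, hd⟩ := dual_exists_basis L
  have hb' : L = ofBasis b := eq_ofBasis hb
  refine ext_toSubmodule (le_antisymm (fun x hx => ?_) (fun x hx y hy => ?_))
  · change x ∈ dualSubmodule (dualSubmodule L.toSubmodule) at hx
    have hc : ∀ i, ∃ k : ℤ, b.repr x i = k := by
      intro i
      have hdi : d i ∈ dualSubmodule L.toSubmodule := by
        rw [hd]; exact Submodule.subset_span ⟨i, rfl⟩
      obtain ⟨k, hk⟩ := hx (d i) hdi
      refine ⟨k, ?_⟩
      rw [← hk, real_inner_comm]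
      have h1 : ⟪d i, ∑ j, b.repr x j • b j⟫ = b.repr x i := by
        simp only [inner_sum, real_inner_smul_right, hbd]
        simp
      rw [← h1, b.sum_repr]
    choose k hk using hc
    rw [hb, ← b.sum_repr x]
    refine Submodule.sum_mem _ fun i _ => ?_
    rw [hk, Int.cast_smul_eq_zsmul]
    exact Submodule.smul_mem _ _ (Submodule.subset_span ⟨i, rfl⟩)
  · obtain ⟨k, hk⟩ := hy x hx
    exact ⟨k, by rw [real_inner_comm, hk]⟩

end EuclideanLattice

section SpectralMap

variable {n : ℕ} (v : OrthonormalBasis (Fin n) ℝ (EuclideanSpace ℝ (Fin n))) (h : Fin n → ℝ)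

/-- The positive definite map with eigenvectors `vᵢ` and eigenvalues `exp (hᵢ / 2)`. -/
noncomputable def spectralMap : EuclideanSpace ℝ (Fin n) ≃ₗ[ℝ] EuclideanSpace ℝ (Fin n) :=
  v.toBasis.equivFun ≪≫ₗ (LinearEquiv.piCongrRight fun i =>
    LinearEquiv.smulOfNeZero ℝ ℝ (Real.exp (h i / 2)) (Real.exp_pos _).ne') ≪≫ₗ
    v.toBasis.equivFun.symm

theorem spectralMap_apply (x : EuclideanSpace ℝ (Fin n)) :
    spectralMap v h x = ∑ i, (Real.exp (h i / 2) * ⟪v i, x⟫) • v i := by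
  rw [spectralMap, LinearEquiv.trans_apply, LinearEquiv.trans_apply, Basis.equivFun_symm_apply]
  refine Finset.sum_congr rfl fun i _ => ?_
  rw [OrthonormalBasis.coe_toBasis, ← OrthonormalBasis.repr_apply_apply]
  rfl

theorem inner_spectralMap (i : Fin n) (x : EuclideanSpace ℝ (Fin n)) :
    ⟪v i, spectralMap v h x⟫ = Real.exp (h i / 2) * ⟪v i, x⟫ := by
  rw [spectralMap_apply, inner_sum]
  simp [real_inner_smul_right, orthonormal_iff_ite.1 v.orthonormal]

theorem norm_spectralMap_sq (x : EuclideanSpace ℝ (Fin n)) :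
    ‖spectralMap v h x‖ ^ 2 = ∑ i, Real.exp (h i) * ⟪v i, x⟫ ^ 2 := by
  rw [← v.sum_sq_inner_right]
  refine Finset.sum_congr rfl fun i _ => ?_
  rw [inner_spectralMap, mul_pow, ← Real.exp_nat_mul]
  congr 2
  push_cast
  ring

theorem inner_spectralMap_neg (x y : EuclideanSpace ℝ (Fin n)) :
    ⟪spectralMap v (-h) y, spectralMap v h x⟫ = ⟪y, x⟫ := by
  rw [← v.sum_inner_mul_inner, ← v.sum_inner_mul_inner y x]
  refine Finset.sum_congr rfl fun i _ => ?_
  rw [inner_spectralMap, real_inner_comm, inner_spectralMap, real_inner_comm y]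
  have : Real.exp ((-h) i / 2) * Real.exp (h i / 2) = 1 := by
    rw [← Real.exp_add]; simp [neg_div]
  linear_combination (⟪y, v i⟫ * ⟪v i, x⟫) * this

theorem det_spectralMap (h0 : ∑ i, h i = 0) : LinearMap.det (spectralMap v h).toLinearMap = 1 := by
  classical
  have hM : LinearMap.toMatrix v.toBasis v.toBasis (spectralMap v h).toLinearMap =
      Matrix.diagonal fun i => Real.exp (h i / 2) := by
    ext i j
    rw [LinearMap.toMatrix_apply, OrthonormalBasis.coe_toBasis_repr_apply,
      OrthonormalBasis.repr_apply_apply, OrthonormalBasis.coe_toBasis]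
    change ⟪v i, spectralMap v h (v j)⟫ = _
    rw [inner_spectralMap, orthonormal_iff_ite.1 v.orthonormal, Matrix.diagonal_apply]
    simp
  rw [← LinearMap.det_toMatrix v.toBasis, hM, Matrix.det_diagonal, ← Real.exp_sum, ← Finset.sum_div,
    h0, zero_div, Real.exp_zero]

theorem EuclideanLattice.covol_map_spectralMap (L : EuclideanLattice n) (h0 : ∑ i, h i = 0) :
    (L.map (spectralMap v h)).covol = L.covol := by
  rw [covol_map, det_spectralMap v h h0, abs_one, one_mul]

theorem EuclideanLattice.theta_map_spectralMap (L : EuclideanLattice n) (t : ℝ) :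
    (L.map (spectralMap v h)).theta t =
      ∑' x : L.Nonzero, Real.exp (-∑ i, Real.exp (h i) * (Real.pi * t * ⟪v i, x.1⟫ ^ 2)) := by
  rw [theta_map]
  refine tsum_congr fun x => ?_
  rw [norm_spectralMap_sq, neg_mul, Finset.mul_sum]
  congr 2
  exact Finset.sum_congr rfl fun i _ => by ring

end SpectralMap

/-! ### Second variation of the theta series -/

namespace EuclideanLattice

variable {n : ℕ} (L : EuclideanLattice n)
  (v : OrthonormalBasis (Fin n) ℝ (EuclideanSpace ℝ (Fin n))) (h : Fin n → ℝ)

/-- Minus the first variation of the theta series in the direction `h`. -/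
noncomputable def firstCoeff (t : ℝ) : ℝ :=
  ∑' x : L.Nonzero, Real.exp (-∑ i, Real.pi * t * ⟪v i, x.1⟫ ^ 2) *
    ∑ i, h i * (Real.pi * t * ⟪v i, x.1⟫ ^ 2)

/-- Half of the second variation of the theta series in the direction `h`. The term with `hᵢ²` comes
from the second order term of `exp (τ hᵢ)`. -/
noncomputable def secondCoeff (t : ℝ) : ℝ :=
  ∑' x : L.Nonzero, Real.exp (-∑ i, Real.pi * t * ⟪v i, x.1⟫ ^ 2) *
    (((∑ i, h i * (Real.pi * t * ⟪v i, x.1⟫ ^ 2)) ^ 2 -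
      ∑ i, h i ^ 2 * (Real.pi * t * ⟪v i, x.1⟫ ^ 2)) / 2)

theorem sum_pi_mul_inner_sq (t : ℝ) (x : EuclideanSpace ℝ (Fin n)) :
    ∑ i, Real.pi * t * ⟪v i, x⟫ ^ 2 = Real.pi * t * ‖x‖ ^ 2 := by
  rw [← Finset.mul_sum, v.sum_sq_inner_right]

theorem hasSum_theta_half {t : ℝ} (ht : 0 < t) :
    HasSum (fun x : L.Nonzero => Real.exp (-(∑ i, Real.pi * t * ⟪v i, x.1⟫ ^ 2) / 2))
      (L.theta (1 / 2 * t)) := by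
  have h1 := (L.summable_exp_neg_mul_sq (a := Real.pi * (1 / 2 * t))
    (by have := Real.pi_pos; positivity)).hasSum
  refine h1.congr_fun fun x => ?_
  rw [sum_pi_mul_inner_sq]
  congr 1
  ring

variable {h}

theorem pi_mul_inner_sq_nonneg {t : ℝ} (ht : 0 < t) (x : EuclideanSpace ℝ (Fin n)) (i : Fin n) :
    0 ≤ Real.pi * t * ⟪v i, x⟫ ^ 2 := by
  have := Real.pi_pos
  positivity

theorem summable_secondCoeff (hh : ∀ i, |h i| ≤ 1) {t : ℝ} (ht : 0 < t) :
    Summable fun x : L.Nonzero => Real.exp (-∑ i, Real.pi * t * ⟪v i, x.1⟫ ^ 2) *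
      (((∑ i, h i * (Real.pi * t * ⟪v i, x.1⟫ ^ 2)) ^ 2 -
        ∑ i, h i ^ 2 * (Real.pi * t * ⟪v i, x.1⟫ ^ 2)) / 2) :=
  Summable.of_norm_bounded ((L.hasSum_theta_half v ht).summable.mul_left 18) fun x =>
    (abs_coeff_le hh (pi_mul_inner_sq_nonneg v ht x.1)).2

theorem summable_firstCoeff (hh : ∀ i, |h i| ≤ 1) {t : ℝ} (ht : 0 < t) :
    Summable fun x : L.Nonzero => Real.exp (-∑ i, Real.pi * t * ⟪v i, x.1⟫ ^ 2) *
      ∑ i, h i * (Real.pi * t * ⟪v i, x.1⟫ ^ 2) :=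
  Summable.of_norm_bounded ((L.hasSum_theta_half v ht).summable.mul_left 4) fun x =>
    (abs_coeff_le hh (pi_mul_inner_sq_nonneg v ht x.1)).1

theorem abs_secondCoeff_le (hh : ∀ i, |h i| ≤ 1) {t : ℝ} (ht : 0 < t) :
    |L.secondCoeff v h t| ≤ 18 * L.theta (1 / 2 * t) := by
  rw [secondCoeff, ← Real.norm_eq_abs]
  exact tsum_of_norm_bounded ((L.hasSum_theta_half v ht).mul_left 18) fun x =>
    (abs_coeff_le hh (pi_mul_inner_sq_nonneg v ht x.1)).2

/-- Second order expansion of the theta series under a deformation of the lattice. -/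
theorem abs_theta_map_sub_le (hh : ∀ i, |h i| ≤ 1) {t : ℝ} (ht : 0 < t) {τ : ℝ} (h0 : 0 ≤ τ)
    (h1 : τ ≤ 1 / 8) :
    |(L.map (spectralMap v (τ • h))).theta t -
      (L.theta t - τ * L.firstCoeff v h t + τ ^ 2 * L.secondCoeff v h t)| ≤
      3124 * τ ^ 3 * L.theta (1 / 2 * t) := by
  have hs0 : Summable fun x : L.Nonzero => Real.exp (-∑ i, Real.pi * t * ⟪v i, x.1⟫ ^ 2) := by
    refine (L.summable_exp_neg_mul_sq (a := Real.pi * t)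
      (by have := Real.pi_pos; positivity)).congr fun x => ?_
    rw [sum_pi_mul_inner_sq, neg_mul]
  have hs1 := L.summable_firstCoeff v hh ht
  have hs2 := L.summable_secondCoeff v hh ht
  have hm := ((hs0.sub (hs1.mul_left τ)).add (hs2.mul_left (τ ^ 2)))
  have hbd := fun x : L.Nonzero =>
    abs_exp_deformed_sub_le hh (pi_mul_inner_sq_nonneg v ht x.1) h0 h1
  have hB := (L.hasSum_theta_half v ht).mul_left (3124 * τ ^ 3)
  rw [L.theta_map_spectralMap]
  simp only [Pi.smul_apply, smul_eq_mul]
  have hθ : L.theta t = ∑' x : L.Nonzero, Real.exp (-∑ i, Real.pi * t * ⟪v i, x.1⟫ ^ 2) :=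
    tsum_congr fun x => by rw [sum_pi_mul_inner_sq, neg_mul]
  have hd : Summable fun x : L.Nonzero =>
      Real.exp (-∑ i, Real.exp (τ * h i) * (Real.pi * t * ⟪v i, x.1⟫ ^ 2)) -
      (Real.exp (-∑ i, Real.pi * t * ⟪v i, x.1⟫ ^ 2) -
        τ * (Real.exp (-∑ i, Real.pi * t * ⟪v i, x.1⟫ ^ 2) *
          ∑ i, h i * (Real.pi * t * ⟪v i, x.1⟫ ^ 2)) +
        τ ^ 2 * (Real.exp (-∑ i, Real.pi * t * ⟪v i, x.1⟫ ^ 2) *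
          (((∑ i, h i * (Real.pi * t * ⟪v i, x.1⟫ ^ 2)) ^ 2 -
          ∑ i, h i ^ 2 * (Real.pi * t * ⟪v i, x.1⟫ ^ 2)) / 2))) := by
    refine Summable.of_norm_bounded hB.summable fun x => le_of_eq_of_le ?_ (hbd x)
    rw [Real.norm_eq_abs]
    congr 1
    ring
  have hf : Summable fun x : L.Nonzero =>
      Real.exp (-∑ i, Real.exp (τ * h i) * (Real.pi * t * ⟪v i, x.1⟫ ^ 2)) :=
    (hd.add hm).congr fun x => by ring
  rw [hθ, firstCoeff, secondCoeff, ← tsum_mul_left, ← tsum_mul_left,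
    ← hs0.tsum_sub (hs1.mul_left τ), ← (hs0.sub (hs1.mul_left τ)).tsum_add (hs2.mul_left (τ ^ 2)),
    ← hf.tsum_sub hm, ← Real.norm_eq_abs]
  refine tsum_of_norm_bounded hB fun x => le_of_eq_of_le ?_ (hbd x)
  rw [Real.norm_eq_abs]
  congr 1
  ring

/-- The second variation of the theta series of a lattice whose layers hold `4`-designs, in a
direction `h` of trace zero with `∑ hᵢ² = 1`, is twice this function. -/
noncomputable def designKernel (t : ℝ) : ℝ :=
  (Real.pi * t) ^ 2 / (n * (n + 2)) * L.momentTheta 2 t - Real.pi * t / (2 * n) * L.momentTheta 1 t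

variable {L}

theorem firstCoeff_eq_zero (hL : L.LayersHoldDesign 4) (hn : 0 < n) (hh : ∀ i, |h i| ≤ 1)
    (hs : ∑ i, h i = 0) {t : ℝ} (ht : 0 < t) : L.firstCoeff v h t = 0 := by
  refine tsum_eq_zero_of_layers (L.summable_firstCoeff v hh ht) fun m hm _ => ?_
  have h1 : ∀ x : L.Layer m, Real.exp (-∑ i, Real.pi * t * ⟪v i, x.1.1⟫ ^ 2) *
      ∑ i, h i * (Real.pi * t * ⟪v i, x.1.1⟫ ^ 2) =
      Real.exp (-(Real.pi * t * m)) * (Real.pi * t) * ∑ i, h i * ⟪v i, x.1.1⟫ ^ 2 := by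
    intro x
    have a1 : ∑ i, h i * (Real.pi * t * ⟪v i, x.1.1⟫ ^ 2) =
        Real.pi * t * ∑ i, h i * ⟪v i, x.1.1⟫ ^ 2 := by
      rw [Finset.mul_sum]
      exact Finset.sum_congr rfl fun i _ => by ring
    rw [a1, sum_pi_mul_inner_sq, x.2, ← mul_assoc]
  rw [Finset.sum_congr rfl fun x _ => h1 x, ← Finset.mul_sum, sum_layer_quadratic hL hn hm v hs,
    mul_zero]

theorem secondCoeff_eq (hL : L.LayersHoldDesign 4) (hn : 0 < n) (hh : ∀ i, |h i| ≤ 1)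
    (hs : ∑ i, h i = 0) {t : ℝ} (ht : 0 < t) :
    L.secondCoeff v h t = (∑ i, h i ^ 2) * L.designKernel t := by
  have hπ := Real.pi_pos
  set H := ∑ i, h i ^ 2 with hH
  have hn0 : (n : ℝ) ≠ 0 := by positivity
  have hs2 := L.summable_secondCoeff v hh ht
  have hm1 := (L.summable_pow_mul_exp_neg_mul_sq (a := Real.pi * t) (by positivity) 1).mul_left
    (H * (Real.pi * t / (2 * n)))
  have hm2 := (L.summable_pow_mul_exp_neg_mul_sq (a := Real.pi * t) (by positivity) 2).mul_left
    (H * ((Real.pi * t) ^ 2 / (n * (n + 2))))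
  have hkey := tsum_eq_zero_of_layers (hs2.sub (hm2.sub hm1)) fun m hm _ => ?_
  · rw [hs2.tsum_sub (hm2.sub hm1), hm2.tsum_sub hm1, tsum_mul_left, tsum_mul_left] at hkey
    rw [designKernel, mul_sub, ← mul_assoc, ← mul_assoc]
    exact sub_eq_zero.1 hkey
  · have e1 : ∀ x : L.Layer m, Real.exp (-∑ i, Real.pi * t * ⟪v i, x.1.1⟫ ^ 2) *
        (((∑ i, h i * (Real.pi * t * ⟪v i, x.1.1⟫ ^ 2)) ^ 2 -
          ∑ i, h i ^ 2 * (Real.pi * t * ⟪v i, x.1.1⟫ ^ 2)) / 2) -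
        (H * ((Real.pi * t) ^ 2 / (n * (n + 2))) *
            ((‖x.1.1‖ ^ 2) ^ 2 * Real.exp (-(Real.pi * t) * ‖x.1.1‖ ^ 2)) -
          H * (Real.pi * t / (2 * n)) *
            ((‖x.1.1‖ ^ 2) ^ 1 * Real.exp (-(Real.pi * t) * ‖x.1.1‖ ^ 2))) =
        Real.exp (-(Real.pi * t * m)) * ((Real.pi * t) ^ 2 / 2 *
            ((∑ i, h i * ⟪v i, x.1.1⟫ ^ 2) ^ 2 - 2 * H / (n * (n + 2)) * (‖x.1.1‖ ^ 2) ^ 2) -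
          Real.pi * t / 2 * (∑ i, h i ^ 2 * ⟪v i, x.1.1⟫ ^ 2 - H / n * ‖x.1.1‖ ^ 2)) := by
      intro x
      have a1 : ∑ i, h i * (Real.pi * t * ⟪v i, x.1.1⟫ ^ 2) =
          Real.pi * t * ∑ i, h i * ⟪v i, x.1.1⟫ ^ 2 := by
        rw [Finset.mul_sum]
        exact Finset.sum_congr rfl fun i _ => by ring
      have a2 : ∑ i, h i ^ 2 * (Real.pi * t * ⟪v i, x.1.1⟫ ^ 2) =
          Real.pi * t * ∑ i, h i ^ 2 * ⟪v i, x.1.1⟫ ^ 2 := by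
        rw [Finset.mul_sum]
        exact Finset.sum_congr rfl fun i _ => by ring
      rw [a1, a2, sum_pi_mul_inner_sq, x.2, neg_mul]
      field_simp
      ring
    rw [Finset.sum_congr rfl fun x _ => e1 x, ← Finset.mul_sum, Finset.sum_sub_distrib,
      ← Finset.mul_sum, ← Finset.mul_sum, Finset.sum_sub_distrib, Finset.sum_sub_distrib,
      sum_layer_quadratic_sq hL hn hm v hs, sum_layer_quadratic_sq_coeff hL hn hm v,
      ← hH]
    simp

variable (L)

/-- Up to constants, a majorant for the variation of the theta series that decays rapidly both at
`∞` and, by the functional equation, at `0`. -/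
noncomputable def thetaBound (t : ℝ) : ℝ :=
  min (L.theta (1 / 2 * t)) (t ^ (-((n : ℝ) / 2)) * L.dual.theta (1 / 2 * t⁻¹))

theorem thetaBound_nonneg {t : ℝ} (ht : 0 < t) : 0 ≤ L.thetaBound t :=
  le_min (L.theta_nonneg _) (mul_nonneg (by positivity) (L.dual.theta_nonneg _))

variable {L}

/-- The functional equation for a deformed lattice: the deformation of the dual is the inverse
one. -/
theorem theta_map_sub_theta (hL1 : L.covol = 1) (hs : ∑ i, h i = 0) {t : ℝ} (ht : 0 < t) (τ : ℝ) :
    (L.map (spectralMap v (τ • h))).theta t - L.theta t = t ^ (-((n : ℝ) / 2)) *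
      ((L.dual.map (spectralMap v (τ • (-h)))).theta t⁻¹ - L.dual.theta t⁻¹) := by
  have hs' : ∑ i, (τ • h) i = 0 := by simp [← Finset.mul_sum, hs]
  have h1 := L.one_add_theta hL1 ht
  have h2 := (L.map (spectralMap v (τ • h))).one_add_theta
    ((L.covol_map_spectralMap v _ hs').trans hL1) ht
  rw [L.dual_map (spectralMap v (τ • h)) (spectralMap v (-(τ • h)))
    (inner_spectralMap_neg v (τ • h)), ← smul_neg] at h2
  linear_combination h2 - h1

/-- The key estimate: at every `t`, the second order Taylor expansion of the theta series of a
deformation is `τ² |h|²` times the kernel, up to `O(τ³)` with a rapidly decaying constant. For large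
`t` this is the expansion of the series. For small `t` the remainder is estimated through the
functional equation; the Taylor coefficients do not change, by uniqueness. -/
theorem theta_map_spectralMap_expansion (hL1 : L.covol = 1) (hL : L.LayersHoldDesign 4) (hn : 0 < n)
    (hh : ∀ i, |h i| ≤ 1) (hs : ∑ i, h i = 0) {t : ℝ} (ht : 0 < t) :
    |(∑ i, h i ^ 2) * L.designKernel t| ≤ 18 * L.thetaBound t ∧
    ∀ τ, 0 < τ → τ ≤ 1 / 8 →
      |(L.map (spectralMap v (τ • h))).theta t - L.theta t -
        τ ^ 2 * ((∑ i, h i ^ 2) * L.designKernel t)| ≤ 3124 * τ ^ 3 * L.thetaBound t := by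
  have hti : 0 < t⁻¹ := inv_pos.2 ht
  have hh' : ∀ i, |(-h) i| ≤ 1 := fun i => by simpa using hh i
  set T : ℝ := t ^ (-((n : ℝ) / 2)) with hT
  have hT0 : 0 < T := by positivity
  set c := (∑ i, h i ^ 2) * L.designKernel t with hc
  have hc2 : L.secondCoeff v h t = c := secondCoeff_eq v hL hn hh hs ht
  set d₁ := L.dual.firstCoeff v (-h) t⁻¹
  set d₂ := L.dual.secondCoeff v (-h) t⁻¹
  have hprimal : ∀ τ, 0 < τ → τ ≤ 1 / 8 →
      |(L.map (spectralMap v (τ • h))).theta t - L.theta t - τ ^ 2 * c| ≤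
        3124 * τ ^ 3 * L.theta (1 / 2 * t) := by
    intro τ h0 h1
    have := L.abs_theta_map_sub_le v hh ht h0.le h1
    rw [hc2, firstCoeff_eq_zero v hL hn hh hs ht] at this
    refine le_of_eq_of_le ?_ this
    congr 1
    ring
  have hdual : ∀ τ, 0 < τ → τ ≤ 1 / 8 →
      |(L.map (spectralMap v (τ • h))).theta t - L.theta t - (-(T * d₁) * τ + T * d₂ * τ ^ 2)| ≤
        3124 * τ ^ 3 * (T * L.dual.theta (1 / 2 * t⁻¹)) := by
    intro τ h0 h1
    have := L.dual.abs_theta_map_sub_le v hh' hti h0.le h1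
    rw [theta_map_sub_theta v hL1 hs ht]
    calc _ = |T * ((L.dual.map (spectralMap v (τ • (-h)))).theta t⁻¹ -
          (L.dual.theta t⁻¹ - τ * d₁ + τ ^ 2 * d₂))| := by
          congr 1
          ring
      _ ≤ T * (3124 * τ ^ 3 * L.dual.theta (1 / 2 * t⁻¹)) := by
          rw [abs_mul, abs_of_pos hT0]
          gcongr
      _ = _ := by ring
  obtain ⟨hcoef1, hcoef⟩ := taylor_coeff_eq_zero (a := -(T * d₁)) (b := T * d₂ - c)
    (C := 3124 * L.theta (1 / 2 * t) + 3124 * (T * L.dual.theta (1 / 2 * t⁻¹)))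
    (δ := 1 / 8) (by norm_num) fun τ h0 h1 => by
      have e1 := hprimal τ h0 h1
      have e2 := hdual τ h0 h1
      set X := (L.map (spectralMap v (τ • h))).theta t - L.theta t
      calc |(-(T * d₁)) * τ + (T * d₂ - c) * τ ^ 2|
          = |(X - τ ^ 2 * c) - (X - (-(T * d₁) * τ + T * d₂ * τ ^ 2))| := by
            congr 1
            ring
        _ ≤ _ := abs_sub _ _
        _ ≤ _ := add_le_add e1 e2
        _ = _ := by ring
  have hc' : c = T * d₂ := by linarith
  constructor
  · rw [thetaBound, mul_min_of_nonneg _ _ (by norm_num : (0 : ℝ) ≤ 18)]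
    refine le_min ?_ ?_
    · rw [← hc2]
      exact L.abs_secondCoeff_le v hh ht
    · rw [hc', abs_mul, abs_of_pos hT0]
      calc T * |d₂| ≤ T * (18 * L.dual.theta (1 / 2 * t⁻¹)) := by
            gcongr
            exact L.dual.abs_secondCoeff_le v hh' hti
        _ = _ := by ring
  · intro τ h0 h1
    rw [thetaBound, mul_min_of_nonneg _ _ (by positivity : (0 : ℝ) ≤ 3124 * τ ^ 3)]
    refine le_min (hprimal τ h0 h1) ?_
    have := hdual τ h0 h1
    rw [hcoef1, ← hc', zero_mul, zero_add, mul_comm c] at this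
    exact this

/-- The majorant is integrable against every power of `t`. -/
theorem exists_rpow_mul_thetaBound_le (L : EuclideanLattice n) (s : ℝ) :
    ∃ C : ℝ, 0 ≤ C ∧ ∀ t : ℝ, 0 < t → t ^ (s - 1) * L.thetaBound t ≤ C * (1 + t ^ 2)⁻¹ := by
  obtain ⟨C₁, hC₁, h₁⟩ := L.exists_theta_mul_rpow_le (c := 1 / 2) (by norm_num) (s + 1)
  obtain ⟨C₂, hC₂, h₂⟩ := L.dual.exists_theta_mul_rpow_le (c := 1 / 2) (by norm_num)
    ((n : ℝ) / 2 - (s - 1))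
  refine ⟨2 * C₁ + 2 * C₂, by positivity, fun t ht => ?_⟩
  rw [← div_eq_mul_inv, le_div_iff₀ (by positivity)]
  have hb := L.thetaBound_nonneg ht
  rcases le_total 1 t with h | h
  · have e1 := h₁ t h
    have e2 : t ^ (s + 1) = t ^ (s - 1) * t ^ 2 := by
      rw [← Real.rpow_natCast, ← Real.rpow_add ht]
      congr 1
      push_cast
      ring
    have e3 : L.thetaBound t ≤ L.theta (1 / 2 * t) := min_le_left _ _
    have e4 : (1 : ℝ) ≤ t ^ 2 := one_le_pow₀ h
    calc t ^ (s - 1) * L.thetaBound t * (1 + t ^ 2)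
        ≤ t ^ (s - 1) * L.theta (1 / 2 * t) * (t ^ 2 + t ^ 2) := by
          have := L.theta_nonneg (1 / 2 * t)
          gcongr
      _ = 2 * (L.theta (1 / 2 * t) * t ^ (s + 1)) := by rw [e2]; ring
      _ ≤ 2 * C₁ + 2 * C₂ := by linarith
  · have e1 := h₂ t⁻¹ (one_le_inv_iff₀.2 ⟨ht, h⟩)
    have e2 : t⁻¹ ^ ((n : ℝ) / 2 - (s - 1)) = t ^ (s - 1) * t ^ (-((n : ℝ) / 2)) := by
      rw [Real.inv_rpow ht.le, ← Real.rpow_neg ht.le, ← Real.rpow_add ht]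
      congr 1
      ring
    have e3 : L.thetaBound t ≤ t ^ (-((n : ℝ) / 2)) * L.dual.theta (1 / 2 * t⁻¹) := min_le_right _ _
    have e4 : t ^ 2 ≤ 1 := pow_le_one₀ ht.le h
    calc t ^ (s - 1) * L.thetaBound t * (1 + t ^ 2)
        ≤ t ^ (s - 1) * (t ^ (-((n : ℝ) / 2)) * L.dual.theta (1 / 2 * t⁻¹)) * (1 + 1) := by
          have := L.dual.theta_nonneg (1 / 2 * t⁻¹)
          gcongr
      _ = 2 * (L.dual.theta (1 / 2 * t⁻¹) * t⁻¹ ^ ((n : ℝ) / 2 - (s - 1))) := by rw [e2]; ring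
      _ ≤ 2 * C₁ + 2 * C₂ := by linarith

end EuclideanLattice

/-! ### Mellin transforms -/

namespace EuclideanLattice

variable {n : ℕ} {L L' : EuclideanLattice n}

/-- The difference of two completed zeta functions is everywhere a convergent Mellin integral: the
terms which correct the theta series at `0` and `∞` depend only on the dimension. -/
theorem hasMellin_theta_sub (hn : 0 < n) (hL : L.covol = 1) (hL' : L'.covol = 1) (s : ℂ) :
    HasMellin (fun t => ((L'.theta t - L.theta t : ℝ) : ℂ)) s
      ((L'.thetaPair hn hL').Λ₀ s - (L.thetaPair hn hL).Λ₀ s) := by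
  have h := hasMellin_sub ((L'.thetaPair hn hL').isStrongFEPair_toStrongFEPair.hasMellin s).1
    ((L.thetaPair hn hL).isStrongFEPair_toStrongFEPair.hasMellin s).1
  have hae : ∀ᵐ t : ℝ ∂volume.restrict (Set.Ioi 0),
      (t : ℂ) ^ (s - 1) • ((L'.thetaPair hn hL').f_modif t - (L.thetaPair hn hL).f_modif t) =
      (t : ℂ) ^ (s - 1) • ((L'.theta t - L.theta t : ℝ) : ℂ) := by
    have h1 : ∀ᵐ t : ℝ ∂volume.restrict (Set.Ioi 0), t ≠ 1 :=
      ae_restrict_of_ae (Measure.ae_ne volume 1)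
    filter_upwards [h1, ae_restrict_mem measurableSet_Ioi] with t ht ht0
    have ht0 : 0 < t := ht0
    congr 1
    rcases lt_or_gt_of_ne ht with ht | ht
    · simp [WeakFEPair.f_modif, thetaPair, ht0, ht, ht.le]
    · simp [WeakFEPair.f_modif, thetaPair, ht, ht.le]
  refine ⟨h.1.congr hae, ?_⟩
  rw [mellin, ← integral_congr_ae hae]
  exact h.2

theorem Λ₀_eq_of_theta_eq (hn : 0 < n) (hL : L.covol = 1) (hL' : L'.covol = 1)
    (h : ∀ t, L'.theta t = L.theta t) (s : ℂ) :
    (L'.thetaPair hn hL').Λ₀ s = (L.thetaPair hn hL).Λ₀ s := by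
  have := (hasMellin_theta_sub hn hL hL' s).2
  simp only [h, sub_self, Complex.ofReal_zero, mellin, smul_zero, integral_zero] at this
  exact (sub_eq_zero.1 this.symm)

/-- At real `s`, the Epstein zeta function is a positive multiple of the entire part of its
completion, up to terms which depend only on the dimension. -/
theorem re_epsteinZeta_eq (hn : 0 < n) (hL : L.covol = 1) {s : ℝ} (hs0 : 0 < s)
    (hs : s ≠ (n : ℝ) / 2) :
    (epsteinZeta L s).re = Real.pi ^ s * (Real.Gamma s)⁻¹ *
      (((L.thetaPair hn hL).Λ₀ s).re - 1 / s - 1 / ((n : ℝ) / 2 - s)) := by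
  rw [L.epsteinZeta_eq hn hL (by exact_mod_cast hs),
    L.epsteinContinuation_eq hn hL (by exact_mod_cast hs0.ne'), WeakFEPair.Λ]
  simp only [thetaPair, smul_eq_mul, mul_one]
  rw [Complex.Gamma_ofReal, ← Complex.ofReal_cpow Real.pi_pos.le, ← Complex.ofReal_inv,
    ← Complex.ofReal_mul, Complex.re_ofReal_mul, Complex.sub_re, Complex.sub_re]
  congr 3
  · rw [← Complex.ofReal_one, ← Complex.ofReal_div, Complex.ofReal_re]
  · rw [← Complex.ofReal_sub, ← Complex.ofReal_one, ← Complex.ofReal_div, Complex.ofReal_re]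

theorem continuousOn_designKernel (L : EuclideanLattice n) :
    ContinuousOn L.designKernel (Set.Ioi 0) := by
  have h1 := L.continuousOn_momentTheta 1
  have h2 := L.continuousOn_momentTheta 2
  unfold designKernel
  fun_prop

/-- In dimension at least two there is a direction of deformation, so the kernel inherits the decay
of the second variation. -/
theorem abs_designKernel_le (hL1 : L.covol = 1) (hL : L.LayersHoldDesign 4) (hn : 2 ≤ n) {t : ℝ}
    (ht : 0 < t) : |L.designKernel t| ≤ 18 * L.thetaBound t := by
  -- the direction `(1, -1, 0, …, 0)`
  let i : Fin n := ⟨0, by omega⟩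
  let j : Fin n := ⟨1, by omega⟩
  have hij : i ≠ j := by simp [i, j]
  let h : Fin n → ℝ := Pi.single i 1 - Pi.single j 1
  have hs : ∑ k, h k = 0 := by simp [h]
  have hh : ∀ k, |h k| ≤ 1 := fun k => by
    by_cases h1 : k = i
    · subst h1; simp [h, hij]
    · by_cases h2 : k = j
      · subst h2; simp [h, h1]
      · simp [h, h1, h2]
  have hone : (1 : ℝ) ≤ ∑ k, h k ^ 2 :=
    calc (1 : ℝ) = h i ^ 2 := by simp [h, hij]
      _ ≤ _ := Finset.single_le_sum (f := fun k => h k ^ 2) (fun k _ => sq_nonneg _)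
        (Finset.mem_univ i)
  have := (theta_map_spectralMap_expansion (EuclideanSpace.basisFun (Fin n) ℝ) hL1 hL (by omega)
    hh hs ht).1
  rw [abs_mul, abs_of_nonneg (by linarith)] at this
  nlinarith [abs_nonneg (L.designKernel t)]

theorem exists_abs_designKernel_le_rpow (hL1 : L.covol = 1) (hL : L.LayersHoldDesign 4)
    (hn : 2 ≤ n) (a : ℝ) : ∃ C : ℝ, ∀ t : ℝ, 0 < t → |L.designKernel t| ≤ C * t ^ (-a) := by
  obtain ⟨C, hC0, hC⟩ := L.exists_rpow_mul_thetaBound_le (a + 1)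
  refine ⟨18 * C, fun t ht => (abs_designKernel_le hL1 hL hn ht).trans ?_⟩
  have h1 := hC t ht
  have h2 : (1 + t ^ 2)⁻¹ ≤ 1 := inv_le_one_of_one_le₀ (by nlinarith [sq_nonneg t])
  have h3 : t ^ a * L.thetaBound t ≤ C := by
    rw [add_sub_cancel_right] at h1
    exact h1.trans (mul_le_of_le_one_right hC0 h2)
  rw [Real.rpow_neg ht.le, ← div_eq_mul_inv, le_div_iff₀ (by positivity)]
  linarith

theorem designKernel_isBigO (hL1 : L.covol = 1) (hL : L.LayersHoldDesign 4) (hn : 2 ≤ n) (a : ℝ)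
    {l : Filter ℝ} (hl : ∀ᶠ t in l, 0 < t) :
    (fun t => (L.designKernel t : ℂ)) =O[l] (· ^ (-a)) := by
  obtain ⟨C, hC⟩ := exists_abs_designKernel_le_rpow hL1 hL hn a
  refine Asymptotics.IsBigO.of_bound C ?_
  filter_upwards [hl] with t ht
  rw [Complex.norm_real, Real.norm_eq_abs, Real.norm_of_nonneg (by positivity)]
  exact hC t ht

theorem locallyIntegrableOn_designKernel (L : EuclideanLattice n) :
    LocallyIntegrableOn (fun t => (L.designKernel t : ℂ)) (Set.Ioi 0) :=
  (Complex.continuous_ofReal.comp_continuousOn L.continuousOn_designKernel).locallyIntegrableOn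
    measurableSet_Ioi

theorem mellinConvergent_designKernel (hL1 : L.covol = 1) (hL : L.LayersHoldDesign 4) (hn : 2 ≤ n)
    (s : ℂ) : MellinConvergent (fun t => (L.designKernel t : ℂ)) s :=
  mellinConvergent_of_isBigO_rpow L.locallyIntegrableOn_designKernel
    (designKernel_isBigO hL1 hL hn _ (eventually_gt_atTop 0)) (lt_add_one s.re)
    (designKernel_isBigO hL1 hL hn _ self_mem_nhdsWithin) (sub_one_lt s.re)

theorem differentiable_mellin_designKernel (hL1 : L.covol = 1) (hL : L.LayersHoldDesign 4)
    (hn : 2 ≤ n) : Differentiable ℂ (mellin fun t => (L.designKernel t : ℂ)) := fun s =>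
  mellin_differentiableAt_of_isBigO_rpow L.locallyIntegrableOn_designKernel
    (designKernel_isBigO hL1 hL hn _ (eventually_gt_atTop 0)) (lt_add_one s.re)
    (designKernel_isBigO hL1 hL hn _ self_mem_nhdsWithin) (sub_one_lt s.re)

theorem momentTheta_nonneg (L : EuclideanLattice n) (j : ℕ) (t : ℝ) : 0 ≤ L.momentTheta j t :=
  tsum_nonneg fun _ => by positivity

/-- The moments of the theta series are controlled by the theta series at `t / 2`, which gives the
convergence of their Mellin transforms. -/
theorem pow_mul_momentTheta_le (L : EuclideanLattice n) (j : ℕ) {t : ℝ} (ht : 0 < t) :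
    t ^ j * L.momentTheta j t ≤ (2 / Real.pi) ^ j * j.factorial * L.theta (1 / 2 * t) := by
  have hπ := Real.pi_pos
  rw [momentTheta, theta, ← tsum_mul_left, ← tsum_mul_left]
  refine Summable.tsum_le_tsum (fun x => ?_)
    ((L.summable_pow_mul_exp_neg_mul_sq (a := Real.pi * t) (by positivity) j).mul_left _)
    ((L.summable_exp_neg_mul_sq (a := Real.pi * (1 / 2 * t)) (by positivity)).mul_left _)
  set u : ℝ := Real.pi * t * ‖x.1‖ ^ 2 / 2 with hu
  have hu0 : 0 ≤ u := by positivity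
  have h1 : u ^ j ≤ j.factorial * Real.exp u := by
    have := Real.pow_div_factorial_le_exp u hu0 j
    rwa [div_le_iff₀ (by positivity), mul_comm] at this
  have h2 : t ^ j * (‖x.1‖ ^ 2) ^ j = (2 / Real.pi) ^ j * u ^ j := by
    rw [← mul_pow, ← mul_pow, hu]
    congr 1
    field_simp
  have h3 : Real.exp (-(Real.pi * (1 / 2 * t)) * ‖x.1‖ ^ 2) =
      Real.exp u * Real.exp (-(Real.pi * t) * ‖x.1‖ ^ 2) := by
    rw [← Real.exp_add]
    congr 1
    rw [hu]
    ring
  rw [h3, ← mul_assoc, h2]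
  calc _ ≤ (2 / Real.pi) ^ j * (j.factorial * Real.exp u) *
        Real.exp (-(Real.pi * t) * ‖x.1‖ ^ 2) := by gcongr
    _ = _ := by ring

theorem mellinConvergent_momentTheta (hn : 0 < n) (hL : L.covol = 1) (j : ℕ) {s : ℂ}
    (hs : (n : ℝ) / 2 < s.re) :
    MellinConvergent (fun t => (L.momentTheta j t : ℂ)) (s + j) := by
  have h1 : MellinConvergent (fun t => (L.theta t : ℂ)) s := by
    have := ((L.thetaPair hn hL).hasMellin hs).1
    simpa [thetaPair] using this
  have h2 := (MellinConvergent.comp_mul_left (f := fun t => (L.theta t : ℂ)) (s := s)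
    (by norm_num : (0 : ℝ) < 1 / 2)).2 h1
  have h3 := h2.const_smul (((2 / Real.pi) ^ j * j.factorial : ℝ) : ℂ)
  refine Integrable.mono h3 ?_ ?_
  · refine ContinuousOn.aestronglyMeasurable (fun t ht => ?_) measurableSet_Ioi
    have ht0 : 0 < t := ht
    have a1 : ContinuousWithinAt (fun t : ℝ => (t : ℂ) ^ (s + j - 1)) (Set.Ioi 0) t :=
      (Complex.continuousAt_ofReal_cpow_const _ _ (Or.inr ht0.ne')).continuousWithinAt
    have a2 : ContinuousWithinAt (fun t : ℝ => (L.momentTheta j t : ℂ)) (Set.Ioi 0) t :=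
      (Complex.continuous_ofReal.comp_continuousOn (L.continuousOn_momentTheta j)) t ht
    exact a1.smul a2
  · filter_upwards [ae_restrict_mem measurableSet_Ioi] with t ht
    have ht0 : 0 < t := ht
    have h5 := L.pow_mul_momentTheta_le j ht0
    rw [norm_smul, norm_smul, norm_smul, Complex.norm_cpow_eq_rpow_re_of_pos ht0,
      Complex.norm_cpow_eq_rpow_re_of_pos ht0, Complex.norm_real, Complex.norm_real,
      Complex.norm_real, Real.norm_of_nonneg (L.momentTheta_nonneg j t),
      Real.norm_of_nonneg (L.theta_nonneg _), Real.norm_of_nonneg (by positivity)]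
    have h6 : t ^ (s + j - 1).re = t ^ (s - 1).re * t ^ j := by
      rw [← Real.rpow_natCast, ← Real.rpow_add ht0]
      congr 1
      simp
      ring
    rw [h6, mul_assoc]
    gcongr

theorem mellin_momentTheta (hn : 0 < n) (hL : L.covol = 1) (j : ℕ) {s : ℂ}
    (hs : (n : ℝ) / 2 < s.re) :
    mellin (fun t => (L.momentTheta j t : ℂ)) (s + j) =
      (Real.pi : ℂ) ^ (-(s + j)) * Complex.Gamma (s + j) * epsteinZeta L s := by
  have hs0 : 0 < s.re := lt_of_le_of_lt (by positivity) hs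
  have h1 := L.hasSum_mellin_momentTheta j (s := s + j) (by simp; positivity) (by simpa using hs)
  have h2 := ((L.isMeromorphicContinuation_epsteinZeta hL).hasSum s hs).mul_left
    ((Real.pi : ℂ) ^ (-(s + j)) * Complex.Gamma (s + j))
  simp only [add_sub_cancel_right] at h1
  exact h1.unique h2

/-- The Mellin transform of the kernel in the half plane of convergence. -/
theorem mellin_designKernel (hn : 0 < n) (hL : L.covol = 1) {s : ℂ} (hs : (n : ℝ) / 2 < s.re) :
    2 * n * (n + 2) * mellin (fun t => (L.designKernel t : ℂ)) s =
      s * (2 * s - n) * (L.thetaPair hn hL).Λ s := by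
  have hs0 : 0 < s.re := lt_of_le_of_lt (by positivity) hs
  have hs1 : s ≠ 0 := by rintro rfl; simp at hs0
  have hs2 : s + 1 ≠ 0 := fun h => by
    have := congrArg Complex.re h
    simp at this
    linarith
  have hπ : (Real.pi : ℂ) ≠ 0 := by exact_mod_cast Real.pi_ne_zero
  have hnc : (n : ℂ) ≠ 0 := by exact_mod_cast hn.ne'
  have hnc2 : (n : ℂ) + 2 ≠ 0 := by exact_mod_cast (by omega : n + 2 ≠ 0)
  have c1 := (MellinConvergent.cpow_smul.2 (mellinConvergent_momentTheta hn hL 1 hs)).const_smul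
    (Real.pi / (2 * n) : ℂ)
  have c2 := (MellinConvergent.cpow_smul.2 (mellinConvergent_momentTheta hn hL 2 hs)).const_smul
    ((Real.pi : ℂ) ^ 2 / (n * (n + 2)))
  have h := (hasMellin_sub c2 c1).2
  rw [mellin_const_smul, mellin_const_smul, mellin_cpow_smul, mellin_cpow_smul,
    mellin_momentTheta hn hL 1 hs, mellin_momentTheta hn hL 2 hs] at h
  have e : (fun t => (L.designKernel t : ℂ)) = fun t : ℝ =>
      ((Real.pi : ℂ) ^ 2 / (n * (n + 2))) • (t : ℂ) ^ ((2 : ℕ) : ℂ) • (L.momentTheta 2 t : ℂ) -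
      ((Real.pi : ℂ) / (2 * n)) • (t : ℂ) ^ ((1 : ℕ) : ℂ) • (L.momentTheta 1 t : ℂ) := by
    funext t
    rw [designKernel, Complex.cpow_natCast, Complex.cpow_natCast]
    push_cast
    simp only [smul_eq_mul]
    ring
  have h0 := mellin_momentTheta hn hL 0 hs
  simp only [momentTheta_zero, Nat.cast_zero, add_zero] at h0
  rw [L.mellin_theta hn hL hs] at h0
  have g1 : Complex.Gamma (s + 1) = s * Complex.Gamma s := Complex.Gamma_add_one s hs1
  have g2 : Complex.Gamma (s + 2) = (s + 1) * (s * Complex.Gamma s) := by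
    rw [← g1, ← Complex.Gamma_add_one _ hs2]
    congr 1
    ring
  have p1 : (Real.pi : ℂ) ^ (-(s + 1)) = (Real.pi : ℂ) ^ (-s) / Real.pi := by
    rw [neg_add', Complex.cpow_sub _ _ hπ, Complex.cpow_one]
  have p2 : (Real.pi : ℂ) ^ (-(s + 2)) = (Real.pi : ℂ) ^ (-s) / (Real.pi : ℂ) ^ 2 := by
    rw [neg_add', Complex.cpow_sub _ _ hπ, Complex.cpow_ofNat]
  rw [e, h, h0]
  simp only [smul_eq_mul, Nat.cast_one, Nat.cast_ofNat]
  rw [g1, g2, p1, p2]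
  field_simp
  ring

/-- By analytic continuation, the Mellin transform of the kernel is a polynomial multiple of the
completed zeta function on the whole plane. -/
theorem mellin_designKernel_eq (hn : 2 ≤ n) (hL1 : L.covol = 1) (hL : L.LayersHoldDesign 4)
    (hn0 : 0 < n) (s : ℂ) :
    2 * n * (n + 2) * mellin (fun t => (L.designKernel t : ℂ)) s =
      s * (2 * s - n) * (L.thetaPair hn0 hL1).Λ₀ s + n := by
  have hd1 : Differentiable ℂ fun s : ℂ =>
      2 * n * (n + 2) * mellin (fun t => (L.designKernel t : ℂ)) s :=
    (differentiable_mellin_designKernel hL1 hL hn).const_mul _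
  have hd2 : Differentiable ℂ fun s : ℂ =>
      s * (2 * s - n) * (L.thetaPair hn0 hL1).Λ₀ s + n := by
    have := (L.thetaPair hn0 hL1).differentiable_Λ₀
    fun_prop
  refine congrFun (AnalyticOnNhd.eq_of_eventuallyEq (𝕜 := ℂ) (z₀ := (n : ℂ))
    (fun z _ => hd1.analyticAt z) (fun z _ => hd2.analyticAt z) ?_) s
  have hU : IsOpen {s : ℂ | (n : ℝ) / 2 < s.re} := isOpen_lt continuous_const Complex.continuous_re
  have hnR : (0 : ℝ) < n := by exact_mod_cast hn0
  filter_upwards [hU.mem_nhds (show (n : ℝ) / 2 < (n : ℂ).re by simpa using hnR)] with z hz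
  have hz : (n : ℝ) / 2 < z.re := hz
  have hz0 : z ≠ 0 := by
    rintro rfl
    simp at hz
    linarith
  have hz1 : (n : ℂ) / 2 - z ≠ 0 := fun h => by
    have := congrArg Complex.re h
    rw [Complex.sub_re, show ((n : ℂ) / 2).re = (n : ℝ) / 2 by
      rw [← Complex.ofReal_natCast, ← Complex.ofReal_ofNat, ← Complex.ofReal_div,
        Complex.ofReal_re]] at this
    simp at this
    linarith
  have hz2 : z * (1 / z) = 1 := mul_one_div_cancel hz0
  have hz3 : ((n : ℂ) / 2 - z) * (1 / ((n : ℂ) / 2 - z)) = 1 := mul_one_div_cancel hz1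
  rw [mellin_designKernel hn0 hL1 hz, WeakFEPair.Λ]
  generalize (L.thetaPair hn0 hL1).Λ₀ z = X
  simp only [thetaPair, smul_eq_mul, mul_one]
  push_cast
  linear_combination (n - 2 * z) * hz2 + 2 * z * hz3

/-- The completed zeta function has a quadratic expansion along deformations of the lattice. -/
theorem exists_norm_Λ₀_sub_le (hn : 2 ≤ n) (hL1 : L.covol = 1) (hL : L.LayersHoldDesign 4)
    (hn0 : 0 < n) (s : ℝ) :
    ∃ K : ℝ, 0 ≤ K ∧ ∀ (v : OrthonormalBasis (Fin n) ℝ (EuclideanSpace ℝ (Fin n))) (h : Fin n → ℝ),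
      ∑ i, h i = 0 → ∑ i, h i ^ 2 = 1 → ∀ τ : ℝ, 0 < τ → τ ≤ 1 / 8 →
      ∀ hL' : (L.map (spectralMap v (τ • h))).covol = 1,
        ‖((L.map (spectralMap v (τ • h))).thetaPair hn0 hL').Λ₀ s - (L.thetaPair hn0 hL1).Λ₀ s -
          τ ^ 2 * mellin (fun t => (L.designKernel t : ℂ)) s‖ ≤ K * τ ^ 3 := by
  obtain ⟨C, hC0, hC⟩ := L.exists_rpow_mul_thetaBound_le s
  have hI : 0 ≤ ∫ t in Set.Ioi (0 : ℝ), (1 + t ^ 2)⁻¹ := integral_nonneg fun t => by positivity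
  refine ⟨3124 * C * ∫ t in Set.Ioi (0 : ℝ), (1 + t ^ 2)⁻¹, by positivity, ?_⟩
  intro v h hs hs2 τ h0 h1 hL'
  have hh : ∀ i, |h i| ≤ 1 := fun i => by
    rw [← sq_le_one_iff_abs_le_one, ← hs2]
    exact Finset.single_le_sum (f := fun k => h k ^ 2) (fun k _ => sq_nonneg _) (Finset.mem_univ i)
  have m1 := hasMellin_theta_sub hn0 hL1 hL' s
  have m2 := (mellinConvergent_designKernel hL1 hL hn s).const_smul ((τ ^ 2 : ℝ) : ℂ)
  have m3 := (hasMellin_sub m1.1 m2).2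
  rw [m1.2, mellin_const_smul, smul_eq_mul] at m3
  push_cast at m3
  rw [← m3, mellin]
  calc _ ≤ ∫ t in Set.Ioi (0 : ℝ), 3124 * C * τ ^ 3 * (1 + t ^ 2)⁻¹ := by
        refine norm_integral_le_of_norm_le (integrable_inv_one_add_sq.integrableOn.const_mul _) ?_
        filter_upwards [ae_restrict_mem measurableSet_Ioi] with t ht
        have ht0 : 0 < t := ht
        have e1 := (theta_map_spectralMap_expansion v hL1 hL hn0 hh hs ht0).2 τ h0 h1
        rw [hs2, one_mul] at e1
        have e2 := hC t ht0
        rw [norm_smul, Complex.norm_cpow_eq_rpow_re_of_pos ht0]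
        have e3 : ((s : ℂ) - 1).re = s - 1 := by simp
        rw [e3]
        have e4 : ‖(((L.map (spectralMap v (τ • h))).theta t : ℂ) - L.theta t -
            (τ : ℂ) ^ 2 • (L.designKernel t : ℂ))‖ ≤ 3124 * τ ^ 3 * L.thetaBound t := by
          refine le_of_eq_of_le ?_ e1
          rw [← Real.norm_eq_abs, ← Complex.norm_real]
          push_cast
          rfl
        calc _ ≤ t ^ (s - 1) * (3124 * τ ^ 3 * L.thetaBound t) := by gcongr
          _ = 3124 * τ ^ 3 * (t ^ (s - 1) * L.thetaBound t) := by ring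
          _ ≤ 3124 * τ ^ 3 * (C * (1 + t ^ 2)⁻¹) := by gcongr
          _ = _ := by ring
    _ = _ := by
        rw [integral_const_mul]
        ring

/-- If the Mellin transform of the kernel is positive at `s`, all small deformations of the lattice
increase the completed zeta function at `s`. -/
theorem exists_Λ₀_lt_of_pos (hn : 2 ≤ n) (hL1 : L.covol = 1) (hL : L.LayersHoldDesign 4)
    (hn0 : 0 < n) {s : ℝ} (hpos : 0 < (mellin (fun t => (L.designKernel t : ℂ)) s).re) :
    ∃ δ : ℝ, 0 < δ ∧
      ∀ (v : OrthonormalBasis (Fin n) ℝ (EuclideanSpace ℝ (Fin n))) (h : Fin n → ℝ),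
      ∑ i, h i = 0 → h ≠ 0 → ∑ i, h i ^ 2 ≤ δ ^ 2 →
      ∀ hL' : (L.map (spectralMap v h)).covol = 1,
        ((L.thetaPair hn0 hL1).Λ₀ s).re <
          (((L.map (spectralMap v h)).thetaPair hn0 hL').Λ₀ s).re := by
  obtain ⟨K, hK0, hK⟩ := exists_norm_Λ₀_sub_le hn hL1 hL hn0 s
  set d := (mellin (fun t => (L.designKernel t : ℂ)) s).re with hd
  refine ⟨min (1 / 8) (d / (K + 1)), by positivity, fun v h hs hne hle hL' => ?_⟩
  -- normalize the direction: `h = τ h₁` with `τ = |h|` and `h₁` a unit vector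
  set q := ∑ i, h i ^ 2 with hq
  have hq0 : 0 < q := by
    obtain ⟨i, hi⟩ := Function.ne_iff.1 hne
    have hi : h i ≠ 0 := hi
    exact lt_of_lt_of_le (by positivity) (Finset.single_le_sum (f := fun k => h k ^ 2)
      (fun k _ => sq_nonneg _) (Finset.mem_univ i))
  set τ := Real.sqrt q with hτ
  have hτ0 : 0 < τ := Real.sqrt_pos.2 hq0
  have hτ2 : τ ^ 2 = q := Real.sq_sqrt hq0.le
  have hτle : τ ≤ min (1 / 8) (d / (K + 1)) := by
    rw [hτ]
    exact Real.sqrt_le_iff.2 ⟨by positivity, hle⟩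
  have hhτ : h = τ • (τ⁻¹ • h) := by rw [smul_smul, mul_inv_cancel₀ hτ0.ne', one_smul]
  have hs' : ∑ i, (τ⁻¹ • h) i = 0 := by simp [← Finset.mul_sum, hs]
  have hs2' : ∑ i, (τ⁻¹ • h) i ^ 2 = 1 := by
    simp only [Pi.smul_apply, smul_eq_mul, mul_pow, ← Finset.mul_sum]
    rw [← hq, ← hτ2]
    field_simp
  have hmain := fun hL'' => hK v (τ⁻¹ • h) hs' hs2' τ hτ0 (hτle.trans (min_le_left _ _)) hL''
  rw [← hhτ] at hmain
  have h1 := (Complex.abs_re_le_norm _).trans (hmain hL')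
  have h2 : (((τ : ℂ)) ^ 2 * mellin (fun t => (L.designKernel t : ℂ)) s).re = τ ^ 2 * d := by
    rw [← Complex.ofReal_pow, Complex.re_ofReal_mul]
  rw [Complex.sub_re, Complex.sub_re, h2] at h1
  have h3 := (abs_le.1 h1).1
  have h4 : K * τ < d := by
    have := hτle.trans (min_le_right _ _)
    rw [le_div_iff₀ (by positivity)] at this
    nlinarith
  have h5 : 0 < τ ^ 2 * (d - K * τ) := by
    have : 0 < d - K * τ := by linarith
    positivity
  nlinarith

/-! ### Positivity -/

theorem epsteinZeta_re_pos (hn : 0 < n) (hL : L.covol = 1) {s : ℝ} (hs : (n : ℝ) / 2 < s) :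
    0 < (epsteinZeta L s).re := by
  have h1 := Complex.hasSum_re
    ((L.isMeromorphicContinuation_epsteinZeta hL).hasSum s (by simpa using hs))
  have e : ∀ x : L.Nonzero, (epsteinTerm L x s).re = ‖x.1‖ ^ (-2 * s) := fun x => by
    rw [epsteinTerm, show (-2 * (s : ℂ)) = ((-2 * s : ℝ) : ℂ) by push_cast; rfl,
      ← Complex.ofReal_cpow (norm_nonneg _), Complex.ofReal_re]
  have hx : ∃ x : L.Nonzero, True := by
    obtain ⟨b, rfl⟩ := L.exists_eq_ofBasis
    exact ⟨⟨b ⟨0, hn⟩, Submodule.subset_span ⟨_, rfl⟩, b.ne_zero _⟩, trivial⟩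
  obtain ⟨x, -⟩ := hx
  have hpos := Nonzero.norm_pos L x
  refine lt_of_lt_of_le (Real.rpow_pos_of_pos hpos (-2 * s)) ?_
  rw [← e x]
  exact le_hasSum h1 x fun y _ => by
    change 0 ≤ (epsteinTerm L y s).re
    rw [e y]
    positivity

/-- The Mellin transform of the kernel has the sign of `(s - n / 2) ζ(L, s)` at real
`0 < s ≠ n / 2`. -/
theorem mellin_designKernel_re_pos (hn : 2 ≤ n) (hL1 : L.covol = 1) (hL : L.LayersHoldDesign 4)
    {s : ℝ} (hs0 : 0 < s) (hs : s ≠ (n : ℝ) / 2)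
    (h : 0 < (s - (n : ℝ) / 2) * (epsteinZeta L s).re) :
    0 < (mellin (fun t => (L.designKernel t : ℂ)) s).re := by
  have hn0 : 0 < n := by omega
  have hnR : (0 : ℝ) < n := by exact_mod_cast hn0
  have h1 := congrArg Complex.re (mellin_designKernel_eq hn hL1 hL hn0 s)
  have e1 : (2 * n * (n + 2) : ℂ) = ((2 * n * (n + 2) : ℝ) : ℂ) := by push_cast; rfl
  have e2 : ((s : ℂ) * (2 * s - n)) = ((s * (2 * s - n) : ℝ) : ℂ) := by push_cast; rfl
  rw [e1, e2, Complex.re_ofReal_mul, Complex.add_re, Complex.re_ofReal_mul,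
    Complex.natCast_re] at h1
  rw [re_epsteinZeta_eq hn0 hL1 hs0 hs] at h
  have hG := Real.Gamma_pos_of_pos hs0
  have hπ := Real.pi_pos
  have hs' : (n : ℝ) / 2 - s ≠ 0 := sub_ne_zero.2 hs.symm
  have h2 : 0 < Real.pi ^ s * (Real.Gamma s)⁻¹ := by positivity
  set x := ((L.thetaPair hn0 hL1).Λ₀ s).re
  have h3 : 0 < (s - (n : ℝ) / 2) * (x - 1 / s - 1 / ((n : ℝ) / 2 - s)) := by
    rw [mul_left_comm] at h
    exact pos_of_mul_pos_right h h2.le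
  have h4 : s * (2 * s - n) * x + n =
      2 * s * ((s - (n : ℝ) / 2) * (x - 1 / s - 1 / ((n : ℝ) / 2 - s))) := by
    have h6 : s * (1 / s) = 1 := mul_one_div_cancel hs0.ne'
    have h7 : ((n : ℝ) / 2 - s) * (1 / ((n : ℝ) / 2 - s)) = 1 := mul_one_div_cancel hs'
    linear_combination (2 * s - n) * h6 - 2 * s * h7
  rw [h4] at h1
  have h5 : 0 < 2 * (n : ℝ) * (n + 2) * (mellin (fun t => (L.designKernel t : ℂ)) s).re := by
    rw [h1]
    positivity
  exact pos_of_mul_pos_right h5 (by positivity)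

/-- At `s = 0` the Mellin transform of the kernel has the value `1 / (2 (n + 2))`, whatever the
lattice. -/
theorem mellin_designKernel_zero_re_pos (hn : 2 ≤ n) (hL1 : L.covol = 1)
    (hL : L.LayersHoldDesign 4) :
    0 < (mellin (fun t => (L.designKernel t : ℂ)) ((0 : ℝ) : ℂ)).re := by
  have hnR : (0 : ℝ) < n := by exact_mod_cast (by omega : 0 < n)
  have h1 := congrArg Complex.re (mellin_designKernel_eq hn hL1 hL (by omega) ((0 : ℝ) : ℂ))
  have e1 : (2 * n * (n + 2) : ℂ) = ((2 * n * (n + 2) : ℝ) : ℂ) := by push_cast; rfl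
  rw [e1, Complex.re_ofReal_mul, Complex.ofReal_zero, zero_mul, zero_mul, zero_add,
    Complex.natCast_re] at h1
  rw [Complex.ofReal_zero]
  exact pos_of_mul_pos_right (h1 ▸ hnR) (by positivity)

end EuclideanLattice

/-! ### Neighbourhoods in the space of lattices -/

section Neighbourhoods

variable {n : ℕ}

/-- The linear automorphism of `ℝⁿ` with a given invertible matrix. -/
noncomputable def glEquiv (g : GL (Fin n) ℝ) :
    EuclideanSpace ℝ (Fin n) ≃ₗ[ℝ] EuclideanSpace ℝ (Fin n) :=
  WithLp.linearEquiv 2 ℝ (Fin n → ℝ) ≪≫ₗ (Matrix.GeneralLinearGroup.toLin g).toLinearEquiv ≪≫ₗ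
    (WithLp.linearEquiv 2 ℝ (Fin n → ℝ)).symm

theorem glEquiv_apply (g : GL (Fin n) ℝ) (x : EuclideanSpace ℝ (Fin n)) :
    glEquiv g x = Matrix.toEuclideanCLM (𝕜 := ℝ) (g : Matrix (Fin n) (Fin n) ℝ) x := rfl

theorem glEquiv_mul_apply (g g' : GL (Fin n) ℝ) (x : EuclideanSpace ℝ (Fin n)) :
    glEquiv (g * g') x = glEquiv g (glEquiv g' x) := by
  simp [glEquiv_apply]

theorem columnBasis_mul (g P : GL (Fin n) ℝ) :
    columnBasis (g * P) = (columnBasis P).map (glEquiv g) := by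
  refine Basis.eq_of_apply_eq fun j => ?_
  rw [Basis.map_apply, columnBasis_apply, columnBasis_apply, glEquiv_apply,
    Matrix.toEuclideanCLM_toLp]
  rfl

namespace EuclideanLattice

theorem ofGL_mul (g P : GL (Fin n) ℝ) : ofGL (g * P) = (ofGL P).map (glEquiv g) := by
  rw [ofGL, ofGL, map_ofBasis, columnBasis_mul]

theorem map_glEquiv_mul (g g' : GL (Fin n) ℝ) (L : EuclideanLattice n) :
    (L.map (glEquiv g')).map (glEquiv g) = L.map (glEquiv (g * g')) := by
  refine ext_toSubmodule (SetLike.ext fun y => ?_)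
  change (∃ x, (∃ z ∈ L, glEquiv g' z = x) ∧ glEquiv g x = y) ↔ ∃ z ∈ L, glEquiv (g * g') z = y
  simp only [glEquiv_mul_apply]
  constructor
  · rintro ⟨_, ⟨z, hz, rfl⟩, h⟩
    exact ⟨z, hz, h⟩
  · rintro ⟨z, hz, h⟩
    exact ⟨_, ⟨z, hz, rfl⟩, h⟩

theorem exists_eq_ofGL (L : EuclideanLattice n) : ∃ P : GL (Fin n) ℝ, L = ofGL P := by
  obtain ⟨b, rfl⟩ := L.exists_eq_ofBasis
  let e : (Fin n → ℝ) ≃ₗ[ℝ] (Fin n → ℝ) :=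
    b.equivFun.symm ≪≫ₗ WithLp.linearEquiv 2 ℝ (Fin n → ℝ)
  refine ⟨Matrix.GeneralLinearGroup.toLin.symm
    (LinearMap.GeneralLinearGroup.ofLinearEquiv e), ?_⟩
  rw [ofGL]
  congr 1
  refine Basis.eq_of_apply_eq fun j => ?_
  rw [columnBasis, MulEquiv.apply_symm_apply, Basis.map_apply, Basis.map_apply]
  change b j = (WithLp.linearEquiv 2 ℝ (Fin n → ℝ)).symm
    (WithLp.linearEquiv 2 ℝ (Fin n → ℝ) (b.equivFun.symm (Pi.basisFun ℝ (Fin n) j)))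
  simp

/-- Lattices near `L₀` are images of `L₀` under linear maps near the identity. -/
theorem eventually_exists_eq_map (L₀ : EuclideanLattice n) {V : Set (GL (Fin n) ℝ)}
    (hV : V ∈ 𝓝 1) : ∀ᶠ L in 𝓝 L₀, ∃ g ∈ V, L = L₀.map (glEquiv g) := by
  obtain ⟨W, hWV, hW, h1⟩ := mem_nhds_iff.1 hV
  have hopen : IsOpen {L : EuclideanLattice n | ∃ g ∈ W, L = L₀.map (glEquiv g)} := by
    -- if `P ℤⁿ = g L₀`, then `Q ℤⁿ = Q P⁻¹ g L₀`, and `Q P⁻¹ g` is close to `g` if `Q` is close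
    -- to `P`
    refine isOpen_coinduced.2 (isOpen_iff_mem_nhds.2 ?_)
    rintro P ⟨g, hg, hP⟩
    have hc : Continuous fun Q : GL (Fin n) ℝ => Q * P⁻¹ * g := by fun_prop
    have : (fun Q : GL (Fin n) ℝ => Q * P⁻¹ * g) ⁻¹' W ∈ 𝓝 P :=
      hc.continuousAt.preimage_mem_nhds (hW.mem_nhds (by simpa using hg))
    filter_upwards [this] with Q hQ
    refine ⟨Q * P⁻¹ * g, hQ, ?_⟩
    rw [← map_glEquiv_mul, ← hP, ← ofGL_mul, inv_mul_cancel_right]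
  have hmem : L₀ ∈ {L : EuclideanLattice n | ∃ g ∈ W, L = L₀.map (glEquiv g)} := by
    refine ⟨1, h1, ?_⟩
    obtain ⟨P, rfl⟩ := L₀.exists_eq_ofGL
    rw [← ofGL_mul, one_mul]
  filter_upwards [hopen.mem_nhds hmem] with L hL
  obtain ⟨g, hg, h⟩ := hL
  exact ⟨g, hWV hg, h⟩

end EuclideanLattice

theorem eventually_norm_glEquiv_sub_le {ε : ℝ} (hε : 0 < ε) :
    ∀ᶠ g : GL (Fin n) ℝ in 𝓝 1, ∀ x, ‖glEquiv g x - x‖ ≤ ε * ‖x‖ := by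
  have hc : Continuous fun g : GL (Fin n) ℝ =>
      ‖Matrix.toEuclideanCLM (n := Fin n) (𝕜 := ℝ) (g : Matrix (Fin n) (Fin n) ℝ) - 1‖ := by
    have h1 : Continuous (Matrix.toEuclideanCLM (n := Fin n) (𝕜 := ℝ)) :=
      LinearMap.continuous_of_finiteDimensional
        (Matrix.toEuclideanCLM (n := Fin n) (𝕜 := ℝ)).toAlgEquiv.toLinearMap
    exact ((h1.comp Units.continuous_val).sub continuous_const).norm
  have h0 : ∀ᶠ g : GL (Fin n) ℝ in 𝓝 1,
      ‖Matrix.toEuclideanCLM (n := Fin n) (𝕜 := ℝ) (g : Matrix (Fin n) (Fin n) ℝ) - 1‖ < ε :=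
    hc.continuousAt.eventually_lt continuousAt_const (by simpa using hε)
  filter_upwards [h0] with g hg x
  exact ((Matrix.toEuclideanCLM (n := Fin n) (𝕜 := ℝ)
    (g : Matrix (Fin n) (Fin n) ℝ) - 1).le_opNorm x).trans (by gcongr)

/-- The Gram operator `gᵀ g`. -/
theorem exists_gram (g : EuclideanSpace ℝ (Fin n) →ₗ[ℝ] EuclideanSpace ℝ (Fin n)) :
    ∃ T : EuclideanSpace ℝ (Fin n) →ₗ[ℝ] EuclideanSpace ℝ (Fin n),
      T.IsSymmetric ∧ (∀ x y, ⟪T x, y⟫ = ⟪g x, g y⟫) ∧ LinearMap.det T = LinearMap.det g ^ 2 := by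
  refine ⟨LinearMap.adjoint g ∘ₗ g, LinearMap.isSymmetric_adjoint_comp_self g, fun x y => ?_, ?_⟩
  · rw [LinearMap.comp_apply, LinearMap.adjoint_inner_left]
  · have hadj : LinearMap.det (LinearMap.adjoint g) = LinearMap.det g := by
      rw [← LinearMap.det_toMatrix (EuclideanSpace.basisFun (Fin n) ℝ).toBasis,
        ← LinearMap.det_toMatrix (EuclideanSpace.basisFun (Fin n) ℝ).toBasis g,
        LinearMap.toMatrix_adjoint, Matrix.det_conjTranspose, star_trivial]
    rw [LinearMap.det_comp, hadj, sq]

/-- Polar decomposition: a linear automorphism `g` of determinant `± 1` is a positive definite map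
of determinant `1` followed by an isometry. The eigenvectors `vᵢ` are those of `gᵀ g`. -/
theorem exists_spectralMap_polar (g : EuclideanSpace ℝ (Fin n) ≃ₗ[ℝ] EuclideanSpace ℝ (Fin n))
    (hdet : |LinearMap.det g.toLinearMap| = 1) :
    ∃ (v : OrthonormalBasis (Fin n) ℝ (EuclideanSpace ℝ (Fin n))) (h : Fin n → ℝ)
      (u : EuclideanSpace ℝ (Fin n) ≃ₗᵢ[ℝ] EuclideanSpace ℝ (Fin n)),
      (∀ i, h i = 2 * Real.log ‖g (v i)‖) ∧ ∑ i, h i = 0 ∧ ∀ x, g x = u (spectralMap v h x) := by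
  obtain ⟨T, hT, hin, hdetT⟩ := exists_gram g.toLinearMap
  rw [← sq_abs, hdet, one_pow] at hdetT
  obtain ⟨v, μ, hv, hμ⟩ : ∃ (v : OrthonormalBasis (Fin n) ℝ (EuclideanSpace ℝ (Fin n)))
      (μ : Fin n → ℝ), (∀ i, T (v i) = μ i • v i) ∧ LinearMap.det T = ∏ i, μ i :=
    ⟨hT.eigenvectorBasis finrank_euclideanSpace_fin, hT.eigenvalues finrank_euclideanSpace_fin,
      hT.apply_eigenvectorBasis _, hT.det_eq_prod_eigenvalues _⟩
  have hpos : ∀ i, 0 < ‖g (v i)‖ := fun i => norm_pos_iff.2 fun h0 =>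
    v.orthonormal.ne_zero i ((map_eq_zero_iff g g.injective).1 h0)
  have heig : ∀ i, μ i = ‖g (v i)‖ ^ 2 := fun i => by
    have h1 : ⟪T (v i), v i⟫ = ⟪g (v i), g (v i)⟫ := hin (v i) (v i)
    rwa [hv, real_inner_smul_left, real_inner_self_eq_norm_sq, real_inner_self_eq_norm_sq,
      v.orthonormal.1 i, one_pow, mul_one] at h1
  obtain ⟨h, hh⟩ : ∃ h : Fin n → ℝ, ∀ i, h i = 2 * Real.log ‖g (v i)‖ := ⟨_, fun _ => rfl⟩
  have hexp : ∀ i, Real.exp (h i) = μ i := fun i => by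
    rw [hh, heig, ← Nat.cast_two, Real.exp_nat_mul, Real.exp_log (hpos i)]
  have hnorm : ∀ x, ‖g x‖ = ‖spectralMap v h x‖ := fun x => by
    rw [← sq_eq_sq₀ (norm_nonneg _) (norm_nonneg _), norm_spectralMap_sq,
      ← real_inner_self_eq_norm_sq, show ⟪g x, g x⟫ = ⟪T x, x⟫ from (hin x x).symm,
      ← v.sum_inner_mul_inner]
    refine Finset.sum_congr rfl fun i _ => ?_
    rw [hT x (v i), hv, real_inner_smul_right, hexp, real_inner_comm]
    ring
  refine ⟨v, h, ⟨(spectralMap v h).symm ≪≫ₗ g, fun x => ?_⟩, hh, ?_, fun x => ?_⟩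
  · rw [LinearEquiv.trans_apply, hnorm, LinearEquiv.apply_symm_apply]
  · rw [← Real.exp_eq_one_iff, Real.exp_sum, ← hdetT, hμ]
    exact Finset.prod_congr rfl fun i _ => hexp i
  · change g x = g ((spectralMap v h).symm (spectralMap v h x))
    rw [LinearEquiv.symm_apply_apply]

end Neighbourhoods

namespace EuclideanLattice

variable {n : ℕ}

/-- The unimodular lattices near `L₀` are, up to isometries, small symmetric deformations
of `L₀`. -/
theorem eventually_eq_map_spectralMap (L₀ : UnimodularLattice n) {δ : ℝ} (hδ : 0 < δ) :
    ∀ᶠ L in 𝓝 L₀, ∃ (v : OrthonormalBasis (Fin n) ℝ (EuclideanSpace ℝ (Fin n))) (h : Fin n → ℝ)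
      (u : EuclideanSpace ℝ (Fin n) ≃ₗᵢ[ℝ] EuclideanSpace ℝ (Fin n)),
      ∑ i, h i = 0 ∧ ∑ i, h i ^ 2 ≤ δ ^ 2 ∧
      L.1 = (L₀.1.map (spectralMap v h)).map u.toLinearEquiv := by
  have hc : ContinuousAt (fun x : ℝ => n * (2 * Real.log x) ^ 2) 1 :=
    continuousAt_const.mul ((continuousAt_const.mul (Real.continuousAt_log one_ne_zero)).pow 2)
  have hlt : ∀ᶠ x in 𝓝 (1 : ℝ), n * (2 * Real.log x) ^ 2 < δ ^ 2 :=
    hc.eventually_lt continuousAt_const (by simp; positivity)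
  obtain ⟨ε, hε, hball⟩ := Metric.eventually_nhds_iff.1 hlt
  have h1 := L₀.1.eventually_exists_eq_map
    (eventually_norm_glEquiv_sub_le (n := n) (half_pos hε))
  filter_upwards [continuous_subtype_val.continuousAt.eventually h1] with L hL
  obtain ⟨g, hg, hLg⟩ := hL
  have hdet : |LinearMap.det (glEquiv g).toLinearMap| = 1 := by
    have := covol_map (glEquiv g) L₀.1
    rwa [← hLg, L.2, L₀.2, mul_one, eq_comm] at this
  obtain ⟨v, h, u, hh, hs, hu⟩ := exists_spectralMap_polar (glEquiv g) hdet
  refine ⟨v, h, u, hs, ?_, ?_⟩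
  · have hi : ∀ i, n * h i ^ 2 ≤ δ ^ 2 := fun i => by
      rw [hh i]
      refine (hball ?_).le
      have h3 : ‖glEquiv g (v i) - v i‖ ≤ ε / 2 * ‖v i‖ := hg (v i)
      have h4 := abs_norm_sub_norm_le (glEquiv g (v i)) (v i)
      rw [v.orthonormal.1 i] at h3 h4
      rw [Real.dist_eq]
      linarith
    rcases Nat.eq_zero_or_pos n with rfl | hn
    · simp; positivity
    · have hnR : (0 : ℝ) < n := by exact_mod_cast hn
      have h5 : ∑ i : Fin n, h i ^ 2 ≤ ∑ _i : Fin n, δ ^ 2 / n :=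
        Finset.sum_le_sum fun i _ => by
          rw [le_div_iff₀ hnR, mul_comm]
          exact hi i
      refine h5.trans_eq ?_
      rw [Finset.sum_const, Finset.card_univ, Fintype.card_fin, nsmul_eq_mul]
      field_simp
  · rw [hLg]
    refine ext_toSubmodule (SetLike.ext fun y => ?_)
    change (∃ x ∈ L₀.1, glEquiv g x = y) ↔
      ∃ x, (∃ z ∈ L₀.1, spectralMap v h z = x) ∧ u x = y
    constructor
    · rintro ⟨x, hx, rfl⟩
      exact ⟨_, ⟨x, hx, rfl⟩, (hu x).symm⟩
    · rintro ⟨_, ⟨x, hx, rfl⟩, rfl⟩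
      exact ⟨x, hx, hu x⟩

theorem isometric_map_spectralMap_zero (L : EuclideanLattice n)
    (v : OrthonormalBasis (Fin n) ℝ (EuclideanSpace ℝ (Fin n)))
    (u : EuclideanSpace ℝ (Fin n) ≃ₗᵢ[ℝ] EuclideanSpace ℝ (Fin n)) :
    L.Isometric ((L.map (spectralMap v 0)).map u.toLinearEquiv) := by
  have h0 : ∀ x, spectralMap v 0 x = x := fun x => by
    rw [spectralMap_apply]
    simpa using v.sum_repr' x
  refine ⟨u, Set.ext fun y => ?_⟩
  change (∃ x, x ∈ L ∧ u x = y) ↔ ∃ x, (∃ z ∈ L, spectralMap v 0 z = x) ∧ u x = y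
  simp [h0]

/-- A criterion for strict local minima: up to isometries, only the symmetric deformations have to
be considered. -/
theorem isStrictLocalMinLattice_of_spectralMap {L₀ : UnimodularLattice n}
    {F : EuclideanLattice n → ℝ} {δ : ℝ} (hδ : 0 < δ)
    (hF : ∀ (v : OrthonormalBasis (Fin n) ℝ (EuclideanSpace ℝ (Fin n))) (h : Fin n → ℝ)
      (u : EuclideanSpace ℝ (Fin n) ≃ₗᵢ[ℝ] EuclideanSpace ℝ (Fin n)),
      ∑ i, h i = 0 → h ≠ 0 → ∑ i, h i ^ 2 ≤ δ ^ 2 →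
      ∀ M : UnimodularLattice n, M.1 = (L₀.1.map (spectralMap v h)).map u.toLinearEquiv →
      F L₀.1 < F M.1) :
    IsStrictLocalMinLattice F L₀ := by
  filter_upwards [eventually_eq_map_spectralMap L₀ hδ] with M hM
  obtain ⟨v, h, u, hs, hle, hMeq⟩ := hM
  by_cases h0 : h = 0
  · left
    rw [hMeq, h0]
    exact L₀.1.isometric_map_spectralMap_zero v u
  · exact Or.inr (hF v h u hs h0 hle M hMeq)

theorem two_le_of_sum_eq_zero {h : Fin n → ℝ} (hs : ∑ i, h i = 0) (h0 : h ≠ 0) : 2 ≤ n := by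
  by_contra hn
  have hn : n < 2 := not_le.1 hn
  interval_cases n
  · exact h0 (Subsingleton.elim _ _)
  · refine h0 (funext fun i => ?_)
    rw [Fin.sum_univ_one] at hs
    rw [Subsingleton.elim i 0, hs, Pi.zero_apply]

theorem theta_map_linearIsometryEquiv (L : EuclideanLattice n)
    (u : EuclideanSpace ℝ (Fin n) ≃ₗᵢ[ℝ] EuclideanSpace ℝ (Fin n)) (t : ℝ) :
    (L.map u.toLinearEquiv).theta t = L.theta t := by
  rw [theta_map, theta]
  exact tsum_congr fun x => by
    rw [show u.toLinearEquiv x.1 = u x.1 from rfl, u.norm_map]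

/-- In dimension at most one there are no deformations, and the statement is trivial. -/
theorem isZetaExtreme_of_pos {L : UnimodularLattice n} (hL : L.1.LayersHoldDesign 4) {s : ℝ}
    (hs0 : 0 < s) (hs : s ≠ (n : ℝ) / 2)
    (hpos : 0 < n → 0 < (s - (n : ℝ) / 2) * (epsteinZeta L.1 s).re) : IsZetaExtreme L s := by
  rcases lt_or_ge n 2 with hn | hn
  · exact isStrictLocalMinLattice_of_spectralMap one_pos fun v h u h1 h2 =>
      absurd (two_le_of_sum_eq_zero h1 h2) (not_le.2 hn)
  have hn0 : 0 < n := by omega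
  obtain ⟨δ, hδ, H⟩ := exists_Λ₀_lt_of_pos hn L.2 hL hn0
    (mellin_designKernel_re_pos hn L.2 hL hs0 hs (hpos hn0))
  refine isStrictLocalMinLattice_of_spectralMap hδ fun v h u h1 h2 h3 M hM => ?_
  have hcov := (covol_map_spectralMap v h L.1 h1).trans L.2
  have h4 := H v h h1 h2 h3 hcov
  rw [← Λ₀_eq_of_theta_eq hn0 hcov M.2 (fun t => by rw [hM, theta_map_linearIsometryEquiv])] at h4
  rw [re_epsteinZeta_eq hn0 L.2 hs0 hs, re_epsteinZeta_eq hn0 M.2 hs0 hs]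
  have hG := Real.Gamma_pos_of_pos hs0
  have hπ := Real.pi_pos
  gcongr

/-- The height of the torus of a deformation of `L*` is read off, at `s = 0`, from the dual lattice,
which is the inverse deformation of `L`. -/
theorem isStrictLocalMinLattice_torusHeight {L : UnimodularLattice n}
    (hL : L.1.LayersHoldDesign 4) : IsStrictLocalMinLattice torusHeight L.dual := by
  rcases lt_or_ge n 2 with hn | hn
  · exact isStrictLocalMinLattice_of_spectralMap one_pos fun v h u h1 h2 =>
      absurd (two_le_of_sum_eq_zero h1 h2) (not_le.2 hn)
  have hn0 : 0 < n := by omega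
  obtain ⟨δ, hδ, H⟩ := exists_Λ₀_lt_of_pos hn L.2 hL hn0 (mellin_designKernel_zero_re_pos hn L.2 hL)
  obtain ⟨K, hK⟩ := exists_torusHeight_eq hn0
  refine isStrictLocalMinLattice_of_spectralMap hδ fun v h u h1 h2 h3 M hM => ?_
  have h1' : ∑ i, (-h) i = 0 := by simp [h1]
  have h2' : -h ≠ 0 := neg_ne_zero.2 h2
  have hcov := (covol_map_spectralMap v (-h) L.1 h1').trans L.2
  have h4 := H v (-h) h1' h2' (by simpa using h3) hcov
  have hdual : M.1.dual = (L.1.map (spectralMap v (-h))).map u.toLinearEquiv := by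
    rw [hM, dual_map u.toLinearEquiv u.toLinearEquiv _ fun x y => u.inner_map_map y x,
      dual_map _ (spectralMap v (-h)) _ (inner_spectralMap_neg v h),
      show L.dual.1 = L.1.dual from rfl, dual_dual]
  rw [← Λ₀_eq_of_theta_eq hn0 hcov (M.1.covol_dual M.2)
      (fun t => by rw [hdual, theta_map_linearIsometryEquiv]),
    ← Λ₀_eq_of_theta_eq hn0 L.2 (L.dual.1.covol_dual L.dual.2)
      (fun t => by rw [show L.dual.1 = L.1.dual from rfl, dual_dual])] at h4
  rw [hK M.1 (M.1.covol_dual M.2), hK L.dual.1 (L.dual.1.covol_dual L.dual.2)]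
  rw [Complex.ofReal_zero] at h4
  linarith

theorem isMeromorphicContinuation_torusZeta (Λ : EuclideanLattice n) (hΛ : Λ.covol = 1) :
    IsMeromorphicContinuation ((n : ℝ) / 2) (torusZetaTerm Λ) (torusZeta Λ) :=
  (isMeromorphicContinuation_torusZeta_of Λ
    (Λ.dual.isMeromorphicContinuation_epsteinZeta (Λ.covol_dual hΛ))).continuedSum_of

end EuclideanLattice

theorem mainTheorem1 (n : ℕ) :
    (∀ M : UnimodularLattice n,
      IsMeromorphicContinuation ((n : ℝ) / 2) (epsteinTerm M.1) (epsteinZeta M.1) ∧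
      IsMeromorphicContinuation ((n : ℝ) / 2) (torusZetaTerm M.1) (torusZeta M.1)) ∧
    ∀ L : UnimodularLattice n, L.1.LayersHoldDesign 4 →
      (∀ s : ℝ, (n : ℝ) / 2 < s → IsZetaExtreme L s) ∧
      IsStrictLocalMinLattice torusHeight L.dual ∧
      ((∀ s : ℝ, 0 < s → s < (n : ℝ) / 2 → (epsteinZeta L.1 (s : ℂ)).re < 0) →
        ∀ s : ℝ, 0 < s → s ≠ (n : ℝ) / 2 → IsZetaExtreme L s) := by
  refine ⟨fun M => ⟨M.1.isMeromorphicContinuation_epsteinZeta M.2,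
    M.1.isMeromorphicContinuation_torusZeta M.2⟩, fun L hL => ?_⟩
  have hright : ∀ s : ℝ, (n : ℝ) / 2 < s → IsZetaExtreme L s := fun s hs =>
    EuclideanLattice.isZetaExtreme_of_pos hL (lt_of_le_of_lt (by positivity) hs) hs.ne' fun hn =>
      mul_pos (sub_pos.2 hs) (EuclideanLattice.epsteinZeta_re_pos hn L.2 hs)
  refine ⟨hright, EuclideanLattice.isStrictLocalMinLattice_torusHeight hL, fun hneg s hs0 hs => ?_⟩
  rcases lt_or_gt_of_ne hs with hlt | hgt
  · exact EuclideanLattice.isZetaExtreme_of_pos hL hs0 hs fun _ =>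
      mul_pos_of_neg_of_neg (sub_neg.2 hlt) (hneg s hs0 hlt)
  · exact hright s hgt
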